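/- Let $d\ge 2$, $\gamma>0$, $R>0$, and let $B=\{x\in\mathbb R^d:|x|<R\}$. Call $D_1\in L^\infty(\mathbb R^d)$ admissible if $D_1=0$ a.e. outside $\overline B$ and $\gamma+D_1\ge c$ a.e. for some constant $c>0$, and spherically symmetric if $D_1(x)$ is a.e. a function of $|x|$. For a multi-index $j\in\mathbb N^d$ let $\phi_j\in H^1_{\rm loc}(\mathbb R^d)\cap C^\infty(\mathbb R^d\setminus\overline B)$ be the solution of $$\nabla\cdot(\gamma+D_1)\nabla\phi_j=-\nabla\cdot(\mathbf 1_B D_1\nabla x^j)\ \text{ in }\mathcal D'(\mathbb R^d),\qquad \phi_j(x)=O(|x|^{1-d})\ \text{ as }|x|\to\infty,$$ and put $M_{ij}=\int_B D_1\,\nabla(x^j+\phi_j)\cdot\nabla x^i\,dx$. (1) There exists an admissible, spherically symmetric $D_1\not\equiv 0$ such that the $\phi_j$ with $|j|=1$ exist and $M_{ij}=0$ for all $|i|=|j|=1$. (2) For every such inclusion the boundary influence is at most of order $\varepsilon^{d+1}$. That is, let $D_1$ be admissible and spherically symmetric, with $M_{ij}=0$ for all $|i|=|j|=1$. Let $\Omega\subset\mathbb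 R^d$ be a bounded (connected) domain with Lipschitz boundary, $D_0\in C^\infty(\overline\Omega)$ bounded from below by a positive constant, $x_0\in\Omega$ and $D_0(x_0)=\gamma$. Then there are $C,\varepsilon_0>0$ such that for all $0<\varepsilon\le\varepsilon_0$ and all $g\in L^2(\partial\Omega)$ with $\int_{\partial\Omega}g\,d\sigma=0$, $$\|u^\varepsilon-U\|_{L^2(\partial\Omega)}\le C\,\varepsilon^{d+1}\,\|g\|_{L^2(\partial\Omega)},$$ where $u^\varepsilon,U\in H^1(\Omega)$ are the variational solutions of $\nabla\cdot D^\varepsilon\nabla u^\varepsilon=0$ and $\nabla\cdot D_0\nabla U=0$ in $\Omega$ with $D^\varepsilon\partial_n u^\varepsilon=D_0\,\partial_n U=g$ on $\partial\Omega$ and $\int_{\partial\Omega}u^\varepsilon d\sigma=\int_{\partial\Omega}U\,d\sigma=0$, and $D^\varepsilon(x)=D_0(x)+D_1\big((x-x_0)/\varepsilon\big)$. -/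

import Mathlib

open MeasureTheory Filter Topology Metric
open scoped ContDiff Gradient NNReal ENNReal

namespace SmallInclusion

noncomputable section

/-- Euclidean space of dimension `d`. -/
abbrev Space (d : ℕ) : Type := EuclideanSpace ℝ (Fin d)

/-- `G` is the weak gradient of `u` in the open set `Ω`. -/
def HasWeakGradient {d : ℕ} (Ω : Set (Space d)) (u : Space d → ℝ) (G : Space d → Space d) : Prop :=
  LocallyIntegrableOn u Ω volume ∧ LocallyIntegrableOn G Ω volume ∧
    ∀ η : Space d → ℝ, ContDiff ℝ ∞ η → HasCompactSupport η → tsupport η ⊆ Ω →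
      ∫ x in Ω, u x • ∇ η x = - ∫ x in Ω, η x • G x

/-- The Sobolev space `H¹(Ω)`: `u` is in it, with weak gradient `G`. -/
def MemH1 {d : ℕ} (Ω : Set (Space d)) (u : Space d → ℝ) (G : Space d → Space d) : Prop :=
  HasWeakGradient Ω u G ∧ MemLp u 2 (volume.restrict Ω) ∧ MemLp G 2 (volume.restrict Ω)

/-- The space `H¹_loc(ℝ^d)`: `u` is in it, with weak gradient `G`. -/
def MemH1Loc {d : ℕ} (u : Space d → ℝ) (G : Space d → Space d) : Prop :=
  HasWeakGradient Set.univ u G ∧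
    ∀ K : Set (Space d), IsCompact K →
      MemLp u 2 (volume.restrict K) ∧ MemLp G 2 (volume.restrict K)

/-! ### The polarization tensor -/

/-- The order `|i| = i_1 + ... + i_d` of a multi-index. -/
def order {d : ℕ} (i : Fin d → ℕ) : ℕ := ∑ k, i k

/-- The monomial `x^i = x_1^{i_1} ... x_d^{i_d}`. -/
def monomial {d : ℕ} (i : Fin d → ℕ) (x : Space d) : ℝ := ∏ k, x k ^ i k

/-- `D₁` is an admissible perturbation in the inclusion `B` of a background of value `γ`:
it is in `L^∞`, vanishes outside the closure of `B`, and `γ + D₁` is bounded from below by a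
positive constant. -/
structure IsPerturbation {d : ℕ} (γ : ℝ) (B : Set (Space d)) (D₁ : Space d → ℝ) : Prop where
  memLp : MemLp D₁ ⊤ volume
  vanish : ∀ᵐ x ∂(volume : Measure (Space d)), x ∉ closure B → D₁ x = 0
  elliptic : ∃ c : ℝ, 0 < c ∧ ∀ᵐ x ∂(volume : Measure (Space d)), c ≤ γ + D₁ x

/-- Spherical symmetry of an element of `L^∞`: it is almost everywhere a function of `|x|`. -/
def IsSphericallySymmetric {d : ℕ} (D₁ : Space d → ℝ) : Prop :=
  ∃ f : ℝ → ℝ, D₁ =ᵐ[volume] fun x => f ‖x‖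

/-- `φ`, with weak gradient `G`, is the solution in `H¹_loc(ℝ^d) ∩ C^∞(ℝ^d ∖ closure B)` of
`∇ · (γ + D₁) ∇φ = - ∇ · (1_B D₁ ∇ x^j)` in the sense of distributions on `ℝ^d`,
with `φ(x) = O(|x|^{1-d})` at infinity. The distributional equation on the whole space contains
the harmonicity outside the inclusion and the jump condition for the flux across `∂B`. -/
structure IsCorrector {d : ℕ} (γ : ℝ) (B : Set (Space d)) (D₁ : Space d → ℝ) (j : Fin d → ℕ)
    (φ : Space d → ℝ) (G : Space d → Space d) : Prop where
  memH1Loc : MemH1Loc φ G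
  smooth : ContDiffOn ℝ ∞ φ (closure B)ᶜ
  equation : ∀ v : Space d → ℝ, ContDiff ℝ ∞ v → HasCompactSupport v →
    ∫ x, (γ + D₁ x) * inner ℝ (G x) (∇ v x)
      = - ∫ x in B, D₁ x * inner ℝ (∇ (monomial j) x) (∇ v x)
  decay : φ =O[Bornology.cobounded (Space d)] fun x => ‖x‖ ^ (1 - (d : ℤ))

/-- The entry `M_{ij} = ∫_B D₁ ∇(x^j + φ_j) · ∇x^i dx`, where `G = ∇φ_j` is the weak gradient of
the corrector of index `j`. -/
def polarizationEntry {d : ℕ} (B : Set (Space d)) (D₁ : Space d → ℝ) (G : Space d → Space d)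
    (i j : Fin d → ℕ) : ℝ :=
  ∫ x in B, D₁ x * inner ℝ (∇ (monomial j) x + G x) (∇ (monomial i) x)

/-- The leading polarization tensor vanishes: for all `|i| = |j| = 1`, the corrector of index `j`
exists and `M_{ij} = 0` (whichever representative of the corrector and of its weak gradient is
used). -/
def LeadingTensorVanishes {d : ℕ} (γ : ℝ) (B : Set (Space d)) (D₁ : Space d → ℝ) : Prop :=
  ∀ i j : Fin d → ℕ, order i = 1 → order j = 1 →
    (∃ φ G, IsCorrector γ B D₁ j φ G) ∧
      ∀ φ G, IsCorrector γ B D₁ j φ G → polarizationEntry B D₁ G i j = 0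

/-! ### The Neumann problem in a Lipschitz domain -/

/-- A bounded domain with Lipschitz boundary: near each boundary point, `Ω` is the part above the
graph of a Lipschitz function over the hyperplane orthogonal to a unit vector `ν`. (Only the values
of `h` on that hyperplane are used.) -/
structure IsLipschitzDomain {d : ℕ} (Ω : Set (Space d)) : Prop where
  isOpen : IsOpen Ω
  isConnected : IsConnected Ω
  isBounded : Bornology.IsBounded Ω
  lipschitz : ∀ p ∈ frontier Ω, ∃ (ν : Space d) (r : ℝ) (K : ℝ≥0) (h : Space d → ℝ),
    ‖ν‖ = 1 ∧ 0 < r ∧ LipschitzWith K h ∧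
      ∀ x ∈ ball p r, x ∈ Ω ↔ h (x - inner ℝ x ν • ν) < inner ℝ x ν

/-- The surface measure on `∂Ω`: the normalized `(d-1)`-dimensional Hausdorff measure. -/
def surfaceMeasure {d : ℕ} (Ω : Set (Space d)) : Measure (Space d) :=
  (Measure.euclideanHausdorffMeasure (d - 1)).restrict (frontier Ω)

/-- `T ∈ L²(∂Ω)` is the trace on `∂Ω` of `u ∈ H¹(Ω)` (with weak gradient `G`): it is the limit in
`L²(∂Ω)` of the boundary values of smooth functions on `ℝ^d` that converge to `u` in `H¹(Ω)`. -/
def IsTrace {d : ℕ} (Ω : Set (Space d)) (u : Space d → ℝ) (G : Space d → Space d)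
    (T : Space d → ℝ) : Prop :=
  MemLp T 2 (surfaceMeasure Ω) ∧
    ∃ w : ℕ → Space d → ℝ, (∀ n, ContDiff ℝ ∞ (w n)) ∧
      Tendsto (fun n => eLpNorm (fun x => w n x - u x) 2 (volume.restrict Ω)) atTop (𝓝 0) ∧
      Tendsto (fun n => eLpNorm (fun x => ∇ (w n) x - G x) 2 (volume.restrict Ω)) atTop (𝓝 0) ∧
      Tendsto (fun n => eLpNorm (fun x => w n x - T x) 2 (surfaceMeasure Ω)) atTop (𝓝 0)

/-- Boundary data: `g ∈ L²(∂Ω)` with `∫_{∂Ω} g dσ = 0`. -/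
def IsNeumannData {d : ℕ} (Ω : Set (Space d)) (g : Space d → ℝ) : Prop :=
  MemLp g 2 (surfaceMeasure Ω) ∧ ∫ x, g x ∂(surfaceMeasure Ω) = 0

/-- `T` is the trace on `∂Ω` of a variational solution `u ∈ H¹(Ω)` of
`∇ · D ∇u = 0` in `Ω`, `D ∂u/∂n = g` on `∂Ω`, `∫_{∂Ω} u dσ = 0`. -/
def IsNeumannTrace {d : ℕ} (Ω : Set (Space d)) (D g : Space d → ℝ) (T : Space d → ℝ) : Prop :=
  ∃ (u : Space d → ℝ) (G : Space d → Space d), MemH1 Ω u G ∧ IsTrace Ω u G T ∧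
    ∫ x, T x ∂(surfaceMeasure Ω) = 0 ∧
    ∀ v : Space d → ℝ, ContDiff ℝ ∞ v →
      ∫ x in Ω, D x * inner ℝ (G x) (∇ v x) = ∫ x, g x * v x ∂(surfaceMeasure Ω)

/-- A background coefficient: `D₀ ∈ C^∞(closure Ω)`, bounded from below by a positive constant. -/
def IsBackground {d : ℕ} (Ω : Set (Space d)) (D₀ : Space d → ℝ) : Prop :=
  ContDiffOn ℝ ∞ D₀ (closure Ω) ∧ ∃ c : ℝ, 0 < c ∧ ∀ x ∈ closure Ω, c ≤ D₀ x

/-- The perturbed coefficient `D^ε(x) = D₀(x) + D₁((x - x₀)/ε)`. -/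
def perturbedCoeff {d : ℕ} (D₀ D₁ : Space d → ℝ) (x₀ : Space d) (ε : ℝ) (x : Space d) : ℝ :=
  D₀ x + D₁ (ε⁻¹ • (x - x₀))

/-- The influence of the inclusion on the boundary values is at most of order `ε^{d+1}`: for
`0 < ε ≤ ε₀`, `‖u^ε - U‖_{L²(∂Ω)} ≤ C ε^{d+1} ‖g‖_{L²(∂Ω)}`, with `C` and `ε₀` independent of `ε`
and of the boundary data. -/
def BoundaryInfluenceOrderSucc {d : ℕ} (Ω : Set (Space d)) (D₀ D₁ : Space d → ℝ)
    (x₀ : Space d) : Prop :=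
  ∃ C ε₀ : ℝ, 0 < C ∧ 0 < ε₀ ∧ ∀ ε : ℝ, 0 < ε → ε ≤ ε₀ →
    ∀ g Tε T₀ : Space d → ℝ, IsNeumannData Ω g →
      IsNeumannTrace Ω (perturbedCoeff D₀ D₁ x₀ ε) g Tε → IsNeumannTrace Ω D₀ g T₀ →
      eLpNorm (fun x => Tε x - T₀ x) 2 (surfaceMeasure Ω)
        ≤ ENNReal.ofReal (C * ε ^ (d + 1)) * eLpNorm g 2 (surfaceMeasure Ω)

end

end SmallInclusion

namespace SmallInclusion

noncomputable section

/-! ### Weighted pairings of square integrable fields -/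

section Pairing

variable {α : Type*} [MeasurableSpace α] {μ : Measure α}
  {E : Type*} [NormedAddCommGroup E]

/-! The boundary estimate is a duality argument. Write `G` and `G₀` for the gradients of `u^ε` and
`U`, `D₁^ε` for `x ↦ D₁((x - x₀)/ε)`, and let `F` be the gradient of the background solution whose
Neumann flux is the difference of the two traces. Green's formula gives `‖T^ε - T₀‖² = ∫ D₀ F·(G -
G₀) = -∫ D₁^ε F·G`. The last integral lives on a ball of radius `εR`. There `F` and `G₀` are bounded
by interior regularity, and the energy estimate `mul_lpNorm_sub_le` bounds the `L²` norm of `G` over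
that ball by that of `G₀`. This alone yields `ε^d`; for one more power the leading term `∫ D₁^ε
b·G`, with `b = F(x₀)`, must cancel to first order.

The cancellation comes from correctors that vanish identically outside the inclusion. If `Ψ` is the
gradient of such a corrector for the direction `b`, the rescaled field `Ψ^ε` is the gradient of an
`H¹` function supported inside `Ω`, so the equation of `u^ε` gives `∫ (D₀ + D₁^ε) G·Ψ^ε = 0`. The
equation of the corrector, tested with `u^ε`, gives `∫ (γ + D₁^ε) Ψ^ε·G = -∫ D₁^ε b·G`. Subtracting,
`∫ D₁^ε b·G = ∫ (D₀ - γ) Ψ^ε·G`, and `D₀ - γ = O(ε)` on the inclusion. The other remainder contains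
`F - b = O(ε)`. Each is of size `ε · ε^{d/2} · ε^{d/2}` (`exists_abs_integral_le`).

That the first-order correctors vanish outside the ball is where spherical symmetry and the
vanishing tensor enter (`exists_compact_correctors`). Decaying solutions are unique up to what
happens inside the ball, by Caccioppoli's inequality, so the family of correctors commutes with
rotations and `φ_j = x_j W(x)` outside, with `W` radial (`exists_profile`). Harmonicity would give
`W = a + b|x|^{-d}`, where decay excludes `a` and `b` is a multiple of `M_jj`. The argument here
avoids the ODE: testing with `η(|x|²) x_j`, where `η` is constant on the inclusion, turns `M_jj = 0`
into the weak vanishing of the radial derivative of `W`. Then `W` has zero gradient and decays,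
hence is zero (`profile_eq_zero`).

For existence, the solution rather than the coefficient is prescribed: `x_i μ(|x|²)` with `μ = 1`
near and beyond the boundary of the ball. The equation for a radial coefficient `K(|x|²)` is then a
linear first-order ODE in the squared radius, solved by an exponential (`exists_neutral_profile`).
Pairing any corrector with the resulting explicit one shows that the tensor vanishes
(`exists_neutral`).

The supporting analysis is a Poincaré trace inequality in Lipschitz domains
(`exists_abs_integral_boundary_le`), Lax–Milgram for the auxiliary Neumann problem
(`exists_solvesNeumann`), and interior Lipschitz bounds for solution fields from the decay of
localized Fourier coefficients (`exists_regularity`). -/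

lemma integral_norm_mul_norm_le {F G : α → E} (hF : MemLp F 2 μ) (hG : MemLp G 2 μ) :
    ∫ x, ‖F x‖ * ‖G x‖ ∂μ ≤ lpNorm F 2 μ * lpNorm G 2 μ := by
  -- Cauchy–Schwarz is applied to the scalar functions `‖F‖` and `‖G‖`, so `E` needs no inner
  -- product.
  have h := real_inner_le_norm (hF.norm.toLp _) (hG.norm.toLp _)
  rw [L2.inner_def, Lp.norm_toLp, Lp.norm_toLp, eLpNorm_norm, eLpNorm_norm,
    toReal_eLpNorm hF.1, toReal_eLpNorm hG.1] at h
  refine le_trans (le_of_eq (integral_congr_ae ?_)) h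
  filter_upwards [hF.norm.coeFn_toLp, hG.norm.coeFn_toLp] with x h1 h2
  rw [h1, h2]
  simp [mul_comm]

lemma integral_norm_sq_eq_lpNorm {F : α → E} (hF : MemLp F 2 μ) :
    ∫ x, ‖F x‖ ^ 2 ∂μ = lpNorm F 2 μ ^ 2 := by
  have h := real_inner_self_eq_norm_sq (hF.norm.toLp _)
  rw [L2.inner_def, Lp.norm_toLp, eLpNorm_norm, toReal_eLpNorm hF.1] at h
  rw [← h]
  refine integral_congr_ae ?_
  filter_upwards [hF.norm.coeFn_toLp] with x h1
  rw [h1]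
  simp [sq]

lemma tendsto_lpNorm_sub {F : ℕ → α → E} {F₀ : α → E} (hF₀ : MemLp F₀ 2 μ)
    (hF : ∀ n, MemLp (F n) 2 μ)
    (h : Tendsto (fun n => eLpNorm (fun x => F n x - F₀ x) 2 μ) atTop (𝓝 0)) :
    Tendsto (fun n => lpNorm (fun x => F n x - F₀ x) 2 μ) atTop (𝓝 0) := by
  have h1 := (ENNReal.tendsto_toReal ENNReal.zero_ne_top).comp h
  simp only [ENNReal.toReal_zero] at h1
  refine h1.congr fun n => ?_
  exact toReal_eLpNorm ((hF n).sub hF₀).1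

variable [InnerProductSpace ℝ E]

lemma integrable_mul_inner {D : α → ℝ} {K : ℝ} {F G : α → E} (hD : AEStronglyMeasurable D μ)
    (hK : ∀ᵐ x ∂μ, |D x| ≤ K) (hF : MemLp F 2 μ) (hG : MemLp G 2 μ) :
    Integrable (fun x => D x * inner ℝ (F x) (G x)) μ := by
  have h1 : Integrable (fun x => ‖F x‖ * ‖G x‖) μ := hF.norm.integrable_mul hG.norm
  refine (h1.const_mul K).mono' (hD.mul (hF.1.inner hG.1)) ?_
  filter_upwards [hK] with x hx
  rw [norm_mul, Real.norm_eq_abs]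
  exact mul_le_mul hx (norm_inner_le_norm _ _) (norm_nonneg _) ((abs_nonneg _).trans hx)

lemma abs_integral_mul_inner_le {D : α → ℝ} {K : ℝ} {F G : α → E} (hK0 : 0 ≤ K)
    (hK : ∀ᵐ x ∂μ, |D x| ≤ K) (hF : MemLp F 2 μ) (hG : MemLp G 2 μ) :
    |∫ x, D x * inner ℝ (F x) (G x) ∂μ| ≤ K * (lpNorm F 2 μ * lpNorm G 2 μ) := by
  have h1 : Integrable (fun x => ‖F x‖ * ‖G x‖) μ := hF.norm.integrable_mul hG.norm
  have h2 : ‖∫ x, D x * inner ℝ (F x) (G x) ∂μ‖ ≤ ∫ x, K * (‖F x‖ * ‖G x‖) ∂μ := by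
    refine norm_integral_le_of_norm_le (h1.const_mul K) ?_
    filter_upwards [hK] with x hx
    rw [norm_mul, Real.norm_eq_abs]
    exact mul_le_mul hx (norm_inner_le_norm _ _) (norm_nonneg _) ((abs_nonneg _).trans hx)
  rw [integral_const_mul] at h2
  exact h2.trans (mul_le_mul_of_nonneg_left (integral_norm_mul_norm_le hF hG) hK0)

/-- Coercivity of the weighted pairing. -/
lemma mul_lpNorm_sq_le_integral {D : α → ℝ} {K c : ℝ} {F : α → E} (hD : AEStronglyMeasurable D μ)
    (hK : ∀ᵐ x ∂μ, |D x| ≤ K) (hc : ∀ᵐ x ∂μ, c ≤ D x) (hF : MemLp F 2 μ) :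
    c * lpNorm F 2 μ ^ 2 ≤ ∫ x, D x * inner ℝ (F x) (F x) ∂μ := by
  rw [← integral_norm_sq_eq_lpNorm hF, ← integral_const_mul]
  refine integral_mono_ae (((memLp_two_iff_integrable_sq_norm hF.1).1 hF).const_mul c)
    (integrable_mul_inner hD hK hF hF) ?_
  filter_upwards [hc] with x hx
  rw [real_inner_self_eq_norm_sq]
  exact mul_le_mul_of_nonneg_right hx (by positivity)

lemma tendsto_integral_mul_inner_left {D : α → ℝ} {K : ℝ} {F : ℕ → α → E} {F₀ G : α → E}
    (hD : AEStronglyMeasurable D μ) (hK : ∀ᵐ x ∂μ, |D x| ≤ K) (hF₀ : MemLp F₀ 2 μ)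
    (hF : ∀ n, MemLp (F n) 2 μ) (hG : MemLp G 2 μ)
    (h : Tendsto (fun n => eLpNorm (fun x => F n x - F₀ x) 2 μ) atTop (𝓝 0)) :
    Tendsto (fun n => ∫ x, D x * inner ℝ (F n x) (G x) ∂μ) atTop
      (𝓝 (∫ x, D x * inner ℝ (F₀ x) (G x) ∂μ)) := by
  have hK' : ∀ᵐ x ∂μ, |D x| ≤ max K 0 := hK.mono fun x hx => hx.trans (le_max_left _ _)
  rw [tendsto_iff_norm_sub_tendsto_zero]
  have h1 := ((tendsto_lpNorm_sub hF₀ hF h).mul_const (lpNorm G 2 μ)).const_mul (max K 0)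
  rw [zero_mul, mul_zero] at h1
  refine squeeze_zero (fun _ => norm_nonneg _) (fun n => ?_) h1
  rw [← integral_sub (integrable_mul_inner hD hK (hF n) hG) (integrable_mul_inner hD hK hF₀ hG)]
  have := abs_integral_mul_inner_le (le_max_right K 0) hK' ((hF n).sub hF₀) hG
  refine le_trans (le_of_eq ?_) this
  rw [Real.norm_eq_abs]
  congr 2
  ext x
  simp [inner_sub_left, mul_sub]

lemma tendsto_integral_mul_inner_right {D : α → ℝ} {K : ℝ} {F : ℕ → α → E} {F₀ G : α → E}
    (hD : AEStronglyMeasurable D μ) (hK : ∀ᵐ x ∂μ, |D x| ≤ K) (hF₀ : MemLp F₀ 2 μ)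
    (hF : ∀ n, MemLp (F n) 2 μ) (hG : MemLp G 2 μ)
    (h : Tendsto (fun n => eLpNorm (fun x => F n x - F₀ x) 2 μ) atTop (𝓝 0)) :
    Tendsto (fun n => ∫ x, D x * inner ℝ (G x) (F n x) ∂μ) atTop
      (𝓝 (∫ x, D x * inner ℝ (G x) (F₀ x) ∂μ)) := by
  simp_rw [fun x => real_inner_comm (F₀ x) (G x), fun n x => real_inner_comm (F n x) (G x)]
  exact tendsto_integral_mul_inner_left hD hK hF₀ hF hG h

end Pairing

/-! ### Gradients and integration by parts -/

section Gradient

variable {d : ℕ}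

/-- The standard basis vector. -/
abbrev basisVec (k : Fin d) : Space d := EuclideanSpace.single k 1

lemma inner_gradient_left (f : Space d → ℝ) (x v : Space d) :
    inner ℝ (∇ f x) v = fderiv ℝ f x v := by
  rw [← InnerProductSpace.toDual_apply_apply (𝕜 := ℝ), toDual_gradient]

lemma inner_gradient_right (f : Space d → ℝ) (x v : Space d) :
    inner ℝ v (∇ f x) = fderiv ℝ f x v := by
  rw [real_inner_comm, inner_gradient_left]

lemma gradient_apply (f : Space d → ℝ) (x : Space d) (k : Fin d) :
    ∇ f x k = fderiv ℝ f x (basisVec k) := by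
  rw [← inner_gradient_left, EuclideanSpace.inner_single_right]
  simp

lemma norm_gradient (f : Space d → ℝ) (x : Space d) : ‖∇ f x‖ = ‖fderiv ℝ f x‖ := by
  rw [gradient, LinearIsometryEquiv.norm_map]

lemma inner_eq_sum (x y : Space d) : inner ℝ x y = ∑ k, x k * y k := by
  simp [PiLp.inner_apply, mul_comm]

lemma contDiff_gradient {f : Space d → ℝ} (hf : ContDiff ℝ ∞ f) : ContDiff ℝ ∞ (∇ f) := by
  have := hf.fderiv_right (m := ∞) (by simp)
  exact (InnerProductSpace.toDual ℝ (Space d)).symm.contDiff.comp this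

lemma support_gradient_subset (f : Space d → ℝ) : Function.support (∇ f) ⊆ tsupport f := by
  intro x hx
  refine support_fderiv_subset ℝ ?_
  rw [Function.mem_support] at hx ⊢
  intro h
  exact hx (by rw [gradient, h, map_zero])

lemma hasCompactSupport_gradient {f : Space d → ℝ} (hf : HasCompactSupport f) :
    HasCompactSupport (∇ f) :=
  hf.mono' (support_gradient_subset f)

lemma gradient_eq_zero_of_notMem_tsupport {f : Space d → ℝ} {x : Space d} (hx : x ∉ tsupport f) :
    ∇ f x = 0 := by
  by_contra h
  exact hx (support_gradient_subset f h)

lemma gradient_mul {f g : Space d → ℝ} {x : Space d} (hf : DifferentiableAt ℝ f x)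
    (hg : DifferentiableAt ℝ g x) :
    ∇ (fun y => f y * g y) x = f x • ∇ g x + g x • ∇ f x := by
  simp only [gradient]
  rw [fderiv_fun_mul hf hg]
  simp

lemma gradient_sub {f g : Space d → ℝ} {x : Space d} (hf : DifferentiableAt ℝ f x)
    (hg : DifferentiableAt ℝ g x) :
    ∇ (fun y => f y - g y) x = ∇ f x - ∇ g x := by
  simp only [gradient]
  rw [fderiv_fun_sub hf hg]
  simp

lemma gradient_add {f g : Space d → ℝ} {x : Space d} (hf : DifferentiableAt ℝ f x)
    (hg : DifferentiableAt ℝ g x) :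
    ∇ (fun y => f y + g y) x = ∇ f x + ∇ g x := by
  simp only [gradient]
  rw [fderiv_fun_add hf hg]
  simp

lemma gradient_sub_const (f : Space d → ℝ) (c : ℝ) :
    ∇ (fun y => f y - c) = ∇ f := by
  ext1 x
  simp only [gradient, fderiv_sub_const]

lemma memLp_of_continuous_isBounded {E : Type*} [NormedAddCommGroup E]
    {S : Set (Space d)} (hS : Bornology.IsBounded S)
    {f : Space d → E} (hf : Continuous f) {p : ℝ≥0∞} : MemLp f p (volume.restrict S) := by
  have hfin : IsFiniteMeasure (volume.restrict S) := ⟨by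
    rw [Measure.restrict_apply_univ]; exact hS.measure_lt_top⟩
  obtain ⟨C, hC⟩ := (hS.isCompact_closure.image hf).isBounded.exists_norm_le
  refine MemLp.of_bound hf.aestronglyMeasurable C ?_
  have : ∀ᵐ x ∂(volume.restrict (closure S)), ‖f x‖ ≤ C := by
    filter_upwards [ae_restrict_mem isClosed_closure.measurableSet] with x hx
    exact hC _ (Set.mem_image_of_mem f hx)
  exact ae_mono (Measure.restrict_mono subset_closure le_rfl) this

lemma integral_mul_fderiv_eq {f g : Space d → ℝ} (hf : ContDiff ℝ 1 f) (hg : ContDiff ℝ 1 g)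
    (h : HasCompactSupport f ∨ HasCompactSupport g) (v : Space d) :
    ∫ x, f x * fderiv ℝ g x v = - ∫ x, fderiv ℝ f x v * g x := by
  have cf := hf.continuous
  have cg := hg.continuous
  have cf' : Continuous fun x => fderiv ℝ f x v :=
    (hf.continuous_fderiv one_ne_zero).clm_apply continuous_const
  have cg' : Continuous fun x => fderiv ℝ g x v :=
    (hg.continuous_fderiv one_ne_zero).clm_apply continuous_const
  have sf (hc : HasCompactSupport f) : HasCompactSupport fun x => fderiv ℝ f x v :=
    hc.fderiv_apply ℝ v
  have sg (hc : HasCompactSupport g) : HasCompactSupport fun x => fderiv ℝ g x v :=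
    hc.fderiv_apply ℝ v
  refine integral_mul_fderiv_eq_neg_fderiv_mul_of_integrable
    ((cf'.mul cg).integrable_of_hasCompactSupport ?_)
    ((cf.mul cg').integrable_of_hasCompactSupport ?_)
    ((cf.mul cg).integrable_of_hasCompactSupport ?_)
    (fun x _ => hf.differentiable one_ne_zero x) (fun x _ => hg.differentiable one_ne_zero x)
  · rcases h with h | h
    · exact (sf h).mul_right
    · exact h.mul_left
  · rcases h with h | h
    · exact h.mul_right
    · exact (sg h).mul_left
  · rcases h with h | h
    · exact h.mul_right
    · exact h.mul_left

lemma integral_fderiv_eq_zero {f : Space d → ℝ} (hf : ContDiff ℝ 1 f) (h : HasCompactSupport f)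
    (v : Space d) : ∫ x, fderiv ℝ f x v = 0 := by
  have := integral_mul_fderiv_eq (contDiff_const (c := (1 : ℝ))) hf (Or.inr h) v
  simpa using this

end Gradient

/-! ### Mollification in `L²` -/

section Mollify

open ContinuousLinearMap

variable {d : ℕ} {E : Type*} [NormedAddCommGroup E] [NormedSpace ℝ E]

lemma sq_lintegral_le_of_isProbabilityMeasure {α : Type*} [MeasurableSpace α] {μ : Measure α}
    [IsProbabilityMeasure μ] {F : α → ℝ≥0∞} (hF : AEMeasurable F μ) :
    (∫⁻ x, F x ∂μ) ^ 2 ≤ ∫⁻ x, F x ^ 2 ∂μ := by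
  have h := ENNReal.lintegral_mul_le_Lp_mul_Lq μ Real.HolderConjugate.two_two hF
    (aemeasurable_const (b := (1 : ℝ≥0∞)))
  simp only [Pi.mul_apply, mul_one, ENNReal.one_rpow, lintegral_const, measure_univ] at h
  calc (∫⁻ x, F x ∂μ) ^ 2 ≤ ((∫⁻ x, F x ^ (2 : ℝ) ∂μ) ^ (1 / (2 : ℝ))) ^ 2 := by gcongr
    _ = ∫⁻ x, F x ^ 2 ∂μ := by
      rw [← ENNReal.rpow_natCast, ← ENNReal.rpow_mul]
      norm_num

lemma eLpNorm_two_sq {α : Type*} [MeasurableSpace α] {μ : Measure α} {F : Type*}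
    [NormedAddCommGroup F] (f : α → F) :
    eLpNorm f 2 μ ^ 2 = ∫⁻ x, ‖f x‖ₑ ^ 2 ∂μ := by
  rw [eLpNorm_eq_lintegral_rpow_enorm_toReal two_ne_zero ENNReal.ofNat_ne_top,
    ← ENNReal.rpow_natCast, ← ENNReal.rpow_mul]
  norm_num

/-- Convolution with a probability density does not increase the `L²` norm. -/
lemma eLpNorm_convolution_le {ρ : Space d → ℝ} (hρ : Continuous ρ) (h0 : ∀ x, 0 ≤ ρ x)
    (hi : Integrable ρ) (h1 : ∫ x, ρ x = 1) {g : Space d → E} (hg : AEStronglyMeasurable g) :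
    eLpNorm (convolution ρ g (lsmul ℝ ℝ) volume) 2 volume ≤ eLpNorm g 2 volume := by
  have hm : Measurable fun x => ‖ρ x‖ₑ := hρ.measurable.enorm
  -- With `ρ dx` as a probability measure, the square of the average is at most the average of the
  -- square; Tonelli and translation invariance do the rest.
  set ν : Measure (Space d) := volume.withDensity fun x => ‖ρ x‖ₑ with hν
  have hprob : IsProbabilityMeasure ν := by
    constructor
    rw [hν, withDensity_apply _ MeasurableSet.univ, Measure.restrict_univ,
      ← ofReal_integral_norm_eq_lintegral_enorm hi]
    simp_rw [Real.norm_of_nonneg (h0 _)]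
    rw [h1, ENNReal.ofReal_one]
  have hac : ν ≪ volume := withDensity_absolutelyContinuous _ _
  have hg2 : AEStronglyMeasurable (fun p : Space d × Space d => g (p.1 - p.2))
      (volume.prod volume) :=
    hg.comp_quasiMeasurePreserving (quasiMeasurePreserving_sub_of_right_invariant volume volume)
  have hgx (x : Space d) : AEStronglyMeasurable (fun t => g (x - t)) volume :=
    hg.comp_quasiMeasurePreserving (quasiMeasurePreserving_sub_left_of_right_invariant volume x)
  rw [← ENNReal.pow_le_pow_left_iff two_ne_zero, eLpNorm_two_sq, eLpNorm_two_sq]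
  calc ∫⁻ x, ‖convolution ρ g (lsmul ℝ ℝ) volume x‖ₑ ^ 2
      ≤ ∫⁻ x, ∫⁻ t, ‖ρ t‖ₑ * ‖g (x - t)‖ₑ ^ 2 := by
        refine lintegral_mono fun x => ?_
        have hx : ‖convolution ρ g (lsmul ℝ ℝ) volume x‖ₑ ≤ ∫⁻ t, ‖g (x - t)‖ₑ ∂ν := by
          rw [hν, lintegral_withDensity_eq_lintegral_mul₀ hm.aemeasurable (hgx x).enorm]
          refine (enorm_integral_le_lintegral_enorm _).trans (le_of_eq ?_)
          simp [enorm_smul]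
        refine (pow_le_pow_left' hx 2).trans ?_
        refine (sq_lintegral_le_of_isProbabilityMeasure ((hgx x).mono_ac hac).enorm).trans ?_
        rw [hν, lintegral_withDensity_eq_lintegral_mul₀ hm.aemeasurable ((hgx x).enorm.pow_const 2)]
        rfl
    _ = ∫⁻ t, ∫⁻ x, ‖ρ t‖ₑ * ‖g (x - t)‖ₑ ^ 2 := by
        have h2 : AEMeasurable (fun p : Space d × Space d => ‖ρ p.2‖ₑ * ‖g (p.1 - p.2)‖ₑ ^ 2)
            (volume.prod volume) :=
          (hm.comp measurable_snd).aemeasurable.mul (hg2.enorm.pow_const 2)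
        exact lintegral_lintegral_swap h2
    _ = ∫⁻ t, ‖ρ t‖ₑ * ∫⁻ x, ‖g x‖ₑ ^ 2 := by
        refine lintegral_congr fun t => ?_
        rw [lintegral_const_mul' _ _ enorm_ne_top,
          lintegral_sub_right_eq_self (fun x => ‖g x‖ₑ ^ 2) t]
    _ = ∫⁻ x, ‖g x‖ₑ ^ 2 := by
        rw [lintegral_mul_const _ hm]
        have := hprob.measure_univ
        rw [hν, withDensity_apply _ MeasurableSet.univ, Measure.restrict_univ] at this
        rw [this, one_mul]

/-- A sequence of bump functions concentrating at the origin. -/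
def bumpSeq (d : ℕ) (n : ℕ) : ContDiffBump (0 : Space d) where
  rIn := 1 / (2 * ((n : ℝ) + 1))
  rOut := 1 / ((n : ℝ) + 1)
  rIn_pos := by positivity
  rIn_lt_rOut := by
    apply one_div_lt_one_div_of_lt <;> linarith [(Nat.cast_nonneg n : (0 : ℝ) ≤ n)]

lemma bumpSeq_rOut_tendsto (d : ℕ) : Tendsto (fun n => (bumpSeq d n).rOut) atTop (𝓝 0) :=
  tendsto_one_div_add_atTop_nhds_zero_nat

/-- The mollification of `g` at scale `1 / (n + 1)`. -/
def mollify (n : ℕ) (g : Space d → E) : Space d → E :=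
  convolution ((bumpSeq d n).normed volume) g (lsmul ℝ ℝ) volume

lemma eLpNorm_mollify_le (n : ℕ) {g : Space d → E} (hg : AEStronglyMeasurable g) :
    eLpNorm (mollify n g) 2 volume ≤ eLpNorm g 2 volume :=
  eLpNorm_convolution_le (bumpSeq d n).continuous_normed (bumpSeq d n).nonneg_normed
    (bumpSeq d n).integrable_normed (bumpSeq d n).integral_normed hg

lemma mollify_eq_zero (n : ℕ) {g : Space d → E} {K : Set (Space d)} (hK : ∀ x ∉ K, g x = 0)
    {x : Space d} (hx : x ∉ thickening (1 / ((n : ℝ) + 1)) K) : mollify n g x = 0 := by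
  rw [mollify, convolution_def]
  refine integral_eq_zero_of_ae (Eventually.of_forall fun t => ?_)
  by_cases ht : t ∈ ball (0 : Space d) (bumpSeq d n).rOut
  · have : g (x - t) = 0 := hK _ fun h => hx <| by
      rw [mem_thickening_iff]
      refine ⟨x - t, h, ?_⟩
      rw [dist_eq_norm]
      simpa [bumpSeq] using! ht
    simp [this]
  · have : (bumpSeq d n).normed volume t = 0 := by
      rw [← (bumpSeq d n).support_normed_eq (μ := volume)] at ht
      simpa using ht
    simp [this]

lemma contDiff_mollify (n : ℕ) {g : Space d → E} (hg : LocallyIntegrable g) :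
    ContDiff ℝ ∞ (mollify n g) := by
  refine contDiff_infty.2 fun m => ?_
  exact (bumpSeq d n).hasCompactSupport_normed.contDiff_convolution_left _
    (bumpSeq d n).contDiff_normed hg

lemma mollify_sub (n : ℕ) {f g : Space d → E} (hf : LocallyIntegrable f)
    (hg : LocallyIntegrable g) : mollify n (f - g) = mollify n f - mollify n g := by
  ext1 x
  have hc : HasCompactSupport ((bumpSeq d n).normed (volume : Measure (Space d))) :=
    (bumpSeq d n).hasCompactSupport_normed
  have h1 := hc.convolutionExists_left (lsmul ℝ ℝ) (bumpSeq d n).continuous_normed hf x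
  have h2 := hc.convolutionExists_left (lsmul ℝ ℝ) (bumpSeq d n).continuous_normed hg x
  rw [Pi.sub_apply, mollify, mollify, mollify, convolution_def, convolution_def, convolution_def,
    ← integral_sub h1 h2]
  simp [smul_sub]

/-- Uniform continuity makes the error uniformly small, and for every `n` it is supported in the
closed 1-neighbourhood of the support of `g`, which has finite measure. -/
lemma tendsto_eLpNorm_mollify_sub_of_continuous [CompleteSpace E] {g : Space d → E} (hg : Continuous g)
    (hc : HasCompactSupport g) :
    Tendsto (fun n => eLpNorm (mollify n g - g) 2 volume) atTop (𝓝 0) := by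
  set K := cthickening 1 (tsupport g) with hK
  have hKc : IsCompact K := hc.cthickening
  have hKfin : volume K ≠ ⊤ := hKc.measure_lt_top.ne
  have huc := hg.uniformContinuous_of_tendsto_cocompact hc.is_zero_at_infty
  set A := volume K ^ (1 / (2 : ℝ≥0∞).toReal) with hA
  have hAfin : A ≠ ⊤ := ENNReal.rpow_ne_top_of_nonneg (by positivity) hKfin
  have key : ∀ δ : ℝ, 0 < δ → ∀ᶠ n in atTop,
      eLpNorm (mollify n g - g) 2 volume ≤ A * ENNReal.ofReal δ := by
    intro δ hδ
    obtain ⟨r, hr, hgr⟩ := Metric.uniformContinuous_iff.1 huc δ hδ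
    filter_upwards [(bumpSeq_rOut_tendsto d).eventually_lt_const hr] with n hn
    have hpt : ∀ x, ‖(mollify n g - g) x‖ ≤ δ := by
      intro x
      rw [Pi.sub_apply, ← dist_eq_norm]
      exact (bumpSeq d n).dist_normed_convolution_le hg.aestronglyMeasurable
        fun y hy => (hgr (lt_trans hy hn)).le
    have hout : ∀ x ∉ K, (mollify n g - g) x = 0 := by
      intro x hx
      have h1 : x ∉ tsupport g := fun h => hx (self_subset_cthickening _ h)
      have h2 : mollify n g x = 0 := by
        refine mollify_eq_zero n (K := tsupport g) (fun y hy => image_eq_zero_of_notMem_tsupport hy) ?_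
        intro h
        refine hx (thickening_subset_cthickening _ _ (thickening_mono ?_ _ h))
        rw [div_le_one (by positivity)]
        linarith [(Nat.cast_nonneg n : (0 : ℝ) ≤ n)]
      rw [Pi.sub_apply, h2, image_eq_zero_of_notMem_tsupport h1, sub_zero]
    have hind : mollify n g - g = K.indicator (mollify n g - g) := by
      ext1 x
      by_cases hx : x ∈ K
      · rw [Set.indicator_of_mem hx]
      · rw [Set.indicator_of_notMem hx, hout x hx]
    rw [hind, eLpNorm_indicator_eq_eLpNorm_restrict hKc.measurableSet]
    refine (eLpNorm_le_of_ae_bound (C := δ) (Eventually.of_forall hpt)).trans (le_of_eq ?_)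
    rw [Measure.restrict_apply_univ, hA, one_div]
  rw [ENNReal.tendsto_nhds_zero]
  intro ε hε
  by_cases hεt : ε = ⊤
  · simp [hεt]
  have hlim : Tendsto (fun δ : ℝ => A * ENNReal.ofReal δ) (𝓝[>] 0) (𝓝 0) := by
    have : Tendsto (fun δ : ℝ => A * ENNReal.ofReal δ) (𝓝 0) (𝓝 (A * ENNReal.ofReal 0)) :=
      ENNReal.Tendsto.const_mul (ENNReal.continuous_ofReal.tendsto 0) (Or.inr hAfin)
    simp only [ENNReal.ofReal_zero, mul_zero] at this
    exact this.mono_left nhdsWithin_le_nhds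
  obtain ⟨δ, hδ1, hδ⟩ := ((hlim.eventually_lt_const hε).and self_mem_nhdsWithin).exists
  filter_upwards [key δ hδ] with n hn
  exact hn.trans hδ1.le

/-- Mollifications converge in `L²`. -/
lemma tendsto_eLpNorm_mollify_sub [CompleteSpace E] {g : Space d → E} (hg : MemLp g 2 volume) :
    Tendsto (fun n => eLpNorm (mollify n g - g) 2 volume) atTop (𝓝 0) := by
  have hgl : LocallyIntegrable g := hg.locallyIntegrable (by norm_num)
  rw [ENNReal.tendsto_nhds_zero]
  intro ε hε
  have hε3 : ε / 3 ≠ 0 := (ENNReal.div_pos hε.ne' (by simp)).ne'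
  obtain ⟨h, hhc, hgh, hh, hhm⟩ := hg.exists_hasCompactSupport_eLpNorm_sub_le (by simp) hε3
  have hhl : LocallyIntegrable h := hhm.locallyIntegrable (by norm_num)
  filter_upwards [(ENNReal.tendsto_nhds_zero.1
    (tendsto_eLpNorm_mollify_sub_of_continuous hh hhc)) (ε / 3) (pos_iff_ne_zero.2 hε3)] with n hn
  -- The first term is small by the `L²` contraction, the second by the continuous case, the third
  -- by density; each is at most `ε / 3`.
  have e : mollify n g - g = mollify n (g - h) + (mollify n h - h) + (h - g) := by
    rw [mollify_sub n hgl hhl]; abel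
  have m1 : AEStronglyMeasurable (mollify n (g - h)) volume :=
    (contDiff_mollify n (hgl.sub hhl)).continuous.aestronglyMeasurable
  have m2 : AEStronglyMeasurable (mollify n h - h) volume :=
    ((contDiff_mollify n hhl).continuous.sub hh).aestronglyMeasurable
  have m3 : AEStronglyMeasurable (h - g) volume := hh.aestronglyMeasurable.sub hg.1
  rw [e]
  calc eLpNorm (mollify n (g - h) + (mollify n h - h) + (h - g)) 2 volume
      ≤ eLpNorm (mollify n (g - h)) 2 volume + eLpNorm (mollify n h - h) 2 volume
        + eLpNorm (h - g) 2 volume :=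
        (eLpNorm_add_le (m1.add m2) m3 (by norm_num)).trans
          (add_le_add (eLpNorm_add_le m1 m2 (by norm_num)) le_rfl)
    _ ≤ ε / 3 + ε / 3 + ε / 3 := by
        refine add_le_add (add_le_add ((eLpNorm_mollify_le n (hg.sub hhm).1).trans hgh) hn) ?_
        rw [← neg_sub, eLpNorm_neg]
        exact hgh
    _ = ε := ENNReal.add_thirds ε

end Mollify

/-! ### Weak gradients -/

section WeakGradient

variable {d : ℕ}

lemma HasWeakGradient.locallyIntegrable {u : Space d → ℝ} {G : Space d → Space d}
    (h : HasWeakGradient Set.univ u G) : LocallyIntegrable u ∧ LocallyIntegrable G :=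
  ⟨locallyIntegrableOn_univ.1 h.1, locallyIntegrableOn_univ.1 h.2.1⟩

lemma HasWeakGradient.integral_eq {u : Space d → ℝ} {G : Space d → Space d}
    (h : HasWeakGradient Set.univ u G) {η : Space d → ℝ} (hη : ContDiff ℝ ∞ η)
    (hc : HasCompactSupport η) : ∫ x, u x • ∇ η x = - ∫ x, η x • G x := by
  have := h.2.2 η hη hc (Set.subset_univ _)
  simpa using this

lemma integrable_smul_of_locallyIntegrable {E : Type*} [NormedAddCommGroup E] [NormedSpace ℝ E]
    {η : Space d → ℝ} (hη : Continuous η) (hc : HasCompactSupport η) {G : Space d → E}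
    (hG : LocallyIntegrable G) : Integrable fun x => η x • G x :=
  hG.integrable_smul_left_of_hasCompactSupport hη hc

lemma HasWeakGradient.integral_inner_eq {u : Space d → ℝ} {G : Space d → Space d}
    (h : HasWeakGradient Set.univ u G) {η : Space d → ℝ} (hη : ContDiff ℝ ∞ η)
    (hc : HasCompactSupport η) (v : Space d) :
    ∫ x, u x * fderiv ℝ η x v = - ∫ x, η x * inner ℝ (G x) v := by
  have h1 := h.integral_eq hη hc
  have i1 : Integrable fun x => u x • ∇ η x :=
    h.locallyIntegrable.1.integrable_smul_right_of_hasCompactSupport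
      (contDiff_gradient hη).continuous (hasCompactSupport_gradient hc)
  have i2 : Integrable fun x => η x • G x :=
    integrable_smul_of_locallyIntegrable hη.continuous hc h.locallyIntegrable.2
  have h2 := congrArg (fun z => inner ℝ v z) h1
  simp only [inner_neg_right] at h2
  rw [← integral_inner i1, ← integral_inner i2] at h2
  simpa [inner_smul_right, inner_gradient_right, real_inner_comm] using h2

/-- Differentiating the convolution puts the derivative on the kernel. Since `y ↦ ρ (x - y)` is a
test function, the weak gradient identity moves it onto `u`. -/
lemma gradient_mollify (n : ℕ) {u : Space d → ℝ} {G : Space d → Space d}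
    (h : HasWeakGradient Set.univ u G) : ∇ (mollify n u) = mollify n G := by
  have hl := h.locallyIntegrable
  ext1 x
  refine ext_inner_right ℝ fun v => ?_
  set ρ := (bumpSeq d n).normed (volume : Measure (Space d)) with hρ
  have hρs : ContDiff ℝ ∞ ρ := contDiff_infty.2 fun m => (bumpSeq d n).contDiff_normed
  have hρc : HasCompactSupport ρ := (bumpSeq d n).hasCompactSupport_normed
  have hd := hρc.hasFDerivAt_convolution_left (ContinuousLinearMap.lsmul ℝ ℝ)
    (hρs.of_le (by norm_num)) hl.1 x
  rw [inner_gradient_left, mollify, hd.fderiv, convolution_def]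
  have hη : ContDiff ℝ ∞ fun y => ρ (x - y) := hρs.comp (contDiff_const.sub contDiff_id)
  have hηc : HasCompactSupport fun y => ρ (x - y) := hρc.comp_homeomorph (Homeomorph.subLeft x)
  have hkey := h.integral_inner_eq hη hηc v
  have hfd (y : Space d) : fderiv ℝ (fun y => ρ (x - y)) y v = - fderiv ℝ ρ (x - y) v := by
    have h1 : HasFDerivAt (fun y => ρ (x - y))
        ((fderiv ℝ ρ (x - y)).comp (-(ContinuousLinearMap.id ℝ (Space d)))) y := by
      have h2 : HasFDerivAt (fun y : Space d => x - y) (-(ContinuousLinearMap.id ℝ (Space d))) y :=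
        (hasFDerivAt_id y).const_sub x
      exact ((hρs.differentiable (by simp)) (x - y)).hasFDerivAt.comp y h2
    rw [h1.fderiv]
    simp
  have i1 : Integrable fun t => ρ t • G (x - t) := by
    have := hρc.convolutionExists_left (ContinuousLinearMap.lsmul ℝ ℝ) hρs.continuous hl.2 x
    exact this
  have i2 : Integrable fun t => (ContinuousLinearMap.precompL (Space d)
      (ContinuousLinearMap.lsmul ℝ ℝ)) (fderiv ℝ ρ t) (u (x - t)) :=
    (hρc.fderiv ℝ).convolutionExists_left _ (hρs.continuous_fderiv (by simp)) hl.1 x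
  refine (ContinuousLinearMap.integral_apply i2 v).trans ?_
  rw [mollify, convolution_def]
  rw [real_inner_comm, ← integral_inner (by exact i1)]
  rw [← integral_sub_left_eq_self _ volume x]
  rw [← integral_sub_left_eq_self (fun t => inner ℝ v _) volume x]
  simp only [hfd, mul_neg, integral_neg, neg_inj] at hkey
  simp only [sub_sub_cancel, ContinuousLinearMap.precompL_apply,
    ContinuousLinearMap.lsmul_apply, smul_eq_mul, inner_smul_right]
  simp_rw [mul_comm (fderiv ℝ ρ _ v), fun y => real_inner_comm (G y) v]
  exact hkey

/-- Compactly supported `H¹` functions are limits of test functions. -/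
lemma exists_testFunction_approx {u : Space d → ℝ} {G : Space d → Space d}
    (h : HasWeakGradient Set.univ u G) (hG : MemLp G 2 volume) {K : Set (Space d)}
    (hK : IsCompact K) (hu : ∀ x ∉ K, u x = 0) :
    ∃ w : ℕ → Space d → ℝ, (∀ n, ContDiff ℝ ∞ (w n)) ∧
      (∀ n, tsupport (w n) ⊆ cthickening (1 / ((n : ℝ) + 1)) K) ∧
      (∀ n, HasCompactSupport (w n)) ∧
      Tendsto (fun n => eLpNorm (fun x => ∇ (w n) x - G x) 2 volume) atTop (𝓝 0) := by
  have hsub (n : ℕ) : tsupport (mollify n u) ⊆ cthickening (1 / ((n : ℝ) + 1)) K := by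
    refine closure_minimal (fun x hx => ?_) isClosed_cthickening
    by_contra hx'
    exact hx (mollify_eq_zero n hu fun h' => hx' (thickening_subset_cthickening _ _ h'))
  refine ⟨fun n => mollify n u, fun n => contDiff_mollify n h.locallyIntegrable.1, hsub,
    fun n => ?_, ?_⟩
  · exact (hK.cthickening).of_isClosed_subset isClosed_closure (hsub n)
  · have := tendsto_eLpNorm_mollify_sub hG
    refine this.congr fun n => ?_
    rw [← gradient_mollify n h]
    rfl

/-- Product rule for a smooth cutoff and a weakly differentiable function. -/
lemma HasWeakGradient.mul_smooth {u : Space d → ℝ} {G : Space d → Space d}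
    (h : HasWeakGradient Set.univ u G) {χ : Space d → ℝ} (hχ : ContDiff ℝ ∞ χ) :
    HasWeakGradient Set.univ (fun x => χ x * u x) (fun x => χ x • G x + u x • ∇ χ x) := by
  have hl := h.locallyIntegrable
  have hgc := (contDiff_gradient hχ).continuous
  have l1 : LocallyIntegrable fun x => χ x * u x := by
    simpa using! locallyIntegrableOn_univ.1 ((locallyIntegrableOn_univ.2 hl.1).continuousOn_smul
      isOpen_univ.isLocallyClosed hχ.continuous.continuousOn)
  have l2 : LocallyIntegrable fun x => χ x • G x :=
    locallyIntegrableOn_univ.1 ((locallyIntegrableOn_univ.2 hl.2).continuousOn_smul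
      isOpen_univ.isLocallyClosed hχ.continuous.continuousOn)
  have l3 : LocallyIntegrable fun x => u x • ∇ χ x :=
    locallyIntegrableOn_univ.1 ((locallyIntegrableOn_univ.2 hl.1).smul_continuousOn
      isOpen_univ.isLocallyClosed hgc.continuousOn)
  refine ⟨locallyIntegrableOn_univ.2 l1, locallyIntegrableOn_univ.2 (l2.add l3), ?_⟩
  intro η hη hc _
  simp only [Measure.restrict_univ]
  have hη1 := (hη.differentiable (by simp))
  have hχ1 := (hχ.differentiable (by simp))
  have hprod : ContDiff ℝ ∞ fun x => χ x * η x := hχ.mul hη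
  have hpc : HasCompactSupport fun x => χ x * η x := hc.mul_left
  have h1 := h.integral_eq hprod hpc
  have e1 : (fun x => u x • ∇ (fun y => χ y * η y) x)
      = fun x => (χ x * u x) • ∇ η x + η x • (u x • ∇ χ x) := by
    ext1 x
    rw [gradient_mul (hχ1 x) (hη1 x), smul_add, smul_smul, smul_smul, smul_smul]
    congr 2 <;> ring
  have i1 : Integrable fun x => (χ x * u x) • ∇ η x :=
    l1.integrable_smul_right_of_hasCompactSupport (contDiff_gradient hη).continuous
      (hasCompactSupport_gradient hc)
  have i2 : Integrable fun x => η x • (u x • ∇ χ x) :=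
    integrable_smul_of_locallyIntegrable hη.continuous hc l3
  have i3 : Integrable fun x => η x • (χ x • G x) :=
    integrable_smul_of_locallyIntegrable hη.continuous hc l2
  rw [e1, integral_add i1 i2] at h1
  simp only [smul_add]
  rw [integral_add i3 i2, neg_add, ← sub_eq_add_neg, eq_sub_iff_add_eq, h1]
  congr 2
  ext1 x
  rw [smul_smul, mul_comm]

lemma HasWeakGradient.add {u u' : Space d → ℝ} {G G' : Space d → Space d}
    (h : HasWeakGradient Set.univ u G) (h' : HasWeakGradient Set.univ u' G') :
    HasWeakGradient Set.univ (fun x => u x + u' x) (fun x => G x + G' x) := by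
  have hl := h.locallyIntegrable
  have hl' := h'.locallyIntegrable
  refine ⟨locallyIntegrableOn_univ.2 (hl.1.add hl'.1), locallyIntegrableOn_univ.2 (hl.2.add hl'.2),
    fun η hη hc _ => ?_⟩
  simp only [Measure.restrict_univ, add_smul, smul_add]
  have hg := (contDiff_gradient hη).continuous
  have hgc := hasCompactSupport_gradient hc
  rw [integral_add (hl.1.integrable_smul_right_of_hasCompactSupport hg hgc)
    (hl'.1.integrable_smul_right_of_hasCompactSupport hg hgc),
    integral_add (integrable_smul_of_locallyIntegrable hη.continuous hc hl.2)
    (integrable_smul_of_locallyIntegrable hη.continuous hc hl'.2),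
    h.integral_eq hη hc, h'.integral_eq hη hc, neg_add]

lemma HasWeakGradient.const_mul {u : Space d → ℝ} {G : Space d → Space d}
    (h : HasWeakGradient Set.univ u G) (c : ℝ) :
    HasWeakGradient Set.univ (fun x => c * u x) (fun x => c • G x) := by
  have := h.mul_smooth (contDiff_const (c := c))
  have hz : ∀ x, ∇ (fun _ : Space d => c) x = 0 := fun x => by simp [gradient]
  simpa [hz] using this

end WeakGradient

/-! ### Uniqueness of decaying solutions -/

section Uniqueness

variable {d : ℕ}

/-- `b`-version of the corrector equation: `x^j` is replaced by the linear function `b · x`. -/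
structure IsVecCorrector (γ : ℝ) (B : Set (Space d)) (D₁ : Space d → ℝ) (b : Space d)
    (φ : Space d → ℝ) (G : Space d → Space d) : Prop where
  memH1Loc : MemH1Loc φ G
  smooth : ContDiffOn ℝ ∞ φ (closure B)ᶜ
  equation : ∀ v : Space d → ℝ, ContDiff ℝ ∞ v → HasCompactSupport v →
    ∫ x, (γ + D₁ x) * inner ℝ (G x) (∇ v x) = - ∫ x in B, D₁ x * inner ℝ b (∇ v x)
  decay : φ =O[Bornology.cobounded (Space d)] fun x => ‖x‖ ^ (1 - (d : ℤ))

lemma memLp_of_norm_le_of_support {E F : Type*} [NormedAddCommGroup E] [NormedAddCommGroup F]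
    {f : Space d → E} {h : Space d → F} {K : Set (Space d)} (hK : IsCompact K)
    (hf : AEStronglyMeasurable f volume) {C : ℝ} (hle : ∀ x, ‖f x‖ ≤ C * ‖h x‖)
    (h0 : ∀ x ∉ K, f x = 0) (hh : MemLp h 2 (volume.restrict K)) : MemLp f 2 volume := by
  have hind : f = K.indicator f := by
    ext1 x
    by_cases hx : x ∈ K
    · rw [Set.indicator_of_mem hx]
    · rw [Set.indicator_of_notMem hx, h0 x hx]
  rw [hind, memLp_indicator_iff_restrict hK.measurableSet]
  exact hh.of_le_mul hf.restrict (Eventually.of_forall hle)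

/-- Mollification extends the homogeneous equation to compactly supported `H¹` test functions. As
`G` is only locally square integrable, it is first cut off to the 1-neighbourhood of `K`, which
contains the supports of all the mollifications. -/
lemma integral_inner_eq_zero_of_testFunctions {κ : Space d → ℝ} {Λ : ℝ}
    (hκ : AEStronglyMeasurable κ volume) (hΛ : ∀ᵐ x, |κ x| ≤ Λ) {G : Space d → Space d}
    (hG : ∀ K : Set (Space d), IsCompact K → MemLp G 2 (volume.restrict K))
    (hz : ∀ v : Space d → ℝ, ContDiff ℝ ∞ v → HasCompactSupport v →
      ∫ x, κ x * inner ℝ (G x) (∇ v x) = 0)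
    {u : Space d → ℝ} {g : Space d → Space d} (h : HasWeakGradient Set.univ u g)
    (hg : MemLp g 2 volume) {K : Set (Space d)} (hK : IsCompact K) (hu : ∀ x ∉ K, u x = 0)
    (hg0 : ∀ x ∉ K, g x = 0) :
    ∫ x, κ x * inner ℝ (G x) (g x) = 0 := by
  obtain ⟨w, hw, hws, hwc, hlim⟩ := exists_testFunction_approx h hg hK hu
  set K' := cthickening 1 K with hK'
  have hKK' : K ⊆ K' := self_subset_cthickening K
  have hK'c : IsCompact K' := hK.cthickening
  set G' := K'.indicator G with hG'
  have hG'm : MemLp G' 2 volume := (memLp_indicator_iff_restrict hK'c.measurableSet).2 (hG K' hK'c)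
  have hwm (n : ℕ) : MemLp (∇ (w n)) 2 volume :=
    ((contDiff_gradient (hw n)).continuous).memLp_of_hasCompactSupport
      (hasCompactSupport_gradient (hwc n))
  have hl := tendsto_integral_mul_inner_right hκ hΛ hg hwm hG'm hlim
  have e1 (n : ℕ) : ∫ x, κ x * inner ℝ (G' x) (∇ (w n) x) = 0 := by
    rw [← hz (w n) (hw n) (hwc n)]
    refine integral_congr_ae (Eventually.of_forall fun x => ?_)
    by_cases hx : x ∈ K'
    · simp only [hG', Set.indicator_of_mem hx]
    · have : ∇ (w n) x = 0 := by
        refine gradient_eq_zero_of_notMem_tsupport fun h' => hx ?_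
        refine cthickening_mono ?_ K (hws n h')
        rw [div_le_one (by positivity)]
        linarith [(Nat.cast_nonneg n : (0 : ℝ) ≤ n)]
      simp [this]
  simp only [e1] at hl
  have e2 : ∫ x, κ x * inner ℝ (G' x) (g x) = ∫ x, κ x * inner ℝ (G x) (g x) := by
    refine integral_congr_ae (Eventually.of_forall fun x => ?_)
    by_cases hx : x ∈ K'
    · simp only [hG', Set.indicator_of_mem hx]
    · simp [hg0 x fun h' => hx (hKK' h')]
  rw [← e2]
  exact (tendsto_nhds_unique hl tendsto_const_nhds)

/-- Caccioppoli's inequality. -/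
lemma caccioppoli {κ : Space d → ℝ} {c Λ : ℝ}
    (hκ : AEStronglyMeasurable κ volume) (hΛ : ∀ᵐ x, |κ x| ≤ Λ) (hc0 : 0 < c)
    (hc : ∀ᵐ x, c ≤ κ x) {φ : Space d → ℝ} {G : Space d → Space d}
    (h : MemH1Loc φ G)
    (hz : ∀ v : Space d → ℝ, ContDiff ℝ ∞ v → HasCompactSupport v →
      ∫ x, κ x * inner ℝ (G x) (∇ v x) = 0)
    {χ : Space d → ℝ} (hχ : ContDiff ℝ ∞ χ) (hχc : HasCompactSupport χ) :
    Integrable (fun x => ‖χ x • G x‖ ^ 2) ∧ Integrable (fun x => ‖φ x • ∇ χ x‖ ^ 2) ∧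
    c / 2 * ∫ x, ‖χ x • G x‖ ^ 2 ≤ 2 * Λ * ∫ x, ‖φ x • ∇ χ x‖ ^ 2 := by
  have hl := h.1.locallyIntegrable
  set K := tsupport χ with hK
  have hKc : IsCompact K := hχc
  obtain ⟨C, hC⟩ := hχc.exists_bound_of_continuous hχ.continuous
  have hgcont := (contDiff_gradient hχ).continuous
  obtain ⟨C', hC'⟩ := (hasCompactSupport_gradient hχc).exists_bound_of_continuous hgcont
  have m1 : MemLp (fun x => χ x • G x) 2 volume := by
    refine memLp_of_norm_le_of_support hKc
      (hχ.continuous.aestronglyMeasurable.smul hl.2.aestronglyMeasurable) (C := C) (h := G)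
      (fun x => ?_) (fun x hx => ?_) (h.2 K hKc).2
    · rw [norm_smul]
      exact mul_le_mul_of_nonneg_right (hC x) (norm_nonneg _)
    · rw [image_eq_zero_of_notMem_tsupport hx, zero_smul]
  have m2 : MemLp (fun x => φ x • ∇ χ x) 2 volume := by
    refine memLp_of_norm_le_of_support hKc
      (hl.1.aestronglyMeasurable.smul hgcont.aestronglyMeasurable) (C := C') (h := φ)
      (fun x => ?_) (fun x hx => ?_) (h.2 K hKc).1
    · rw [norm_smul, mul_comm]
      exact mul_le_mul_of_nonneg_right (hC' x) (norm_nonneg _)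
    · rw [gradient_eq_zero_of_notMem_tsupport hx, smul_zero]
  -- The function tested with is `χ² φ`, whose weak gradient is `χ² G + 2 χ φ ∇χ`.
  set θ : Space d → ℝ := fun x => χ x * χ x with hθ
  have hθs : ContDiff ℝ ∞ θ := hχ.mul hχ
  have hθx (x : Space d) : θ x = χ x * χ x := rfl
  have hgθ (x : Space d) : ∇ θ x = (2 * χ x) • ∇ χ x := by
    rw [hθ, gradient_mul (hχ.differentiable (by simp) x) (hχ.differentiable (by simp) x),
      ← add_smul, two_mul]
  have hw := h.1.mul_smooth hθs
  have hg0 : ∀ x ∉ K, θ x • G x + φ x • ∇ θ x = 0 := by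
    intro x hx
    simp [hθx, hgθ, image_eq_zero_of_notMem_tsupport hx]
  have mg : MemLp (fun x => θ x • G x + φ x • ∇ θ x) 2 volume := by
    have a1 : MemLp (fun x => χ x • (χ x • G x)) 2 volume := by
      refine m1.of_le_mul (hχ.continuous.aestronglyMeasurable.smul m1.1) (c := C)
        (Eventually.of_forall fun x => ?_)
      rw [norm_smul]
      exact mul_le_mul_of_nonneg_right (hC x) (norm_nonneg _)
    have a2 : MemLp (fun x => χ x • (φ x • ∇ χ x)) 2 volume := by
      refine m2.of_le_mul (hχ.continuous.aestronglyMeasurable.smul m2.1) (c := C)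
        (Eventually.of_forall fun x => ?_)
      rw [norm_smul]
      exact mul_le_mul_of_nonneg_right (hC x) (norm_nonneg _)
    refine (a1.add (a2.const_smul (2 : ℝ))).ae_eq (Eventually.of_forall fun x => ?_)
    simp only [Pi.add_apply, Pi.smul_apply, hθx, hgθ, smul_smul]
    congr 2
    ring
  have hzero := integral_inner_eq_zero_of_testFunctions hκ hΛ (fun K hK => (h.2 K hK).2) hz hw mg hKc
    (fun x hx => by simp [hθ, image_eq_zero_of_notMem_tsupport hx]) hg0
  have i1 := (memLp_two_iff_integrable_sq_norm m1.1).1 m1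
  have i2 := (memLp_two_iff_integrable_sq_norm m2.1).1 m2
  refine ⟨i1, i2, ?_⟩
  rw [← integral_const_mul, ← integral_const_mul, ← sub_nonpos,
    ← integral_sub (i1.const_mul _) (i2.const_mul _), ← hzero]
  have i3 : Integrable fun x => κ x * inner ℝ (G x) (θ x • G x + φ x • ∇ θ x) := by
    have := (integrable_mul_inner hκ hΛ m1 m1).add
      ((integrable_mul_inner hκ hΛ m1 m2).const_mul 2)
    refine this.congr (Eventually.of_forall fun x => ?_)
    simp only [Pi.add_apply, hθx, hgθ, inner_add_right, inner_smul_right, inner_smul_left, RCLike.conj_to_real]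
    ring
  refine integral_mono_ae ((i1.const_mul _).sub (i2.const_mul _)) i3 ?_
  filter_upwards [hc, hΛ] with x hx1 hx2
  have e : κ x * inner ℝ (G x) (θ x • G x + φ x • ∇ θ x)
      = κ x * (‖χ x • G x‖ ^ 2 + 2 * inner ℝ (χ x • G x) (φ x • ∇ χ x)) := by
    rw [← real_inner_self_eq_norm_sq]
    simp only [hθx, hgθ, inner_add_right, inner_smul_right, inner_smul_left, RCLike.conj_to_real]
    ring
  change _ ≤ κ x * inner ℝ (G x) (θ x • G x + φ x • ∇ θ x)
  rw [e]
  have hin := abs_real_inner_le_norm (χ x • G x) (φ x • ∇ χ x)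
  set a := ‖χ x • G x‖
  set b := ‖φ x • ∇ χ x‖
  set t := inner ℝ (χ x • G x) (φ x • ∇ χ x)
  have ha : 0 ≤ a := norm_nonneg _
  have hb : 0 ≤ b := norm_nonneg _
  have ht : -(a * b) ≤ t := neg_le_of_abs_le hin
  have hk : 0 < κ x := hc0.trans_le hx1
  have hk2 : κ x ≤ Λ := (le_abs_self _).trans hx2
  change c / 2 * a ^ 2 - 2 * Λ * b ^ 2 ≤ _
  -- Young's inequality `2ab ≤ a²/2 + 2b²` absorbs half of the energy.
  have h1 : κ x * (a ^ 2 / 2 - 2 * b ^ 2) ≤ κ x * (a ^ 2 + 2 * t) := by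
    refine mul_le_mul_of_nonneg_left ?_ hk.le
    nlinarith [sq_nonneg (a - 2 * b)]
  nlinarith [mul_nonneg (sub_nonneg.2 hx1) (sq_nonneg a), mul_nonneg (sub_nonneg.2 hk2) (sq_nonneg b)]

/-- A weak gradient is the classical gradient where the function is smooth. -/
lemma HasWeakGradient.ae_eq_gradient {u : Space d → ℝ} {G : Space d → Space d}
    (h : HasWeakGradient Set.univ u G) {U : Set (Space d)} (hU : IsOpen U)
    (hu : ContDiffOn ℝ ∞ u U) : ∀ᵐ x, x ∈ U → G x = ∇ u x := by
  have hl := h.locallyIntegrable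
  have hcg : ContinuousOn (∇ u) U := by
    have := hu.continuousOn_fderiv_of_isOpen hU (by simp)
    exact (InnerProductSpace.toDual ℝ (Space d)).symm.continuous.comp_continuousOn this
  have hloc : LocallyIntegrableOn (fun x => G x - ∇ u x) U volume :=
    (hl.2.locallyIntegrableOn U).sub (hcg.locallyIntegrableOn hU.measurableSet)
  have := hU.ae_eq_zero_of_integral_contDiff_smul_eq_zero hloc ?_
  · filter_upwards [this] with x hx hxU
    exact sub_eq_zero.1 (hx hxU)
  intro η hη hc hsupp
  -- `u` is smooth only on `U`; multiplied by a function supported inside `U`, it gives a globally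
  -- continuous integrand.
  have cont_mul {E : Type} [NormedAddCommGroup E] [NormedSpace ℝ E] {f : Space d → ℝ}
      {F : Space d → E}
      (hf : Continuous f) (hfs : tsupport f ⊆ tsupport η) (hF : ContinuousOn F U) :
      Continuous fun x => f x • F x := by
    refine continuous_iff_continuousAt.2 fun x => ?_
    by_cases hx : x ∈ tsupport f
    · exact hf.continuousAt.smul (hF.continuousAt (hU.mem_nhds (hsupp (hfs hx))))
    · have : (fun x => f x • F x) =ᶠ[𝓝 x] fun _ => 0 := by
        filter_upwards [(isClosed_tsupport f).isOpen_compl.mem_nhds hx] with y hy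
        rw [image_eq_zero_of_notMem_tsupport hy, zero_smul]
      exact continuousAt_const.congr this.symm
  have i1 : Integrable fun x => η x • G x := integrable_smul_of_locallyIntegrable hη.continuous hc hl.2
  have i2 : Integrable fun x => η x • ∇ u x :=
    (cont_mul hη.continuous le_rfl hcg).integrable_of_hasCompactSupport hc.smul_right
  simp only [smul_sub]
  rw [integral_sub i1 i2, sub_eq_zero]
  refine ext_inner_left ℝ fun v => ?_
  rw [← integral_inner i1, ← integral_inner i2]
  have h1 := h.integral_inner_eq hη hc v
  have hη' : Continuous fun x => fderiv ℝ η x v :=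
    (hη.continuous_fderiv (by simp)).clm_apply continuous_const
  have hη's : tsupport (fun x => fderiv ℝ η x v) ⊆ tsupport η := tsupport_fderiv_apply_subset ℝ v
  have hc' : HasCompactSupport fun x => fderiv ℝ η x v := hc.fderiv_apply ℝ v
  have hfu : ContinuousOn (fun x => fderiv ℝ u x v) U :=
    (hu.continuousOn_fderiv_of_isOpen hU (by simp)).clm_apply continuousOn_const
  have h2 := integral_mul_fderiv_eq_neg_fderiv_mul_of_integrable (μ := volume) (f := η) (g := u) (v := v)
    ?_ ?_ ?_ (fun x _ => hη.differentiable (by simp) x)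
    (fun x hx => (hu.differentiableOn (by simp)).differentiableAt (hU.mem_nhds (hsupp hx)))
  · simp only [inner_smul_right, inner_gradient_right]
    rw [h2]
    simp_rw [fun x => real_inner_comm (G x) v]
    rw [← neg_eq_iff_eq_neg, ← h1]
    simp_rw [mul_comm]
  · exact (cont_mul hη' hη's hu.continuousOn).integrable_of_hasCompactSupport hc'.smul_right
  · exact (cont_mul hη.continuous le_rfl hfu).integrable_of_hasCompactSupport hc.smul_right
  · exact (cont_mul hη.continuous le_rfl hu.continuousOn).integrable_of_hasCompactSupport
      hc.smul_right

end Uniqueness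

/-! ### Vanishing of decaying solutions and uniqueness of correctors outside the inclusion. -/

section UniquenessDecay

variable {d : ℕ}

/-- A decaying weak solution of the homogeneous equation has zero gradient. -/
lemma gradient_ae_eq_zero_of_decay (hd : 1 ≤ d) {κ : Space d → ℝ} {c Λ : ℝ}
    (hκ : AEStronglyMeasurable κ volume) (hΛ : ∀ᵐ x, |κ x| ≤ Λ) (hc0 : 0 < c)
    (hc : ∀ᵐ x, c ≤ κ x) {φ : Space d → ℝ} {G : Space d → Space d}
    (h : MemH1Loc φ G)
    (hdec : φ =O[Bornology.cobounded (Space d)] fun x => ‖x‖ ^ (1 - (d : ℤ)))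
    (hz : ∀ v : Space d → ℝ, ContDiff ℝ ∞ v → HasCompactSupport v →
      ∫ x, κ x * inner ℝ (G x) (∇ v x) = 0) :
    ∀ᵐ x, G x = 0 := by
  obtain ⟨C, hC0, hC⟩ := hdec.exists_pos
  rw [Asymptotics.isBigOWith_iff, ← comap_norm_atTop, eventually_comap] at hC
  obtain ⟨N, hN⟩ := eventually_atTop.1 hC
  let β : ContDiffBump (0 : Space d) := ⟨1, 2, one_pos, one_lt_two⟩
  have hβ : ContDiff ℝ ∞ (β : Space d → ℝ) := β.contDiff
  obtain ⟨C', hC'⟩ := (hasCompactSupport_gradient β.hasCompactSupport).exists_bound_of_continuous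
    (contDiff_gradient hβ).continuous
  have hC'0 : 0 ≤ C' := (norm_nonneg _).trans (hC' 0)
  have hΛ0 : 0 ≤ Λ := by
    obtain ⟨x, hx⟩ := hΛ.exists
    exact (abs_nonneg _).trans hx
  set V := (volume (closedBall (0 : Space d) 1)).toReal with hV
  -- Caccioppoli with a cutoff between the radii `n` and `2n`: there `φ² = O(n^{2-2d})`, `|∇χ|² =
  -- O(n^{-2})` and the volume is `O(n^d)`, in total `O(n^{-d})`.
  have key : ∀ n : ℕ, 1 ≤ n → N ≤ n → ∀ m : ℕ, m ≤ n →
      c / 2 * ∫ x in ball (0 : Space d) m, ‖G x‖ ^ 2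
        ≤ 2 * Λ * ((C * C') ^ 2 * 2 ^ d * V) * ((n : ℝ)⁻¹) ^ d := by
    intro n hn1 hnN m hmn
    have hn0 : (0 : ℝ) < n := by exact_mod_cast hn1
    set χ : Space d → ℝ := fun x => β ((n : ℝ)⁻¹ • x) with hχdef
    have hχ : ContDiff ℝ ∞ χ := hβ.comp (contDiff_const_smul _)
    have hin : ∀ x ∈ ball (0 : Space d) n, χ x = 1 := by
      intro x hx
      refine β.one_of_mem_closedBall ?_
      rw [mem_closedBall_zero_iff, norm_smul, norm_inv, Real.norm_natCast]
      rw [mem_ball_zero_iff] at hx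
      rw [inv_mul_le_iff₀ hn0]
      exact hx.le.trans (by simp [β])
    have hout : ∀ x ∉ closedBall (0 : Space d) (2 * n), χ x = 0 := by
      intro x hx
      refine β.zero_of_le_dist ?_
      rw [dist_zero_right, norm_smul, norm_inv, Real.norm_natCast, le_inv_mul_iff₀ hn0]
      rw [mem_closedBall_zero_iff, not_le] at hx
      change (n : ℝ) * 2 ≤ _
      linarith
    have hts : tsupport χ ⊆ closedBall (0 : Space d) (2 * n) :=
      closure_minimal (fun x hx => by by_contra h'; exact hx (hout x h')) isClosed_closedBall
    have hχc : HasCompactSupport χ :=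
      (isCompact_closedBall _ _).of_isClosed_subset isClosed_closure hts
    have hgrad (x : Space d) : ∇ χ x = (n : ℝ)⁻¹ • ∇ (β : Space d → ℝ) ((n : ℝ)⁻¹ • x) := by
      refine ext_inner_right ℝ fun v => ?_
      rw [inner_smul_left, inner_gradient_left, inner_gradient_left, hχdef]
      have h1 : HasFDerivAt (fun x : Space d => (n : ℝ)⁻¹ • x)
          ((n : ℝ)⁻¹ • ContinuousLinearMap.id ℝ (Space d)) x :=
        ((n : ℝ)⁻¹ • ContinuousLinearMap.id ℝ (Space d)).hasFDerivAt
      have h2 : HasFDerivAt χ _ x :=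
        ((hβ.differentiable (by simp)) ((n : ℝ)⁻¹ • x)).hasFDerivAt.comp x h1
      rw [h2.fderiv]
      simp
    have hgb (x : Space d) : ‖φ x • ∇ χ x‖ ^ 2
        ≤ (closedBall (0 : Space d) (2 * n)).indicator (fun _ => (C * C' * ((n : ℝ)⁻¹) ^ d) ^ 2) x := by
      by_cases hx2 : x ∈ closedBall (0 : Space d) (2 * n)
      · rw [Set.indicator_of_mem hx2]
        by_cases hx1 : x ∈ ball (0 : Space d) n
        · have hev : χ =ᶠ[𝓝 x] fun _ => 1 := by
            filter_upwards [isOpen_ball.mem_nhds hx1] with y hy using hin y hy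
          have : ∇ χ x = 0 := by
            rw [gradient, hev.fderiv_eq]
            simp
          have h0 : ‖φ x • ∇ χ x‖ ^ 2 = 0 := by simp [this]
          rw [h0]
          positivity
        · rw [mem_ball_zero_iff, not_lt] at hx1
          refine pow_le_pow_left₀ (norm_nonneg _) ?_ 2
          have hxN := hN ‖x‖ (hnN.trans hx1) x rfl
          have hφ : ‖φ x‖ ≤ C * (n * ((n : ℝ)⁻¹) ^ d) := by
            refine hxN.trans (mul_le_mul_of_nonneg_left ?_ hC0.le)
            rw [norm_zpow, norm_norm]
            have e : (n : ℝ) * ((n : ℝ)⁻¹) ^ d = (n : ℝ) ^ (1 - (d : ℤ)) := by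
              rw [zpow_sub₀ hn0.ne', zpow_one, zpow_natCast, inv_pow, div_eq_mul_inv]
            rw [e]
            have e2 : (1 - (d : ℤ)) = -((d - 1 : ℕ) : ℤ) := by
              push_cast [Nat.cast_sub hd]; ring
            rw [e2, zpow_neg, zpow_neg, zpow_natCast, zpow_natCast]
            exact inv_anti₀ (by positivity) (pow_le_pow_left₀ hn0.le hx1 _)
          rw [norm_smul, hgrad, norm_smul, norm_inv, Real.norm_natCast]
          calc ‖φ x‖ * ((n : ℝ)⁻¹ * ‖∇ (β : Space d → ℝ) ((n : ℝ)⁻¹ • x)‖)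
              ≤ (C * (n * ((n : ℝ)⁻¹) ^ d)) * ((n : ℝ)⁻¹ * C') := by
                gcongr
                exact hC' _
            _ = C * C' * ((n : ℝ)⁻¹) ^ d := by
                field_simp
      · rw [Set.indicator_of_notMem hx2, gradient_eq_zero_of_notMem_tsupport fun h' => hx2 (hts h')]
        simp
    obtain ⟨i1, i2, hle⟩ := caccioppoli hκ hΛ hc0 hc h hz hχ hχc
    have hb2 : ∫ x, ‖φ x • ∇ χ x‖ ^ 2 ≤ (C * C') ^ 2 * 2 ^ d * V * ((n : ℝ)⁻¹) ^ d := by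
      refine (integral_mono_of_nonneg (Eventually.of_forall fun x => by positivity) ?_
        (Eventually.of_forall hgb)).trans ?_
      · exact (integrable_indicator_iff isClosed_closedBall.measurableSet).2
          (integrableOn_const (isCompact_closedBall _ _).measure_lt_top.ne)
      · rw [integral_indicator isClosed_closedBall.measurableSet, setIntegral_const, Measure.real,
          Measure.addHaar_closedBall' _ _ (by positivity), finrank_euclideanSpace_fin,
          ENNReal.toReal_mul, ENNReal.toReal_ofReal (by positivity),
          ← hV, smul_eq_mul]
        refine le_of_eq ?_
        have e1 : (n : ℝ) ^ d * ((n : ℝ)⁻¹) ^ d = 1 := by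
          rw [← mul_pow, mul_inv_cancel₀ hn0.ne', one_pow]
        rw [mul_pow 2 (n : ℝ)]
        linear_combination (2 ^ d * V * (C * C') ^ 2 * ((n : ℝ)⁻¹) ^ d) * e1
    have hb1 : ∫ x in ball (0 : Space d) m, ‖G x‖ ^ 2 ≤ ∫ x, ‖χ x • G x‖ ^ 2 := by
      rw [← integral_indicator isOpen_ball.measurableSet]
      refine integral_mono_of_nonneg (Eventually.of_forall fun x => ?_) i1
        (Eventually.of_forall fun x => ?_)
      · exact Set.indicator_nonneg (fun _ _ => by positivity) x
      · by_cases hx : x ∈ ball (0 : Space d) m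
        · have : x ∈ ball (0 : Space d) n := ball_subset_ball (by exact_mod_cast hmn) hx
          simp only [Set.indicator_of_mem hx, hin x this, one_smul]
          exact le_rfl
        · simp only [Set.indicator_of_notMem hx]
          positivity
    calc c / 2 * ∫ x in ball (0 : Space d) m, ‖G x‖ ^ 2
        ≤ c / 2 * ∫ x, ‖χ x • G x‖ ^ 2 := by gcongr
      _ ≤ 2 * Λ * ∫ x, ‖φ x • ∇ χ x‖ ^ 2 := hle
      _ ≤ 2 * Λ * ((C * C') ^ 2 * 2 ^ d * V * ((n : ℝ)⁻¹) ^ d) := by gcongr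
      _ = _ := by ring
  have hball : ∀ m : ℕ, ∀ᵐ x, x ∈ ball (0 : Space d) m → G x = 0 := by
    intro m
    have hlim : Tendsto (fun n : ℕ => 2 * Λ * ((C * C') ^ 2 * 2 ^ d * V) * ((n : ℝ)⁻¹) ^ d) atTop
        (𝓝 0) := by
      have h1 : Tendsto (fun n : ℕ => ((n : ℝ)⁻¹) ^ d) atTop (𝓝 (0 ^ d)) :=
        tendsto_inv_atTop_nhds_zero_nat.pow d
      rw [zero_pow (by omega)] at h1
      simpa using h1.const_mul (2 * Λ * ((C * C') ^ 2 * 2 ^ d * V))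
    have hle : c / 2 * ∫ x in ball (0 : Space d) m, ‖G x‖ ^ 2 ≤ 0 := by
      refine ge_of_tendsto hlim ?_
      filter_upwards [eventually_ge_atTop 1, eventually_ge_atTop m,
        tendsto_natCast_atTop_atTop.eventually_ge_atTop N] with n h1 h2 h3
      exact key n h1 h3 m h2
    have hm : MemLp G 2 (volume.restrict (ball (0 : Space d) m)) :=
      (h.2 _ (isCompact_closedBall 0 (m : ℝ))).2.mono_measure
        (Measure.restrict_mono ball_subset_closedBall le_rfl)
    have hzero : ∫ x in ball (0 : Space d) m, ‖G x‖ ^ 2 = 0 := by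
      refine le_antisymm ?_ (integral_nonneg fun x => by positivity)
      exact nonpos_of_mul_nonpos_right hle (by positivity)
    rw [integral_eq_zero_iff_of_nonneg (fun x => by positivity)
      ((memLp_two_iff_integrable_sq_norm hm.1).1 hm)] at hzero
    rw [← ae_restrict_iff' isOpen_ball.measurableSet]
    filter_upwards [hzero] with x hx
    simpa using hx
  filter_upwards [ae_all_iff.2 hball] with x hx
  obtain ⟨m, hm⟩ := exists_nat_gt ‖x‖
  exact hx m (by rwa [mem_ball_zero_iff])

/-- A function with zero gradient outside a ball that decays at infinity vanishes there. -/
lemma eq_zero_of_gradient_eq_zero (hd : 2 ≤ d) {R : ℝ} (hR : 0 < R) {φ : Space d → ℝ}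
    (hs : ContDiffOn ℝ ∞ φ (closedBall 0 R)ᶜ)
    (hdec : φ =O[Bornology.cobounded (Space d)] fun x => ‖x‖ ^ (1 - (d : ℤ)))
    (hg : ∀ x ∈ (closedBall (0 : Space d) R)ᶜ, ∇ φ x = 0) :
    ∀ x ∈ (closedBall (0 : Space d) R)ᶜ, φ x = 0 := by
  intro x hx
  have hopen : IsOpen (closedBall (0 : Space d) R)ᶜ := isClosed_closedBall.isOpen_compl
  have hxR : R < ‖x‖ := by simpa using hx
  have hx0 : 0 < ‖x‖ := hR.trans hxR
  -- On the part of the ray through `x` outside the ball, `φ` is constant and tends to zero at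
  -- infinity; arguing along rays makes connectedness of the exterior unnecessary.
  have hmem : ∀ t ∈ Set.Ioi (R / ‖x‖), t • x ∈ (closedBall (0 : Space d) R)ᶜ := by
    intro t ht
    have ht0 : 0 < t := lt_trans (by positivity) ht
    rw [Set.mem_Ioi, div_lt_iff₀ hx0] at ht
    simpa [norm_smul, abs_of_pos ht0] using ht
  have hder : ∀ t ∈ Set.Ioi (R / ‖x‖), HasDerivAt (fun t : ℝ => φ (t • x)) 0 t := by
    intro t ht
    have h1 : DifferentiableAt ℝ φ (t • x) :=
      (hs.differentiableOn (by simp)).differentiableAt (hopen.mem_nhds (hmem t ht))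
    have h2 : HasDerivAt (fun t : ℝ => t • x) x t := by
      simpa using (hasDerivAt_id t).smul_const x
    have h3 := h1.hasFDerivAt.comp_hasDerivAt t h2
    rw [← inner_gradient_left, hg _ (hmem t ht), inner_zero_left] at h3
    exact h3
  have hconst : ∀ t ∈ Set.Ioi (R / ‖x‖), φ (t • x) = φ x := by
    intro t ht
    have := isOpen_Ioi.is_const_of_deriv_eq_zero isPreconnected_Ioi
      (fun s hs => (hder s hs).differentiableAt.differentiableWithinAt)
      (fun s hs => (hder s hs).deriv) ht (show (1 : ℝ) ∈ Set.Ioi (R / ‖x‖) by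
        rw [Set.mem_Ioi, div_lt_one hx0]; exact hxR)
    simpa using this
  have htend : Tendsto (fun t : ℝ => t • x) atTop (Bornology.cobounded (Space d)) := by
    rw [← tendsto_norm_atTop_iff_cobounded]
    have : Tendsto (fun t : ℝ => t * ‖x‖) atTop atTop := tendsto_id.atTop_mul_const hx0
    refine this.congr' ?_
    filter_upwards [eventually_ge_atTop 0] with t ht
    rw [norm_smul, Real.norm_of_nonneg ht]
  have hlim : Tendsto φ (Bornology.cobounded (Space d)) (𝓝 0) := by
    refine hdec.trans_tendsto ?_
    have e2 : (1 - (d : ℤ)) = -((d - 1 : ℕ) : ℤ) := by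
      push_cast [Nat.cast_sub (by omega : 1 ≤ d)]; ring
    rw [e2]
    exact (tendsto_pow_neg_atTop (by omega : d - 1 ≠ 0)).comp tendsto_norm_cobounded_atTop
  have h1 : Tendsto (fun t : ℝ => φ (t • x)) atTop (𝓝 0) := hlim.comp htend
  have h2 : Tendsto (fun t : ℝ => φ (t • x)) atTop (𝓝 (φ x)) := by
    refine tendsto_const_nhds.congr' ?_
    filter_upwards [eventually_gt_atTop (R / ‖x‖)] with t ht
    exact (hconst t ht).symm
  exact tendsto_nhds_unique h2 h1

variable {γ R : ℝ} {D₁ : Space d → ℝ}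

lemma IsPerturbation.exists_bound {B : Set (Space d)} (h : IsPerturbation γ B D₁) :
    ∃ K : ℝ, 0 ≤ K ∧ ∀ᵐ x, |D₁ x| ≤ K :=
  ⟨lpNorm D₁ ⊤ volume, lpNorm_nonneg, ae_le_lpNorm_exponent_top h.memLp⟩

lemma IsVecCorrector.add {B : Set (Space d)} (hD : IsPerturbation γ B D₁) (hB : Bornology.IsBounded B)
    {b b' : Space d} {φ φ' : Space d → ℝ}
    {G G' : Space d → Space d} (h : IsVecCorrector γ B D₁ b φ G)
    (h' : IsVecCorrector γ B D₁ b' φ' G') :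
    IsVecCorrector γ B D₁ (b + b') (fun x => φ x + φ' x) (fun x => G x + G' x) := by
  obtain ⟨K, hK0, hK⟩ := hD.exists_bound
  have hKγ : ∀ᵐ x, |γ + D₁ x| ≤ |γ| + K := hK.mono fun x hx =>
    (abs_add_le _ _).trans (add_le_add le_rfl hx)
  have hm : AEStronglyMeasurable (fun x => γ + D₁ x) volume :=
    aestronglyMeasurable_const.add hD.memLp.1
  refine ⟨⟨h.memH1Loc.1.add h'.memH1Loc.1, fun K hK => ⟨(h.memH1Loc.2 K hK).1.add
    (h'.memH1Loc.2 K hK).1, (h.memH1Loc.2 K hK).2.add (h'.memH1Loc.2 K hK).2⟩⟩,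
    h.smooth.add h'.smooth, ?_, h.decay.add h'.decay⟩
  intro v hv hvc
  have hint {G : Space d → Space d} (hG : ∀ K, IsCompact K → MemLp G 2 (volume.restrict K)) :
      Integrable (fun x => (γ + D₁ x) * inner ℝ (G x) (∇ v x)) := by
    have hs : (fun x => (γ + D₁ x) * inner ℝ (G x) (∇ v x))
        = (tsupport v).indicator fun x => (γ + D₁ x) * inner ℝ (G x) (∇ v x) := by
      ext1 x
      by_cases hx : x ∈ tsupport v
      · rw [Set.indicator_of_mem hx]
      · rw [Set.indicator_of_notMem hx, gradient_eq_zero_of_notMem_tsupport hx]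
        simp
    rw [hs, integrable_indicator_iff (isClosed_tsupport v).measurableSet]
    exact integrable_mul_inner hm.restrict (ae_restrict_of_ae hKγ) (hG _ hvc)
      (memLp_of_continuous_isBounded hvc.isBounded (contDiff_gradient hv).continuous)
  have hint2 (b : Space d) : Integrable (fun x => D₁ x * inner ℝ b (∇ v x)) (volume.restrict B) :=
    integrable_mul_inner hD.memLp.1.restrict (ae_restrict_of_ae hK)
      (memLp_of_continuous_isBounded hB continuous_const)
      (memLp_of_continuous_isBounded hB (contDiff_gradient hv).continuous)
  simp only [inner_add_left, mul_add]
  rw [integral_add (hint fun K hK => (h.memH1Loc.2 K hK).2)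
    (hint fun K hK => (h'.memH1Loc.2 K hK).2), integral_add (hint2 b) (hint2 b'),
    h.equation v hv hvc, h'.equation v hv hvc, neg_add]

lemma IsVecCorrector.const_mul {B : Set (Space d)} {b : Space d} {φ : Space d → ℝ}
    {G : Space d → Space d} (h : IsVecCorrector γ B D₁ b φ G) (c : ℝ) :
    IsVecCorrector γ B D₁ (c • b) (fun x => c * φ x) (fun x => c • G x) := by
  refine ⟨⟨h.memH1Loc.1.const_mul c, fun K hK => ⟨(h.memH1Loc.2 K hK).1.const_mul c,
    (h.memH1Loc.2 K hK).2.const_smul c⟩⟩, contDiffOn_const.mul h.smooth, ?_,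
    h.decay.const_mul_left c⟩
  intro v hv hvc
  have := congrArg (fun t => c * t) (h.equation v hv hvc)
  simp only [mul_neg] at this
  rw [← integral_const_mul, ← integral_const_mul] at this
  simp only [inner_smul_left, RCLike.conj_to_real]
  simpa only [mul_left_comm] using this

/-- Correctors for the same direction agree outside the inclusion. -/
lemma IsVecCorrector.eq_of_notMem (hd : 2 ≤ d) (hR : 0 < R)
    (hD : IsPerturbation γ (ball 0 R) D₁) {b : Space d} {φ φ' : Space d → ℝ}
    {G G' : Space d → Space d} (h : IsVecCorrector γ (ball 0 R) D₁ b φ G)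
    (h' : IsVecCorrector γ (ball 0 R) D₁ b φ' G') {x : Space d} (hx : x ∉ closedBall (0 : Space d) R) :
    φ x = φ' x := by
  obtain ⟨K, hK0, hK⟩ := hD.exists_bound
  have hKγ : ∀ᵐ x, |γ + D₁ x| ≤ |γ| + K := hK.mono fun x hx =>
    (abs_add_le _ _).trans (add_le_add le_rfl hx)
  have hm : AEStronglyMeasurable (fun x => γ + D₁ x) volume :=
    aestronglyMeasurable_const.add hD.memLp.1
  obtain ⟨c, hc0, hc⟩ := hD.elliptic
  -- The difference of the two correctors corrects the direction `b - b = 0`, so it solves the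
  -- homogeneous equation.
  have hdiff := h.add hD isBounded_ball (h'.const_mul (-1))
  rw [neg_one_smul, add_neg_cancel] at hdiff
  have hG := gradient_ae_eq_zero_of_decay (by omega) hm hKγ hc0 hc hdiff.memH1Loc hdiff.decay
    (fun v hv hvc => by simpa using hdiff.equation v hv hvc)
  have hs := hdiff.smooth
  rw [closure_ball _ hR.ne'] at hs
  have hopen : IsOpen (closedBall (0 : Space d) R)ᶜ := isClosed_closedBall.isOpen_compl
  set ψ : Space d → ℝ := fun x => φ x + -1 * φ' x with hψ
  have hgr : ∀ y ∈ (closedBall (0 : Space d) R)ᶜ, ∇ ψ y = 0 := by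
    have hae : ∇ ψ =ᵐ[volume.restrict (closedBall (0 : Space d) R)ᶜ] fun _ => 0 := by
      have h1 := hdiff.memH1Loc.1.ae_eq_gradient hopen hs
      refine (ae_restrict_iff' hopen.measurableSet).2 ?_
      filter_upwards [h1, hG] with y hy1 hy2 hy
      rw [← hy1 hy, hy2]
    -- Continuity upgrades the almost everywhere vanishing of the gradient to every point of the
    -- open exterior.
    have hcg : ContinuousOn (∇ ψ) (closedBall (0 : Space d) R)ᶜ :=
      (InnerProductSpace.toDual ℝ (Space d)).symm.continuous.comp_continuousOn
        (hs.continuousOn_fderiv_of_isOpen hopen (by simp))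
    exact Measure.eqOn_open_of_ae_eq hae hopen hcg continuousOn_const
  have := eq_zero_of_gradient_eq_zero hd hR hs hdiff.decay hgr x hx
  simp only [hψ] at this
  linarith

end UniquenessDecay

section Radial

variable {d : ℕ} {γ R : ℝ} {D₁ : Space d → ℝ}

/-! ### Invariance under isometries -/

lemma gradient_comp_isometry (Q : Space d ≃ₗᵢ[ℝ] Space d) (f : Space d → ℝ) (x : Space d) :
    ∇ (fun y => f (Q y)) x = Q.symm (∇ f (Q x)) := by
  refine ext_inner_right ℝ fun v => ?_
  rw [inner_gradient_left]
  have h1 : fderiv ℝ (fun y => f (Q y)) x = (fderiv ℝ f (Q x)).comp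
      (Q.toContinuousLinearEquiv : Space d →L[ℝ] Space d) :=
    Q.toContinuousLinearEquiv.comp_right_fderiv (f := f) (x := x)
  rw [h1, ← Q.inner_map_map, Q.apply_symm_apply, inner_gradient_left]
  rfl

lemma integral_comp_isometry {E : Type*} [NormedAddCommGroup E] [NormedSpace ℝ E]
    (Q : Space d ≃ₗᵢ[ℝ] Space d) (f : Space d → E) : ∫ x, f (Q x) = ∫ x, f x :=
  Q.measurePreserving.integral_comp Q.toHomeomorph.measurableEmbedding f

/-- The ball and, almost everywhere, the coefficient are invariant under `Q`, so a change of
variables in the equation only rotates the direction, with test functions transported by `Q.symm`.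
Together with uniqueness this gives the rotation symmetry of the whole family of correctors. -/
lemma IsVecCorrector.comp_isometry (hR : 0 < R) (hs : IsSphericallySymmetric D₁)
    (Q : Space d ≃ₗᵢ[ℝ] Space d) {b : Space d} {φ : Space d → ℝ} {G : Space d → Space d}
    (h : IsVecCorrector γ (ball 0 R) D₁ b φ G) :
    IsVecCorrector γ (ball 0 R) D₁ (Q.symm b) (fun x => φ (Q x)) (fun x => Q.symm (G (Q x))) := by
  have hemb := Q.toHomeomorph.measurableEmbedding
  have hmp := Q.measurePreserving
  have hDQ : ∀ᵐ x, D₁ (Q x) = D₁ x := by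
    obtain ⟨f, hf⟩ := hs
    filter_upwards [hf, hmp.quasiMeasurePreserving.ae hf] with x h1 h2
    rw [h1, h2, Q.norm_map]
  have hl := h.memH1Loc.1.locallyIntegrable
  have hmemK {E : Type} [NormedAddCommGroup E] {f : Space d → E} {K : Set (Space d)}
      (hf : ∀ K, IsCompact K → MemLp f 2 (volume.restrict K)) (hK : IsCompact K) :
      MemLp (fun x => f (Q x)) 2 (volume.restrict K) := by
    have hr := hmp.restrict_preimage_emb hemb (Q.symm ⁻¹' K)
    have e : (Q : Space d → Space d) ⁻¹' (Q.symm ⁻¹' K) = K := by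
      ext x; simp
    rw [e] at hr
    have hc : IsCompact ((Q.symm : Space d → Space d) ⁻¹' K) :=
      Q.symm.toHomeomorph.isCompact_preimage.2 hK
    exact (hf _ hc).comp_measurePreserving hr
  have m1 (K : Set (Space d)) (hK : IsCompact K) := hmemK (fun K hK => (h.memH1Loc.2 K hK).1) hK
  have m2 (K : Set (Space d)) (hK : IsCompact K) := hmemK (fun K hK => (h.memH1Loc.2 K hK).2) hK
  have m3 (K : Set (Space d)) (hK : IsCompact K) :
      MemLp (fun x => Q.symm (G (Q x))) 2 (volume.restrict K) := by
    refine (m2 K hK).of_le ?_ (Eventually.of_forall fun x => by simp)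
    exact Q.symm.continuous.comp_aestronglyMeasurable (m2 K hK).1
  have loc {E : Type} [NormedAddCommGroup E] {f : Space d → E}
      (hf : ∀ K, IsCompact K → MemLp f 2 (volume.restrict K)) : LocallyIntegrable f := by
    refine locallyIntegrable_iff.2 fun K hK => ?_
    have : IsFiniteMeasure (volume.restrict K) := ⟨by
      rw [Measure.restrict_apply_univ]; exact hK.measure_lt_top⟩
    exact (hf K hK).integrable (by norm_num)
  refine ⟨⟨⟨locallyIntegrableOn_univ.2 (loc m1), locallyIntegrableOn_univ.2 (loc m3),
    fun η hη hc _ => ?_⟩, fun K hK => ⟨m1 K hK, m3 K hK⟩⟩, ?_, ?_, ?_⟩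
  · simp only [Measure.restrict_univ]
    set η' : Space d → ℝ := fun y => η (Q.symm y) with hη'
    have hη's : ContDiff ℝ ∞ η' := hη.comp Q.symm.toContinuousLinearEquiv.contDiff
    have hη'c : HasCompactSupport η' := hc.comp_homeomorph Q.symm.toHomeomorph
    have h1 := h.memH1Loc.1.integral_eq hη's hη'c
    have hgr (y : Space d) : ∇ η' y = Q (∇ η (Q.symm y)) := by
      rw [hη', gradient_comp_isometry, LinearIsometryEquiv.symm_symm]
    rw [← integral_comp_isometry Q, ← integral_comp_isometry Q (fun x => η' x • G x)] at h1
    have hη'Q (y : Space d) : η' (Q y) = η y := by simp [hη']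
    simp only [hgr, LinearIsometryEquiv.symm_apply_apply, hη'Q] at h1
    have h2 := congrArg Q.symm h1
    rw [map_neg] at h2
    have comm (f : Space d → Space d) : Q.symm (∫ x, f x) = ∫ x, Q.symm (f x) :=
      (Q.symm.toContinuousLinearEquiv.integral_comp_comm f).symm
    rw [comm, comm] at h2
    simpa using h2
  · refine h.smooth.comp Q.toContinuousLinearEquiv.contDiff.contDiffOn fun x hx => ?_
    rw [closure_ball _ hR.ne'] at hx ⊢
    simpa using hx
  · intro v hv hvc
    set v' : Space d → ℝ := fun y => v (Q.symm y) with hv'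
    have hv's : ContDiff ℝ ∞ v' := hv.comp Q.symm.toContinuousLinearEquiv.contDiff
    have hv'c : HasCompactSupport v' := hvc.comp_homeomorph Q.symm.toHomeomorph
    have hgr (y : Space d) : ∇ v' y = Q (∇ v (Q.symm y)) := by
      rw [hv', gradient_comp_isometry, LinearIsometryEquiv.symm_symm]
    have h1 := h.equation v' hv's hv'c
    rw [← integral_indicator isOpen_ball.measurableSet] at h1 ⊢
    rw [← integral_comp_isometry Q, ← integral_comp_isometry Q (Set.indicator _ _)] at h1
    have e1 : ∫ x, (γ + D₁ (Q x)) * inner ℝ (G (Q x)) (∇ v' (Q x))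
        = ∫ x, (γ + D₁ x) * inner ℝ (Q.symm (G (Q x))) (∇ v x) := by
      refine integral_congr_ae ?_
      filter_upwards [hDQ] with x hx
      rw [hx, hgr, Q.symm_apply_apply, ← Q.inner_map_map (Q.symm _), Q.apply_symm_apply]
    have e2 : ∫ x, (ball (0 : Space d) R).indicator
          (fun x => D₁ x * inner ℝ b (∇ v' x)) (Q x)
        = ∫ x, (ball (0 : Space d) R).indicator
          (fun x => D₁ x * inner ℝ (Q.symm b) (∇ v x)) x := by
      refine integral_congr_ae ?_
      filter_upwards [hDQ] with x hx
      by_cases hxB : x ∈ ball (0 : Space d) R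
      · have : Q x ∈ ball (0 : Space d) R := by simpa using hxB
        rw [Set.indicator_of_mem hxB, Set.indicator_of_mem this, hx, hgr, Q.symm_apply_apply,
          ← Q.inner_map_map (Q.symm _), Q.apply_symm_apply]
      · have : Q x ∉ ball (0 : Space d) R := by simpa using hxB
        rw [Set.indicator_of_notMem hxB, Set.indicator_of_notMem this]
    rw [e1, e2] at h1
    exact h1
  · have ht : Tendsto (Q : Space d → Space d) (Bornology.cobounded _) (Bornology.cobounded _) := by
      rw [← tendsto_norm_atTop_iff_cobounded]
      simpa using tendsto_norm_cobounded_atTop (E := Space d)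
    have := h.decay.comp_tendsto ht
    simpa [Function.comp_def] using this

/-! ### Radial functions -/

lemma hasFDerivAt_radial {h : ℝ → ℝ} {x : Space d} (hh : DifferentiableAt ℝ h (‖x‖ ^ 2)) :
    HasFDerivAt (fun y : Space d => h (‖y‖ ^ 2)) (deriv h (‖x‖ ^ 2) • (2 • innerSL ℝ x)) x :=
  hh.hasDerivAt.comp_hasFDerivAt x (hasStrictFDerivAt_norm_sq x).hasFDerivAt

lemma hasFDerivAt_coord (j : Fin d) (x : Space d) :
    HasFDerivAt (fun y : Space d => y j) (EuclideanSpace.proj j : Space d →L[ℝ] ℝ) x :=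
  (EuclideanSpace.proj j : Space d →L[ℝ] ℝ).hasFDerivAt

lemma contDiff_coord (j : Fin d) : ContDiff ℝ ∞ fun y : Space d => y j :=
  (EuclideanSpace.proj j : Space d →L[ℝ] ℝ).contDiff

lemma contDiff_radial {h : ℝ → ℝ} (hh : ContDiff ℝ ∞ h) :
    ContDiff ℝ ∞ fun y : Space d => h (‖y‖ ^ 2) :=
  hh.comp (contDiff_norm_sq ℝ)

lemma fderiv_radial_mul_coord {h : ℝ → ℝ} (hh : ContDiff ℝ ∞ h) (j : Fin d) (x v : Space d) :
    fderiv ℝ (fun y : Space d => h (‖y‖ ^ 2) * y j) x v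
      = h (‖x‖ ^ 2) * v j + x j * (deriv h (‖x‖ ^ 2) * (2 * inner ℝ x v)) := by
  have h1 := hasFDerivAt_radial (x := x) (hh.differentiable (by simp) (‖x‖ ^ 2))
  have e : fderiv ℝ (fun y : Space d => h (‖y‖ ^ 2) * y j) x = _ :=
    (h1.mul (hasFDerivAt_coord j x)).fderiv
  rw [e]
  simp

lemma deriv_contDiff {h : ℝ → ℝ} (hh : ContDiff ℝ ∞ h) : ContDiff ℝ ∞ (deriv h) :=
  (contDiff_infty_iff_deriv.1 hh).2

/-- The Laplacian of `h(|x|²) x_j`. -/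
lemma sum_fderiv_fderiv_radial_mul_coord {h : ℝ → ℝ} (hh : ContDiff ℝ ∞ h) (j : Fin d) (x : Space d) :
    ∑ k, fderiv ℝ (fun z => fderiv ℝ (fun y : Space d => h (‖y‖ ^ 2) * y j) z (basisVec k)) x (basisVec k)
      = x j * (4 * ‖x‖ ^ 2 * deriv (deriv h) (‖x‖ ^ 2) + (2 * d + 4) * deriv h (‖x‖ ^ 2)) := by
  have hh' := deriv_contDiff hh
  have hterm (k : Fin d) :
      fderiv ℝ (fun z => fderiv ℝ (fun y : Space d => h (‖y‖ ^ 2) * y j) z (basisVec k)) x (basisVec k)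
        = 4 * deriv h (‖x‖ ^ 2) * (if j = k then x k else 0) + 2 * x j * deriv h (‖x‖ ^ 2)
          + 4 * x j * deriv (deriv h) (‖x‖ ^ 2) * (x k * x k) := by
    have e : (fun z => fderiv ℝ (fun y : Space d => h (‖y‖ ^ 2) * y j) z (basisVec k))
        = fun z : Space d => h (‖z‖ ^ 2) * (basisVec k) j + z j * (deriv h (‖z‖ ^ 2) * (2 * z k)) := by
      ext1 z
      rw [fderiv_radial_mul_coord hh, EuclideanSpace.inner_single_right]
      simp
    rw [e]
    have d1 := hasFDerivAt_radial (x := x) (hh.differentiable (by simp) (‖x‖ ^ 2))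
    have d2 := hasFDerivAt_radial (x := x) (hh'.differentiable (by simp) (‖x‖ ^ 2))
    have d3 := (d1.mul_const ((basisVec k : Space d) j)).add
      ((hasFDerivAt_coord j x).mul (d2.mul ((hasFDerivAt_coord k x).const_mul 2)))
    have e3 : fderiv ℝ (fun z : Space d => h (‖z‖ ^ 2) * (basisVec k) j
        + z j * (deriv h (‖z‖ ^ 2) * (2 * z k))) x = _ := d3.fderiv
    rw [e3]
    by_cases hjk : j = k
    · subst hjk
      simp [EuclideanSpace.inner_single_right]
      ring
    · simp [EuclideanSpace.inner_single_right, hjk]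
      ring
  rw [Finset.sum_congr rfl fun k _ => hterm k, Finset.sum_add_distrib, Finset.sum_add_distrib,
    ← Finset.mul_sum, Finset.sum_ite_eq, Finset.sum_const, ← Finset.mul_sum]
  have hS : ∑ k, x k * x k = ‖x‖ ^ 2 := by
    rw [EuclideanSpace.real_norm_sq_eq]
    exact Finset.sum_congr rfl fun k _ => (sq _).symm
  rw [hS, Finset.card_univ, Fintype.card_fin, nsmul_eq_mul,
    if_pos (Finset.mem_univ _)]
  ring

end Radial

/-! ### Correctors of a symmetric inclusion with vanishing tensor vanish outside it. -/

section Compact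

variable {d : ℕ} {γ R : ℝ} {D₁ : Space d → ℝ}

lemma monomial_single (k : Fin d) : monomial (d := d) (Pi.single k 1) = fun x => x k := by
  ext1 x
  rw [monomial, Finset.prod_eq_single k]
  · simp
  · intro b _ hb
    simp [hb]
  · simp

lemma order_single (k : Fin d) : order (d := d) (Pi.single k 1) = 1 := by
  simp [order]

lemma gradient_coord (k : Fin d) (x : Space d) : ∇ (fun y : Space d => y k) x = basisVec k := by
  refine ext_inner_right ℝ fun v => ?_
  rw [inner_gradient_left, (hasFDerivAt_coord k x).fderiv, EuclideanSpace.inner_single_left]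
  simp

lemma gradient_monomial_single (k : Fin d) (x : Space d) :
    ∇ (monomial (d := d) (Pi.single k 1)) x = basisVec k := by
  rw [monomial_single, gradient_coord]

/-- The gradient of `x_k` is the constant vector `basisVec k`. The form indexed by a direction is
linear in it and stable under isometries, which multi-indices are not. -/
lemma isCorrector_single_iff {B : Set (Space d)} (k : Fin d) {φ : Space d → ℝ}
    {G : Space d → Space d} :
    IsCorrector γ B D₁ (Pi.single k 1) φ G ↔ IsVecCorrector γ B D₁ (basisVec k) φ G := by
  constructor
  · intro h
    exact ⟨h.memH1Loc, h.smooth, fun v hv hc => by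
      have := h.equation v hv hc
      simpa only [gradient_monomial_single] using this, h.decay⟩
  · intro h
    exact ⟨h.memH1Loc, h.smooth, fun v hv hc => by
      have := h.equation v hv hc
      simpa only [gradient_monomial_single] using this, h.decay⟩

lemma eq_single_of_order_eq_one {i : Fin d → ℕ} (h : order i = 1) : ∃ k, i = Pi.single k 1 := by
  have h1 : ∑ k, i k = 1 := h
  obtain ⟨k, hk⟩ : ∃ k, i k ≠ 0 := by
    by_contra hc
    push Not at hc
    simp [hc] at h1
  refine ⟨k, ?_⟩
  rw [← Finset.add_sum_erase _ _ (Finset.mem_univ k)] at h1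
  have h2 : ∑ x ∈ Finset.univ.erase k, i x = 0 := by omega
  have h3 : i k = 1 := by omega
  ext l
  by_cases hl : l = k
  · subst hl; simpa using h3
  · rw [Pi.single_eq_of_ne hl]
    exact (Finset.sum_eq_zero_iff.1 h2) l (by simp [hl])

lemma sum_smul_basisVec (b : Space d) : ∑ k, b k • (basisVec k : Space d) = b := by
  ext l
  simp [Finset.sum_apply, basisVec, Pi.single_apply]

lemma IsVecCorrector.sum {B : Set (Space d)} (hD : IsPerturbation γ B D₁)
    (hB : Bornology.IsBounded B) {φ : Fin d → Space d → ℝ} {G : Fin d → Space d → Space d}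
    {e : Fin d → Space d} (h0 : 0 < d)
    (h : ∀ j, IsVecCorrector γ B D₁ (e j) (φ j) (G j)) (b : Space d) :
    IsVecCorrector γ B D₁ (∑ j, b j • e j) (fun x => ∑ j, b j * φ j x)
      (fun x => ∑ j, b j • G j x) := by
  -- Restricting to nonempty sets starts the induction from one corrector, so the zero direction
  -- needs no treatment of its own.
  have key : ∀ s : Finset (Fin d), s.Nonempty →
      IsVecCorrector γ B D₁ (∑ j ∈ s, b j • e j) (fun x => ∑ j ∈ s, b j * φ j x)
        (fun x => ∑ j ∈ s, b j • G j x) := by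
    intro s hs
    induction hs using Finset.Nonempty.cons_induction with
    | singleton a => simpa using (h a).const_mul (b a)
    | cons a s ha hs ih =>
      simp only [Finset.sum_cons]
      exact ((h a).const_mul (b a)).add hD hB ih
  exact key Finset.univ ⟨⟨0, h0⟩, Finset.mem_univ _⟩

/-- Reflection in the hyperplane orthogonal to `e`. -/
lemma exists_reflection (e : Space d) :
    ∃ Q : Space d ≃ₗᵢ[ℝ] Space d, Q.symm e = -e ∧ ∀ x, inner ℝ e x = 0 → Q x = x := by
  refine ⟨(ℝ ∙ e)ᗮ.reflection, ?_, fun x hx => ?_⟩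
  · rw [Submodule.reflection_symm]
    exact Submodule.reflection_orthogonalComplement_singleton_eq_neg e
  · rw [Submodule.reflection_eq_self_iff, Submodule.mem_orthogonal_singleton_iff_inner_right]
    exact hx

lemma exists_isometry_apply_eq {x y : Space d} (h : ‖x‖ = ‖y‖) :
    ∃ Q : Space d ≃ₗᵢ[ℝ] Space d, Q x = y :=
  ⟨(ℝ ∙ (x - y))ᗮ.reflection, Submodule.reflection_sub h⟩

/-- The radial profile of the correctors of a spherically symmetric inclusion. -/
lemma exists_profile (hd : 2 ≤ d) (hR : 0 < R) (hD : IsPerturbation γ (ball 0 R) D₁)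
    (hs : IsSphericallySymmetric D₁) {φ : Fin d → Space d → ℝ} {G : Fin d → Space d → Space d}
    (h : ∀ j, IsVecCorrector γ (ball 0 R) D₁ (basisVec j) (φ j) (G j)) :
    ∃ W : Space d → ℝ, ContDiffOn ℝ ∞ W (closedBall 0 R)ᶜ ∧
      (W =O[Bornology.cobounded (Space d)] fun x => ‖x‖ ^ (1 - (d : ℤ))) ∧
      (∀ (Q : Space d ≃ₗᵢ[ℝ] Space d) x, W (Q x) = W x) ∧
      ∀ j, ∀ x ∉ closedBall (0 : Space d) R, φ j x = x j * W x := by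
  classical
  set ψ : Space d → Space d → ℝ := fun b x => ∑ j, b j * φ j x with hψ
  have hvec (b : Space d) : ∃ g, IsVecCorrector γ (ball 0 R) D₁ b (ψ b) g := by
    have := IsVecCorrector.sum hD isBounded_ball (by omega) h b
    rw [sum_smul_basisVec] at this
    exact ⟨_, this⟩
  have hinv (b : Space d) (Q : Space d ≃ₗᵢ[ℝ] Space d) {x : Space d}
      (hx : x ∉ closedBall (0 : Space d) R) : ψ b (Q x) = ψ (Q.symm b) x := by
    obtain ⟨g, hg⟩ := hvec b
    obtain ⟨g', hg'⟩ := hvec (Q.symm b)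
    exact (hg.comp_isometry hR hs Q).eq_of_notMem hd hR hD hg' hx
  -- The reflection in the hyperplane orthogonal to `e` fixes `x` and reverses `e`, so `ψ e x`
  -- equals its own opposite.
  have horth {e x : Space d} (hx : x ∉ closedBall (0 : Space d) R) (hex : inner ℝ e x = 0) :
      ψ e x = 0 := by
    obtain ⟨Q, hQe, hQ⟩ := exists_reflection e
    have := hinv e Q hx
    rw [hQ x hex, hQe] at this
    have h2 : ψ (-e) x = - ψ e x := by simp [hψ]
    linarith
  have hlin (b c x : Space d) (t : ℝ) : ψ (b - t • c) x = ψ b x - t * ψ c x := by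
    simp only [hψ, Finset.mul_sum, ← Finset.sum_sub_distrib]
    refine Finset.sum_congr rfl fun j _ => ?_
    simp
    ring
  have hnorm {x : Space d} (hx : x ∉ closedBall (0 : Space d) R) : R < ‖x‖ := by simpa using hx
  -- Only the component of `b` along `x` contributes, since `ψ` is linear in the direction and
  -- vanishes on directions orthogonal to `x`.
  have hgen (b : Space d) {x : Space d} (hx : x ∉ closedBall (0 : Space d) R) :
      ψ b x = inner ℝ b x * (ψ x x / ‖x‖ ^ 2) := by
    have hx0 : ‖x‖ ≠ 0 := (hR.trans (hnorm hx)).ne'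
    have := horth (e := b - (inner ℝ b x / ‖x‖ ^ 2) • x) hx (by
      rw [inner_sub_left, inner_smul_left, real_inner_self_eq_norm_sq]
      simp
      field_simp
      ring)
    rw [hlin] at this
    rw [sub_eq_zero.1 this]
    ring
  -- The value zero inside the ball makes the profile invariant under isometries at every point, not
  -- only outside.
  refine ⟨fun x => if x ∈ closedBall (0 : Space d) R then 0 else ψ x x / ‖x‖ ^ 2, ?_, ?_, ?_, ?_⟩
  · have : ContDiffOn ℝ ∞ (fun x => ψ x x / ‖x‖ ^ 2) (closedBall 0 R)ᶜ := by
      refine ContDiffOn.div (ContDiffOn.sum fun j _ => ?_) (contDiff_norm_sq ℝ).contDiffOn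
        fun x hx => ?_
      · refine (contDiff_coord j).contDiffOn.mul ?_
        have := (h j).smooth
        rwa [closure_ball _ hR.ne'] at this
      · exact pow_ne_zero 2 (hR.trans (hnorm hx)).ne'
    exact this.congr fun x hx => if_neg hx
  · have h1 : (fun x : Space d => if x ∈ closedBall (0 : Space d) R then 0 else ψ x x / ‖x‖ ^ 2)
        =O[Bornology.cobounded (Space d)] fun x => ∑ j, ‖φ j x‖ := by
      refine Asymptotics.IsBigO.of_bound 1 ?_
      filter_upwards [tendsto_norm_cobounded_atTop.eventually_ge_atTop (max 1 R)] with x hx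
      have hx1 : 1 ≤ ‖x‖ := (le_max_left _ _).trans hx
      have hn : (0 : ℝ) ≤ ∑ j, ‖φ j x‖ := Finset.sum_nonneg fun j _ => norm_nonneg _
      rw [one_mul, Real.norm_of_nonneg hn]
      split_ifs
      · simpa using hn
      · rw [norm_div, norm_pow, norm_norm, div_le_iff₀ (by positivity), hψ, Finset.sum_mul]
        refine (norm_sum_le _ _).trans (Finset.sum_le_sum fun j _ => ?_)
        rw [norm_mul, mul_comm]
        refine mul_le_mul_of_nonneg_left ?_ (norm_nonneg _)
        calc ‖x j‖ ≤ ‖x‖ := PiLp.norm_apply_le x j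
          _ ≤ ‖x‖ ^ 2 := by nlinarith
    have h2 := Asymptotics.IsBigO.sum (s := Finset.univ) fun j _ => (h j).decay.norm_left
    exact h1.trans (h2.congr_left fun x => by simp)
  · intro Q x
    have e : Q x ∈ closedBall (0 : Space d) R ↔ x ∈ closedBall (0 : Space d) R := by simp
    simp only [e, Q.norm_map]
    split_ifs with hx
    · rfl
    · rw [hinv (Q x) Q hx, Q.symm_apply_apply]
  · intro j x hx
    have h1 := hgen (basisVec j) hx
    have h2 : ψ (basisVec j) x = φ j x := by
      simp [hψ]
    simp only [if_neg hx]
    rw [← h2, h1, EuclideanSpace.inner_single_left]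
    simp

/-- A smooth primitive that vanishes for large values. -/
lemma exists_primitive {θ : ℝ → ℝ} (hθ : ContDiff ℝ ∞ θ) {a S : ℝ}
    (h1 : ∀ s ≤ a, θ s = 0) (h2 : ∀ s, S ≤ s → θ s = 0) :
    ∃ (η : ℝ → ℝ) (c : ℝ), ContDiff ℝ ∞ η ∧ deriv η = θ ∧ (∀ s ≤ a, η s = c) ∧
      ∀ s, S ≤ s → η s = 0 := by
  have hd (s : ℝ) : HasDerivAt (fun s => ∫ t in S..s, θ t) (θ s) s :=
    intervalIntegral.integral_hasDerivAt_right (hθ.continuous.intervalIntegrable _ _)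
      (hθ.continuous.stronglyMeasurableAtFilter _ _) hθ.continuous.continuousAt
  have hder : deriv (fun s => ∫ t in S..s, θ t) = θ := funext fun s => (hd s).deriv
  refine ⟨fun s => ∫ t in S..s, θ t, ∫ t in S..a, θ t, ?_, hder, fun s hs => ?_, fun s hs => ?_⟩
  · rw [contDiff_infty_iff_deriv, hder]
    exact ⟨fun s => (hd s).differentiableAt, hθ⟩
  · have : ∫ t in a..s, θ t = 0 := by
      rw [intervalIntegral.integral_congr (g := fun _ => (0 : ℝ))]
      · simp
      · intro t ht
        rw [Set.uIcc_of_ge hs] at ht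
        exact h1 t ht.2
    simp only
    rw [← intervalIntegral.integral_add_adjacent_intervals
      (hθ.continuous.intervalIntegrable S a) (hθ.continuous.intervalIntegrable a s), this, add_zero]
  · simp only
    rw [intervalIntegral.integral_congr (g := fun _ => (0 : ℝ))]
    · simp
    · intro t ht
      rw [Set.uIcc_of_le hs] at ht
      exact h2 t ht.1

/-- The test function is `v = η(|x|²) x_j` with `η' = θ`. On the ball `∇v` is the constant vector `c
e_j`, so the terms with `D₁` in the corrector equation add up to `c M_jj = 0`. What remains is `γ ∫
∇φ·∇v = 0`, that is `∫ φ Δv = 0`, and the factor multiplying `φ` in the conclusion is `Δv`. -/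
lemma IsVecCorrector.integral_mul_radial_eq_zero (hγ : 0 < γ) (hR : 0 < R)
    (hD : IsPerturbation γ (ball 0 R) D₁) {j : Fin d} {φ : Space d → ℝ} {G : Space d → Space d}
    (h : IsVecCorrector γ (ball 0 R) D₁ (basisVec j) φ G)
    (hM : ∫ x in ball 0 R, D₁ x * inner ℝ (basisVec j + G x) (basisVec j) = 0)
    {θ : ℝ → ℝ} (hθ : ContDiff ℝ ∞ θ) {S : ℝ} (hRS : R ^ 2 ≤ S)
    (h1 : ∀ s ≤ R ^ 2, θ s = 0) (h2 : ∀ s, S ≤ s → θ s = 0) :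
    ∫ x, φ x * (x j * (4 * ‖x‖ ^ 2 * deriv θ (‖x‖ ^ 2) + (2 * d + 4) * θ (‖x‖ ^ 2))) = 0 := by
  obtain ⟨η, c, hη, hηθ, hηc, hηS⟩ := exists_primitive hθ h1 h2
  obtain ⟨Λ, hΛ0, hΛ⟩ := hD.exists_bound
  have hDm := hD.memLp.1
  set v : Space d → ℝ := fun x => η (‖x‖ ^ 2) * x j with hv
  have hvs : ContDiff ℝ ∞ v := (contDiff_radial hη).mul (contDiff_coord j)
  have hS0 : 0 ≤ S := (sq_nonneg R).trans hRS
  set K := closedBall (0 : Space d) √S with hK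
  have hKc : IsCompact K := isCompact_closedBall _ _
  have hv0 : ∀ x ∉ K, v x = 0 := by
    intro x hx
    have : √S < ‖x‖ := by simpa [hK] using hx
    have : S ≤ ‖x‖ ^ 2 := by
      rw [← Real.sq_sqrt hS0]; gcongr
    simp [hv, hηS _ this]
  have hvc : HasCompactSupport v := HasCompactSupport.intro hKc hv0
  have hts : tsupport v ⊆ K := closure_minimal (fun x hx => by
    by_contra hx'; exact hx (hv0 x hx')) isClosed_closedBall
  have hgB : ∀ x ∈ ball (0 : Space d) R, ∇ v x = c • basisVec j := by
    intro x hx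
    have hx' : ‖x‖ ^ 2 ≤ R ^ 2 := by
      have : ‖x‖ < R := by simpa using hx
      gcongr
    refine ext_inner_right ℝ fun w => ?_
    rw [inner_gradient_left, hv, fderiv_radial_mul_coord hη, hηθ, h1 _ hx', hηc _ hx',
      inner_smul_left, EuclideanSpace.inner_single_left]
    simp
  have hgm : MemLp (∇ v) 2 volume :=
    (contDiff_gradient hvs).continuous.memLp_of_hasCompactSupport (hasCompactSupport_gradient hvc)
  have hG'm : MemLp (K.indicator G) 2 volume :=
    (memLp_indicator_iff_restrict hKc.measurableSet).2 (h.memH1Loc.2 K hKc).2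
  have hGG (x : Space d) : inner ℝ (G x) (∇ v x) = inner ℝ (K.indicator G x) (∇ v x) := by
    by_cases hx : x ∈ K
    · rw [Set.indicator_of_mem hx]
    · rw [gradient_eq_zero_of_notMem_tsupport fun h' => hx (hts h'), inner_zero_right,
        inner_zero_right]
  have hGB : MemLp G 2 (volume.restrict (ball 0 R)) :=
    ((h.memH1Loc.2 _ (isCompact_closedBall 0 R)).2).mono_measure
      (Measure.restrict_mono ball_subset_closedBall le_rfl)
  have hbB : MemLp (fun _ : Space d => (basisVec j : Space d)) 2 (volume.restrict (ball 0 R)) :=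
    memLp_of_continuous_isBounded isBounded_ball continuous_const
  have i1 : Integrable (fun x => inner ℝ (G x) (∇ v x)) := by
    simp only [hGG]
    simpa using integrable_mul_inner (D := fun _ => (1 : ℝ)) (K := 1)
      aestronglyMeasurable_const (by simp) hG'm hgm
  have i2 : Integrable (fun x => D₁ x * inner ℝ (G x) (∇ v x)) := by
    simp only [hGG]
    exact integrable_mul_inner hDm hΛ hG'm hgm
  have heq := h.equation v hvs hvc
  have e1 : ∫ x, (γ + D₁ x) * inner ℝ (G x) (∇ v x)
      = γ * (∫ x, inner ℝ (G x) (∇ v x)) + ∫ x, D₁ x * inner ℝ (G x) (∇ v x) := by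
    rw [← integral_const_mul, ← integral_add (i1.const_mul γ) i2]
    refine integral_congr_ae (Eventually.of_forall fun x => ?_)
    simp only; ring
  -- `D₁` vanishes only outside the closed ball, while the tensor integrates over the open one; the
  -- sphere between them is a null set.
  have hsph : ∀ᵐ x : Space d, x ∉ sphere (0 : Space d) R := by
    rw [ae_iff]
    simpa only [not_not, Set.ofPred_mem_eq] using
      Measure.addHaar_sphere_of_ne_zero volume (0 : Space d) hR.ne'
  have e2 : ∫ x, D₁ x * inner ℝ (G x) (∇ v x)
      = c * ∫ x in ball 0 R, D₁ x * inner ℝ (G x) (basisVec j) := by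
    rw [← integral_const_mul, ← integral_indicator isOpen_ball.measurableSet]
    refine integral_congr_ae ?_
    filter_upwards [hsph, hD.vanish] with x hx1 hx2
    by_cases hx : x ∈ ball (0 : Space d) R
    · rw [Set.indicator_of_mem hx, hgB x hx, inner_smul_right]
      ring
    · rw [Set.indicator_of_notMem hx, hx2, zero_mul]
      rw [closure_ball _ hR.ne', ← ball_union_sphere]
      exact fun h' => h'.elim hx hx1
  have e3 : ∫ x in ball 0 R, D₁ x * inner ℝ (basisVec j) (∇ v x)
      = c * ∫ x in ball 0 R, D₁ x * inner ℝ (basisVec j : Space d) (basisVec j) := by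
    rw [← integral_const_mul]
    refine setIntegral_congr_fun isOpen_ball.measurableSet fun x hx => ?_
    rw [hgB x hx, inner_smul_right]
    ring
  have e4 : (∫ x in ball 0 R, D₁ x * inner ℝ (basisVec j : Space d) (basisVec j))
      + ∫ x in ball 0 R, D₁ x * inner ℝ (G x) (basisVec j) = 0 := by
    rw [← hM, ← integral_add (integrable_mul_inner hDm.restrict (ae_restrict_of_ae hΛ) hbB hbB)
      (integrable_mul_inner hDm.restrict (ae_restrict_of_ae hΛ) hGB hbB)]
    refine integral_congr_ae (Eventually.of_forall fun x => ?_)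
    simp only
    rw [inner_add_left]
    ring
  have e5 : ∫ x, inner ℝ (G x) (∇ v x) = 0 := by
    have : γ * ∫ x, inner ℝ (G x) (∇ v x) = 0 := by
      rw [e1, e2, e3] at heq
      linear_combination heq - c * e4
    exact (mul_eq_zero.1 this).resolve_left hγ.ne'
  have hpart (k : Fin d) : ContDiff ℝ ∞ fun x => fderiv ℝ v x (basisVec k) :=
    (hvs.fderiv_right (m := ∞) (by simp)).clm_apply contDiff_const
  have hpartc (k : Fin d) : HasCompactSupport fun x => fderiv ℝ v x (basisVec k) :=
    hvc.fderiv_apply (𝕜 := ℝ) _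
  have hl := h.memH1Loc.1.locallyIntegrable
  have e6 : ∫ x, inner ℝ (G x) (∇ v x)
      = ∑ k, ∫ x, fderiv ℝ v x (basisVec k) * inner ℝ (G x) (basisVec k) := by
    rw [← integral_finsetSum]
    · refine integral_congr_ae (Eventually.of_forall fun x => ?_)
      simp only
      rw [inner_eq_sum]
      refine Finset.sum_congr rfl fun k _ => ?_
      rw [gradient_apply, EuclideanSpace.inner_single_right]
      simp [mul_comm]
    · intro k _
      have := integrable_smul_of_locallyIntegrable (hpart k).continuous (hpartc k) hl.2
      have := this.inner_const (𝕜 := ℝ) (basisVec k : Space d)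
      refine this.congr (Eventually.of_forall fun x => ?_)
      simp [inner_smul_left]
  have hpp (k : Fin d) : Integrable fun x =>
      φ x * fderiv ℝ (fun z => fderiv ℝ v z (basisVec k)) x (basisVec k) := by
    have hc : Continuous fun x => fderiv ℝ (fun z => fderiv ℝ v z (basisVec k)) x (basisVec k) :=
      ((hpart k).continuous_fderiv (by simp)).clm_apply continuous_const
    have := integrable_smul_of_locallyIntegrable hc ((hpartc k).fderiv_apply (𝕜 := ℝ) _) hl.1
    refine this.congr (Eventually.of_forall fun x => ?_)
    simp [mul_comm]
  have e7 : ∑ k, ∫ x, φ x * fderiv ℝ (fun z => fderiv ℝ v z (basisVec k)) x (basisVec k) = 0 := by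
    rw [e6] at e5
    rw [Finset.sum_congr rfl fun k _ =>
      h.memH1Loc.1.integral_inner_eq (hpart k) (hpartc k) (basisVec k), Finset.sum_neg_distrib, e5,
      neg_zero]
  rw [← integral_finsetSum _ fun k _ => hpp k] at e7
  rw [← e7]
  refine integral_congr_ae (Eventually.of_forall fun x => ?_)
  simp only
  rw [← Finset.mul_sum, hv, sum_fderiv_fderiv_radial_mul_coord hη, hηθ]

/-- The strict inequality `R ^ 2 < a` makes `g` vanish on a neighbourhood of the closed ball, where
`f` need not be smooth. -/
lemma contDiff_mul_of_eq_zero {f g : Space d → ℝ} (hf : ContDiffOn ℝ ∞ f (closedBall 0 R)ᶜ)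
    (hg : ContDiff ℝ ∞ g) {a : ℝ} (ha : R ^ 2 < a)
    (h0 : ∀ x : Space d, ‖x‖ ^ 2 ≤ a → g x = 0) : ContDiff ℝ ∞ fun x => f x * g x := by
  refine contDiff_iff_contDiffAt.2 fun x => ?_
  by_cases hx : x ∈ closedBall (0 : Space d) R
  · have hx' : ‖x‖ ^ 2 < a := by
      have : ‖x‖ ≤ R := by simpa using hx
      refine lt_of_le_of_lt ?_ ha
      gcongr
    have : (fun x => f x * g x) =ᶠ[𝓝 x] fun _ => 0 := by
      have hc : Continuous fun y : Space d => ‖y‖ ^ 2 := by fun_prop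
      filter_upwards [hc.continuousAt.eventually_lt continuousAt_const hx'] with y hy
      rw [h0 y hy.le, mul_zero]
    exact contDiffAt_const.congr_of_eventuallyEq this
  · exact (hf.contDiffAt (isClosed_closedBall.isOpen_compl.mem_nhds hx)).mul hg.contDiffAt

/-- With `h(s) = s θ(s)`, the divergence of `W h(|x|²) x` is half the integrand of `hint` plus `|x|²
θ(|x|²) ∇W·x`. The field has compact support, so its divergence integrates to zero. Continuity of
the integrand is recorded because a sign argument is applied to it later. -/
lemma integral_radial_mul_inner_gradient_eq_zero {W : Space d → ℝ}
    (hW : ContDiffOn ℝ ∞ W (closedBall 0 R)ᶜ) {θ : ℝ → ℝ} (hθ : ContDiff ℝ ∞ θ) {a S : ℝ}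
    (ha : R ^ 2 < a) (hS0 : 0 ≤ S) (h1 : ∀ s ≤ a, θ s = 0) (h2 : ∀ s, S ≤ s → θ s = 0)
    (hint : ∫ x, W x * (‖x‖ ^ 2 * (4 * ‖x‖ ^ 2 * deriv θ (‖x‖ ^ 2)
      + (2 * d + 4) * θ (‖x‖ ^ 2))) = 0) :
    (Continuous fun x => ‖x‖ ^ 2 * θ (‖x‖ ^ 2) * inner ℝ (∇ W x) x) ∧
    ∫ x, ‖x‖ ^ 2 * θ (‖x‖ ^ 2) * inner ℝ (∇ W x) x = 0 := by
  have hθ' := deriv_contDiff hθ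
  have h1' : ∀ s ≤ R ^ 2, deriv θ s = 0 := by
    intro s hs
    have : θ =ᶠ[𝓝 s] fun _ => 0 := by
      filter_upwards [gt_mem_nhds (hs.trans_lt ha)] with t ht using h1 t ht.le
    rw [this.deriv_eq]
    simp
  obtain ⟨a', ha', haa⟩ := exists_between ha
  have h1'' : ∀ s ≤ a', deriv θ s = 0 := by
    intro s hs
    have : θ =ᶠ[𝓝 s] fun _ => 0 := by
      filter_upwards [gt_mem_nhds (hs.trans_lt haa)] with t ht using h1 t ht.le
    rw [this.deriv_eq]
    simp
  set h : ℝ → ℝ := fun s => s * θ s with hh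
  have hhs : ContDiff ℝ ∞ h := contDiff_id.mul hθ
  have hhd (s : ℝ) : deriv h s = θ s + s * deriv θ s := by
    rw [hh, deriv_fun_mul differentiableAt_fun_id (hθ.differentiable (by simp) s)]
    simp
  set F : Fin d → Space d → ℝ := fun k x => h (‖x‖ ^ 2) * x k with hF
  have hFs (k : Fin d) : ContDiff ℝ ∞ (F k) := (contDiff_radial hhs).mul (contDiff_coord k)
  have hF0 (k : Fin d) (x : Space d) (hx : ‖x‖ ^ 2 ≤ a) : F k x = 0 := by
    simp [hF, hh, h1 _ hx]
  have hP (k : Fin d) : ContDiff ℝ ∞ fun x => W x * F k x :=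
    contDiff_mul_of_eq_zero hW (hFs k) ha (hF0 k)
  have hout {x : Space d} (hx : x ∉ closedBall (0 : Space d) √S) : S ≤ ‖x‖ ^ 2 := by
    have : √S < ‖x‖ := by simpa using hx
    rw [← Real.sq_sqrt hS0]; gcongr
  have hPc (k : Fin d) : HasCompactSupport fun x => W x * F k x := by
    refine HasCompactSupport.intro (isCompact_closedBall (0 : Space d) √S) fun x hx => ?_
    simp [hF, hh, h2 _ (hout hx)]
  set A : Space d → ℝ := fun x => W x * (‖x‖ ^ 2 * (4 * ‖x‖ ^ 2 * deriv θ (‖x‖ ^ 2)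
      + (2 * d + 4) * θ (‖x‖ ^ 2))) with hA
  have hAs : ContDiff ℝ ∞ A := by
    refine contDiff_mul_of_eq_zero hW ?_ ha' fun x hx => ?_
    · exact (contDiff_norm_sq ℝ).mul (((contDiff_const.mul (contDiff_norm_sq ℝ)).mul
        (contDiff_radial hθ')).add (contDiff_const.mul (contDiff_radial hθ)))
    · simp [h1 _ (hx.trans haa.le), h1'' _ hx]
  have h2' : ∀ s, S < s → deriv θ s = 0 := by
    intro s hs
    have : θ =ᶠ[𝓝 s] fun _ => 0 := by
      filter_upwards [lt_mem_nhds hs] with t ht using h2 t ht.le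
    rw [this.deriv_eq]
    simp
  have hAc : HasCompactSupport A := by
    refine HasCompactSupport.intro (isCompact_closedBall (0 : Space d) √S) fun x hx => ?_
    have : S < ‖x‖ ^ 2 := by
      have : √S < ‖x‖ := by simpa using hx
      rw [← Real.sq_sqrt hS0]; gcongr
    simp [hA, h2 _ this.le, h2' _ this]
  have hdiv (x : Space d) : ∑ k, fderiv ℝ (fun x => W x * F k x) x (basisVec k)
      = A x / 2 + ‖x‖ ^ 2 * θ (‖x‖ ^ 2) * inner ℝ (∇ W x) x := by
    have hS : ∑ k, x k * x k = ‖x‖ ^ 2 := by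
      rw [EuclideanSpace.real_norm_sq_eq]
      exact Finset.sum_congr rfl fun k _ => (sq _).symm
    have hFd (k : Fin d) : fderiv ℝ (F k) x (basisVec k)
        = h (‖x‖ ^ 2) + 2 * deriv h (‖x‖ ^ 2) * (x k * x k) := by
      rw [hF, fderiv_radial_mul_coord hhs, EuclideanSpace.inner_single_right]
      simp
      ring
    by_cases hx : x ∈ closedBall (0 : Space d) R
    · have hxa : ‖x‖ ^ 2 ≤ R ^ 2 := by
        have : ‖x‖ ≤ R := by simpa using hx
        gcongr
      have hz (k : Fin d) : (fun x => W x * F k x) =ᶠ[𝓝 x] fun _ => 0 := by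
        have hc : Continuous fun y : Space d => ‖y‖ ^ 2 := by fun_prop
        filter_upwards [hc.continuousAt.eventually_lt continuousAt_const (hxa.trans_lt ha)] with y hy
        rw [hF0 k y hy.le, mul_zero]
      have h0 := h1 _ (hxa.trans ha.le)
      rw [Finset.sum_eq_zero fun k _ => by rw [(hz k).fderiv_eq]; simp]
      simp [hA, h0, h1' _ hxa]
    · have hWd : DifferentiableAt ℝ W x :=
        (hW.contDiffAt (isClosed_closedBall.isOpen_compl.mem_nhds hx)).differentiableAt (by simp)
      have e (k : Fin d) : fderiv ℝ (fun x => W x * F k x) x (basisVec k)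
          = W x * h (‖x‖ ^ 2) + 2 * W x * deriv h (‖x‖ ^ 2) * (x k * x k)
            + h (‖x‖ ^ 2) * (∇ W x k * x k) := by
        rw [fderiv_fun_mul hWd ((hFs k).differentiable (by simp) x), add_apply,
          smul_apply, smul_apply, hFd, gradient_apply]
        simp only [hF, smul_eq_mul]
        ring
      rw [Finset.sum_congr rfl fun k _ => e k, Finset.sum_add_distrib, Finset.sum_add_distrib,
        ← Finset.mul_sum, Finset.sum_const, ← Finset.mul_sum, hS, ← Finset.mul_sum, ← inner_eq_sum, Finset.card_univ,
        Fintype.card_fin, nsmul_eq_mul, hhd, hA]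
      simp only [hh]
      ring
  have hc1 (k : Fin d) : Continuous fun x => fderiv ℝ (fun x => W x * F k x) x (basisVec k) :=
    ((hP k).continuous_fderiv (by simp)).clm_apply continuous_const
  have hi1 (k : Fin d) : Integrable fun x => fderiv ℝ (fun x => W x * F k x) x (basisVec k) :=
    (hc1 k).integrable_of_hasCompactSupport ((hPc k).fderiv_apply (𝕜 := ℝ) _)
  have hAi : Integrable A := hAs.continuous.integrable_of_hasCompactSupport hAc
  have hT : (fun x => ‖x‖ ^ 2 * θ (‖x‖ ^ 2) * inner ℝ (∇ W x) x)
      = fun x => ∑ k, fderiv ℝ (fun x => W x * F k x) x (basisVec k) - A x / 2 := by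
    ext1 x
    rw [hdiv]
    ring
  rw [hT]
  refine ⟨(continuous_finsetSum _ fun k _ => hc1 k).sub (hAs.continuous.div_const 2), ?_⟩
  rw [integral_sub (integrable_finsetSum _ fun k _ => hi1 k) (hAi.div_const 2),
    integral_finsetSum _ fun k _ => hi1 k, integral_div, hint]
  simp [integral_fderiv_eq_zero ((hP _).of_le (by simp)) (hPc _)]

/-- Radial invariance kills the tangential derivatives of `W`, and `x ↦ ∇W·x` depends on `|x|` only.
Were it nonzero somewhere, a bump `θ` concentrated near that squared radius would make the vanishing
integral of the preceding lemma strictly of one sign. So `∇W = 0` outside the ball, and decay gives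
`W = 0`. -/
lemma profile_eq_zero (hd : 2 ≤ d) (hR : 0 < R) {W : Space d → ℝ}
    (hW : ContDiffOn ℝ ∞ W (closedBall 0 R)ᶜ)
    (hdec : W =O[Bornology.cobounded (Space d)] fun x => ‖x‖ ^ (1 - (d : ℤ)))
    (hrad : ∀ (Q : Space d ≃ₗᵢ[ℝ] Space d) x, W (Q x) = W x)
    (hint : ∀ θ : ℝ → ℝ, ContDiff ℝ ∞ θ → ∀ S, R ^ 2 ≤ S → (∀ s ≤ R ^ 2, θ s = 0) →
      (∀ s, S ≤ s → θ s = 0) → ∫ x, W x * (‖x‖ ^ 2 * (4 * ‖x‖ ^ 2 * deriv θ (‖x‖ ^ 2)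
      + (2 * d + 4) * θ (‖x‖ ^ 2))) = 0) :
    ∀ x ∈ (closedBall (0 : Space d) R)ᶜ, W x = 0 := by
  have hgr (Q : Space d ≃ₗᵢ[ℝ] Space d) (x : Space d) : ∇ W x = Q.symm (∇ W (Q x)) := by
    rw [← gradient_comp_isometry Q W x]
    congr 1
    ext1 y
    exact (hrad Q y).symm
  have hq {x y : Space d} (h : ‖x‖ = ‖y‖) : inner ℝ (∇ W x) x = inner ℝ (∇ W y) y := by
    obtain ⟨Q, rfl⟩ := exists_isometry_apply_eq h
    rw [hgr Q x, ← Q.inner_map_map, Q.apply_symm_apply]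
  have horth {x e : Space d} (he : inner ℝ e x = 0) : inner ℝ (∇ W x) e = 0 := by
    obtain ⟨Q, hQe, hQ⟩ := exists_reflection e
    have h1 : inner ℝ (∇ W x) (Q.symm e) = inner ℝ (∇ W x) e := by
      have h2 := hgr Q x
      rw [hQ x he] at h2
      conv_lhs => rw [h2]
      exact Q.symm.inner_map_map _ _
    rw [hQe, inner_neg_right] at h1
    linarith
  have hU : IsOpen (closedBall (0 : Space d) R)ᶜ := isClosed_closedBall.isOpen_compl
  have hcg : ContinuousOn (∇ W) (closedBall (0 : Space d) R)ᶜ :=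
    (InnerProductSpace.toDual ℝ (Space d)).symm.continuous.comp_continuousOn
      (hW.continuousOn_fderiv_of_isOpen hU (by simp))
  have hzero : ∀ x ∈ (closedBall (0 : Space d) R)ᶜ, inner ℝ (∇ W x) x = 0 := by
    intro x₁ hx₁
    by_contra hne
    have hxR : R < ‖x₁‖ := by simpa using hx₁
    have hx0 : 0 < ‖x₁‖ := hR.trans hxR
    set q₁ : ℝ := inner ℝ (∇ W x₁) x₁ with hq₁
    -- A continuous choice of one point for each squared radius `s`, passing through `x₁`; it turns
    -- continuity of `∇W` at `x₁` into a sign on a whole spherical shell.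
    set p : ℝ → Space d := fun s => (√s / ‖x₁‖) • x₁ with hp
    have hp1 : p (‖x₁‖ ^ 2) = x₁ := by
      simp [hp, Real.sqrt_sq hx0.le, div_self hx0.ne']
    have hpc : Continuous p := by fun_prop
    have hpn (s : ℝ) : ‖p s‖ = √s := by
      rw [hp, norm_smul, norm_div, norm_norm, Real.norm_of_nonneg (Real.sqrt_nonneg s)]
      field_simp
    have hcat : ContinuousAt (fun s => q₁ * inner ℝ (∇ W (p s)) (p s)) (‖x₁‖ ^ 2) := by
      have h1 : ContinuousAt (fun s => ∇ W (p s)) (‖x₁‖ ^ 2) := by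
        refine ContinuousAt.comp (g := ∇ W) ?_ hpc.continuousAt
        rw [hp1]
        exact hcg.continuousAt (hU.mem_nhds hx₁)
      exact continuousAt_const.mul (h1.inner hpc.continuousAt)
    have hpos : 0 < q₁ * inner ℝ (∇ W (p (‖x₁‖ ^ 2))) (p (‖x₁‖ ^ 2)) := by
      rw [hp1]
      exact mul_self_pos.2 hne
    have hev := (hcat.eventually_const_lt hpos)
    obtain ⟨δ₀, hδ₀, hδ⟩ := Metric.eventually_nhds_iff_ball.1 hev
    have hRs : R ^ 2 < ‖x₁‖ ^ 2 := by gcongr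
    set δ := min δ₀ ((‖x₁‖ ^ 2 - R ^ 2) / 2) with hδdef
    have hδ0 : 0 < δ := lt_min hδ₀ (by linarith)
    have hδ2 : δ ≤ (‖x₁‖ ^ 2 - R ^ 2) / 2 := min_le_right _ _
    let θ : ContDiffBump (‖x₁‖ ^ 2) := ⟨δ / 2, δ, by positivity, by linarith⟩
    have hθ0 (s : ℝ) (hs : s ∉ ball (‖x₁‖ ^ 2) δ) : θ s = 0 := by
      refine θ.zero_of_le_dist ?_
      simpa using hs
    have hθp (s : ℝ) (hs : s ∈ ball (‖x₁‖ ^ 2) δ) : 0 < θ s := θ.pos_of_mem_ball hs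
    have hθ1 : ∀ s ≤ ‖x₁‖ ^ 2 - δ, θ s = 0 := fun s hs => hθ0 s (by
      rw [Real.ball_eq_Ioo]; intro h; linarith [h.1])
    have hθ2 : ∀ s, ‖x₁‖ ^ 2 + δ ≤ s → θ s = 0 := fun s hs => hθ0 s (by
      rw [Real.ball_eq_Ioo]; intro h; linarith [h.2])
    obtain ⟨hc, hi⟩ := integral_radial_mul_inner_gradient_eq_zero hW θ.contDiff
      (a := ‖x₁‖ ^ 2 - δ) (S := ‖x₁‖ ^ 2 + δ) (by linarith) (by positivity) hθ1 hθ2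
      (hint θ θ.contDiff (‖x₁‖ ^ 2 + δ) (by linarith) (fun s hs => hθ1 s (by linarith)) hθ2)
    set T : Space d → ℝ := fun x => ‖x‖ ^ 2 * θ (‖x‖ ^ 2) * inner ℝ (∇ W x) x with hT
    have hTc : HasCompactSupport fun x => q₁ * T x := by
      refine HasCompactSupport.intro (isCompact_closedBall (0 : Space d) √(‖x₁‖ ^ 2 + δ))
        fun x hx => ?_
      have h1 : √(‖x₁‖ ^ 2 + δ) < ‖x‖ := by simpa using hx
      have : ‖x₁‖ ^ 2 + δ ≤ ‖x‖ ^ 2 := by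
        rw [← Real.sq_sqrt (show 0 ≤ ‖x₁‖ ^ 2 + δ by positivity)]; gcongr
      simp [hT, hθ2 _ this]
    -- Multiplying by `q₁` covers both signs of the radial derivative at once.
    have hTn : ∀ x, 0 ≤ q₁ * T x := by
      intro x
      by_cases hx : ‖x‖ ^ 2 ∈ ball (‖x₁‖ ^ 2) δ
      · have h1 := hδ _ (ball_subset_ball (min_le_left _ _) hx)
        rw [← hq (x := x) (by rw [hpn, Real.sqrt_sq (norm_nonneg _)])] at h1
        have h2 := (hθp _ hx).le
        have : q₁ * T x = ‖x‖ ^ 2 * θ (‖x‖ ^ 2) * (q₁ * inner ℝ (∇ W x) x) := by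
          simp only [hT]; ring
        rw [this]
        positivity
      · simp [hT, hθ0 _ hx]
    have hT1 : q₁ * T x₁ ≠ 0 := by
      have h2 := (hθp (‖x₁‖ ^ 2) (mem_ball_self hδ0)).ne'
      simp only [hT]
      exact mul_ne_zero hne (mul_ne_zero (mul_ne_zero (by positivity) h2) hne)
    have := (hc.const_mul q₁ |>.integral_pos_of_hasCompactSupport_nonneg_nonzero
      (μ := volume) hTc hTn hT1)
    rw [integral_const_mul, hi, mul_zero] at this
    exact lt_irrefl _ this
  refine eq_zero_of_gradient_eq_zero hd hR hW hdec fun x hx => ?_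
  have := horth (x := x) (e := ∇ W x) (hzero x hx)
  exact inner_self_eq_zero.1 this

/-- For a spherically symmetric inclusion with vanishing leading tensor, the gradients of the
correctors of order one vanish outside the inclusion. -/
theorem exists_compact_correctors (hd : 2 ≤ d) (hγ : 0 < γ) (hR : 0 < R)
    (hD : IsPerturbation γ (ball 0 R) D₁) (hs : IsSphericallySymmetric D₁)
    (hM : LeadingTensorVanishes γ (ball 0 R) D₁) :
    ∃ (φ : Fin d → Space d → ℝ) (G : Fin d → Space d → Space d), ∀ j,
      HasWeakGradient Set.univ (φ j) (G j) ∧ MemLp (G j) 2 volume ∧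
      (∀ x ∉ closedBall (0 : Space d) R, φ j x = 0) ∧
      (∀ x ∉ closedBall (0 : Space d) R, G j x = 0) ∧
      ∀ v : Space d → ℝ, ContDiff ℝ ∞ v → HasCompactSupport v →
        ∫ x, (γ + D₁ x) * inner ℝ (G j x) (∇ v x) = - ∫ x, D₁ x * inner ℝ (basisVec j) (∇ v x) := by
  have hex (j : Fin d) := (hM (Pi.single j 1) (Pi.single j 1) (order_single j) (order_single j)).1
  choose φ G hc using hex
  have hv (j : Fin d) := isCorrector_single_iff j |>.1 (hc j)
  have hMj (j : Fin d) :
      ∫ x in ball 0 R, D₁ x * inner ℝ (basisVec j + G j x) (basisVec j) = 0 := by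
    have := (hM _ _ (order_single j) (order_single j)).2 _ _ (hc j)
    simpa only [polarizationEntry, gradient_monomial_single] using this
  obtain ⟨W, hW, hWd, hWr, hWφ⟩ := exists_profile hd hR hD hs hv
  have hW0 := profile_eq_zero hd hR hW hWd hWr (by
    intro θ hθ S hS h1 h2
    have hl (j : Fin d) := (hv j).memH1Loc.1.locallyIntegrable
    have hterm (j : Fin d) := (hv j).integral_mul_radial_eq_zero hγ hR hD (hMj j) hθ hS h1 h2
    have hS0 : 0 ≤ S := (sq_nonneg R).trans hS
    set r : Space d → ℝ := fun x => 4 * ‖x‖ ^ 2 * deriv θ (‖x‖ ^ 2) + (2 * d + 4) * θ (‖x‖ ^ 2)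
      with hr
    have hrc : Continuous r := by
      have h3 := (contDiff_radial (d := d) (deriv_contDiff hθ)).continuous
      have h4 := (contDiff_radial (d := d) hθ).continuous
      have h5 : Continuous fun x : Space d => ‖x‖ ^ 2 := by fun_prop
      exact ((continuous_const.mul h5).mul h3).add (continuous_const.mul h4)
    have h2' : ∀ s, S < s → deriv θ s = 0 := by
      intro s hs
      have : θ =ᶠ[𝓝 s] fun _ => 0 := by
        filter_upwards [lt_mem_nhds hs] with t ht using h2 t ht.le
      rw [this.deriv_eq]
      simp
    have hrS : HasCompactSupport r := by
      refine HasCompactSupport.intro (isCompact_closedBall (0 : Space d) √S) fun x hx => ?_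
      have : S < ‖x‖ ^ 2 := by
        have : √S < ‖x‖ := by simpa using hx
        rw [← Real.sq_sqrt hS0]; gcongr
      simp [hr, h2 _ this.le, h2' _ this]
    have hr0 (x : Space d) (hx : x ∈ closedBall (0 : Space d) R) : r x = 0 := by
      have hx' : ‖x‖ ^ 2 ≤ R ^ 2 := by
        have : ‖x‖ ≤ R := by simpa using hx
        gcongr
      -- At `s = R ^ 2` the function `θ` is known to vanish only on the left; the left derivative
      -- determines the derivative.
      have hd0 : ∀ s ≤ R ^ 2, deriv θ s = 0 := by
        intro s hs
        have hder := (hθ.differentiable (by simp) s).hasDerivAt.hasDerivWithinAt (s := Set.Iic s)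
        have h0 : HasDerivWithinAt θ 0 (Set.Iic s) s :=
          (hasDerivWithinAt_const s _ (0 : ℝ)).congr (fun t ht => h1 t (le_trans ht hs)) (h1 s hs)
        exact (uniqueDiffWithinAt_Iic s).eq_deriv _ hder h0
      simp [hr, h1 _ hx', hd0 _ hx']
    have hi (j : Fin d) : Integrable fun x => φ j x * (x j * r x) := by
      have := integrable_smul_of_locallyIntegrable
        ((contDiff_coord j).continuous.mul hrc) hrS.mul_left (hl j).1
      refine this.congr (Eventually.of_forall fun x => ?_)
      simp [mul_comm]
    -- Summing over `j` is what turns `φ_j x_j = x_j² W` into `|x|² W`, leaving a condition on the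
    -- radial profile alone.
    have hsum : ∫ x, ∑ j, φ j x * (x j * r x) = 0 := by
      rw [integral_finsetSum _ fun j _ => hi j]
      exact Finset.sum_eq_zero fun j _ => hterm j
    rw [← hsum]
    refine integral_congr_ae (Eventually.of_forall fun x => ?_)
    by_cases hx : x ∈ closedBall (0 : Space d) R
    · have := hr0 x hx
      simp only [hr] at this
      simp [hr, this]
    · simp only
      have hS : ∑ k, x k * x k = ‖x‖ ^ 2 := by
        rw [EuclideanSpace.real_norm_sq_eq]
        exact Finset.sum_congr rfl fun k _ => (sq _).symm
      rw [← hS, Finset.sum_mul, Finset.mul_sum, hS]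
      refine Finset.sum_congr rfl fun j _ => ?_
      rw [hWφ j x hx]
      simp only [hr]
      ring)
  have hφ0 (j : Fin d) (x : Space d) (hx : x ∉ closedBall (0 : Space d) R) : φ j x = 0 := by
    rw [hWφ j x hx, hW0 x hx, mul_zero]
  have hU : IsOpen (closedBall (0 : Space d) R)ᶜ := isClosed_closedBall.isOpen_compl
  have hG0 (j : Fin d) : ∀ᵐ x, x ∉ closedBall (0 : Space d) R → G j x = 0 := by
    have hsm : ContDiffOn ℝ ∞ (φ j) (closedBall 0 R)ᶜ := by
      have := (hv j).smooth
      rwa [closure_ball _ hR.ne'] at this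
    filter_upwards [(hv j).memH1Loc.1.ae_eq_gradient hU hsm] with x hx hxU
    rw [hx hxU]
    have : φ j =ᶠ[𝓝 x] fun _ => 0 := by
      filter_upwards [hU.mem_nhds hxU] with y hy using hφ0 j y hy
    rw [gradient, this.fderiv_eq]
    simp
  have hGae (j : Fin d) : G j =ᵐ[volume] (closedBall (0 : Space d) R).indicator (G j) := by
    filter_upwards [hG0 j] with x hx
    by_cases hxb : x ∈ closedBall (0 : Space d) R
    · rw [Set.indicator_of_mem hxb]
    · rw [Set.indicator_of_notMem hxb, hx hxb]
  -- A weak gradient is defined only up to null sets; this representative vanishes at every point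
  -- outside the closed ball.
  refine ⟨φ, fun j => (closedBall (0 : Space d) R).indicator (G j), fun j => ⟨?_, ?_, hφ0 j,
    fun x hx => Set.indicator_of_notMem hx _, fun v hvs hvc => ?_⟩⟩
  · have hl := (hv j).memH1Loc.1.locallyIntegrable
    refine ⟨locallyIntegrableOn_univ.2 hl.1, locallyIntegrableOn_univ.2
      (hl.2.congr (hGae j)), fun η hη hηc hηs => ?_⟩
    rw [(hv j).memH1Loc.1.2.2 η hη hηc hηs, Measure.restrict_univ]
    congr 1
    refine integral_congr_ae ?_
    filter_upwards [hGae j] with x hx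
    rw [← hx]
  · exact (memLp_indicator_iff_restrict measurableSet_closedBall).2
      ((hv j).memH1Loc.2 _ (isCompact_closedBall 0 R)).2
  · have := (hv j).equation v hvs hvc
    rw [← integral_indicator isOpen_ball.measurableSet] at this
    have hsph : ∀ᵐ x : Space d, x ∉ sphere (0 : Space d) R := by
      rw [ae_iff]
      simpa only [not_not, Set.ofPred_mem_eq] using
        Measure.addHaar_sphere_of_ne_zero volume (0 : Space d) hR.ne'
    have e1 : ∫ x, (γ + D₁ x) * inner ℝ ((closedBall (0 : Space d) R).indicator (G j) x) (∇ v x)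
        = ∫ x, (γ + D₁ x) * inner ℝ (G j x) (∇ v x) := by
      refine integral_congr_ae ?_
      filter_upwards [hGae j] with x hx
      rw [← hx]
    rw [e1, this]
    congr 1
    refine integral_congr_ae ?_
    filter_upwards [hsph, hD.vanish] with x hx1 hx2
    by_cases hx : x ∈ ball (0 : Space d) R
    · rw [Set.indicator_of_mem hx]
    · rw [Set.indicator_of_notMem hx, hx2, zero_mul]
      rw [closure_ball _ hR.ne', ← ball_union_sphere]
      exact fun h' => h'.elim hx hx1

end Compact

/-! ### Construction of a smooth neutral spherically symmetric inclusion. -/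

section Existence

variable {d : ℕ} {γ R : ℝ}

lemma hasWeakGradient_of_contDiff {v : Space d → ℝ} (hv : ContDiff ℝ ∞ v) :
    HasWeakGradient Set.univ v (∇ v) := by
  have hgc := (contDiff_gradient hv).continuous
  refine ⟨locallyIntegrableOn_univ.2 hv.continuous.locallyIntegrable,
    locallyIntegrableOn_univ.2 hgc.locallyIntegrable, fun η hη hc _ => ?_⟩
  rw [Measure.restrict_univ]
  have i1 : Integrable fun x => v x • ∇ η x :=
    (hv.continuous.smul (contDiff_gradient hη).continuous).integrable_of_hasCompactSupport
      (hasCompactSupport_gradient hc).smul_left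
  have i2 : Integrable fun x => η x • ∇ v x :=
    (hη.continuous.smul hgc).integrable_of_hasCompactSupport hc.smul_right
  refine ext_inner_right ℝ fun w => ?_
  rw [inner_neg_left, real_inner_comm, ← integral_inner i1, real_inner_comm, ← integral_inner i2]
  simp only [inner_smul_right, inner_gradient_right]
  rw [integral_mul_fderiv_eq (hv.of_le (by simp)) (hη.of_le (by simp)) (Or.inr hc)]
  simp only [mul_comm]

/-- The profile of a smooth neutral inclusion: `x ↦ μ(|x|²) x_i` is harmonic for the coefficient
`K(|x|²)`. -/
lemma exists_neutral_profile (d : ℕ) (hγ : 0 < γ) (hR : 0 < R) :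
    ∃ μ K : ℝ → ℝ, ContDiff ℝ ∞ μ ∧ ContDiff ℝ ∞ K ∧ (∀ s, 0 < K s) ∧
      (∀ s, 3 * R ^ 2 / 4 ≤ s → μ s = 1 ∧ K s = γ ∧ deriv μ s = 0) ∧ μ (R ^ 2 / 2) ≠ 1 ∧
      ∀ s, 2 * deriv (fun s => K s * μ s - γ) s + 2 * s * deriv (fun s => 2 * K s * deriv μ s) s
        + (d + 1) * (2 * K s * deriv μ s) = 0 := by
  have hR2 : 0 < R ^ 2 := by positivity
  -- The bump lives in the shell where `s = |x|²` is between `R²/4` and `3R²/4`, so the inclusion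
  -- stays away from the boundary of the ball.
  let b : ContDiffBump (R ^ 2 / 2) := ⟨R ^ 2 / 8, R ^ 2 / 4, by positivity, by linarith⟩
  have hb : ContDiff ℝ ∞ b := b.contDiff
  have hb' := deriv_contDiff hb
  have hbc : HasCompactSupport (deriv b) := b.hasCompactSupport.deriv
  obtain ⟨M, hM⟩ := (HasCompactSupport.mul_left (f := fun s : ℝ => 2 * s) hbc).exists_bound_of_continuous
    ((continuous_const.mul continuous_id).mul hb'.continuous)
  have hM0 : 0 ≤ M := (norm_nonneg _).trans (hM 0)
  -- The amplitude is small enough to keep `p = μ + 2 s μ'` positive, `M` being a bound for `2 s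
  -- b'`. Here `p` is the radial derivative of `r μ(r²)`, by which the solution below divides.
  set δ : ℝ := 1 / (M + 1) with hδ
  have hδ0 : 0 < δ := by positivity
  have hδM : δ * M < 1 := by
    rw [hδ, div_mul_eq_mul_div, one_mul, div_lt_one (by positivity)]
    linarith
  set μ : ℝ → ℝ := fun s => 1 + δ * b s with hμ
  have hμs : ContDiff ℝ ∞ μ := contDiff_const.add (contDiff_const.mul hb)
  have hμ' (s : ℝ) : deriv μ s = δ * deriv b s := by
    have := ((hb.differentiable (by simp) s).hasDerivAt.const_mul δ).const_add 1
    exact this.deriv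
  have hμ's := deriv_contDiff hμs
  set p : ℝ → ℝ := fun s => μ s + 2 * s * deriv μ s with hp
  have hps : ContDiff ℝ ∞ p := hμs.add ((contDiff_const.mul contDiff_id).mul hμ's)
  have hpp (s : ℝ) : 0 < p s := by
    have h1 := neg_le_of_abs_le (hM s)
    have h2 : 0 ≤ b s := b.nonneg
    have h3 : p s = 1 + δ * b s + δ * (2 * s * deriv b s) := by
      simp only [hp, hμ']
      simp only [hμ]
      ring
    rw [h3]
    have h4 : δ * (-M) ≤ δ * (2 * s * deriv b s) := mul_le_mul_of_nonneg_left h1 hδ0.le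
    have h5 : 0 ≤ δ * b s := by positivity
    linarith
  have hbl : ∀ s, s ≤ R ^ 2 / 4 → b s = 0 := fun s hs => b.zero_of_le_dist (by
    rw [Real.dist_eq, abs_sub_comm]
    exact le_trans (show R ^ 2 / 4 ≤ _ by linarith) (le_abs_self _))
  have hbr : ∀ s, 3 * R ^ 2 / 4 ≤ s → b s = 0 := fun s hs => b.zero_of_le_dist (by
    rw [Real.dist_eq]
    exact le_trans (show R ^ 2 / 4 ≤ _ by linarith) (le_abs_self _))
  have hdl : ∀ s, s ≤ R ^ 2 / 4 → deriv μ s = 0 := fun s hs => by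
    have hder := (hb.differentiable (by simp) s).hasDerivAt.hasDerivWithinAt (s := Set.Iic s)
    have h0 : HasDerivWithinAt b 0 (Set.Iic s) s :=
      (hasDerivWithinAt_const s _ (0 : ℝ)).congr (fun t ht => hbl t (le_trans ht hs)) (hbl s hs)
    rw [hμ', (uniqueDiffWithinAt_Iic s).eq_deriv _ hder h0, mul_zero]
  have hdr : ∀ s, 3 * R ^ 2 / 4 ≤ s → deriv μ s = 0 := fun s hs => by
    have hder := (hb.differentiable (by simp) s).hasDerivAt.hasDerivWithinAt (s := Set.Ici s)
    have h0 : HasDerivWithinAt b 0 (Set.Ici s) s :=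
      (hasDerivWithinAt_const s _ (0 : ℝ)).congr (fun t ht => hbr t (le_trans hs ht)) (hbr s hs)
    rw [hμ', (uniqueDiffWithinAt_Ici s).eq_deriv _ hder h0, mul_zero]
  -- In terms of `σ = K p` the divergence equation reads `σ' = -(d - 1) K μ' = -(d - 1) (μ'/p) σ`,
  -- solved by an exponential of a primitive `η` of `μ'/p`. Normalizing `η` to vanish for large `s`
  -- gives `K = γ` there.
  obtain ⟨η, c, hη, hηd, -, hηr⟩ := exists_primitive (θ := fun s => deriv μ s / p s)
    (a := R ^ 2 / 4) (S := 3 * R ^ 2 / 4) (hμ's.div hps fun s => (hpp s).ne')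
    (fun s hs => by simp [hdl s hs]) (fun s hs => by simp [hdr s hs])
  set σ : ℝ → ℝ := fun s => γ * Real.exp (-((d : ℝ) - 1) * η s) with hσ
  have hσs : ContDiff ℝ ∞ σ := contDiff_const.mul (contDiff_const.mul hη).exp
  set K : ℝ → ℝ := fun s => σ s / p s with hK
  have hKs : ContDiff ℝ ∞ K := hσs.div hps fun s => (hpp s).ne'
  have hσd (s : ℝ) : HasDerivAt σ (-((d : ℝ) - 1) * (K s * deriv μ s)) s := by
    have h1 := (((hη.differentiable (by simp) s).hasDerivAt.const_mul (-((d : ℝ) - 1))).exp.const_mul γ)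
    have e : -((d : ℝ) - 1) * (K s * deriv μ s)
        = γ * (Real.exp (-((d : ℝ) - 1) * η s) * (-((d : ℝ) - 1) * deriv η s)) := by
      rw [hηd]
      simp only [hK, hσ]
      ring
    rw [e]
    exact h1
  refine ⟨μ, K, hμs, hKs, fun s => div_pos (by positivity) (hpp s), fun s hs => ⟨?_, ?_, hdr s hs⟩,
    ?_, fun s => ?_⟩
  · simp [hμ, hbr s hs]
  · have h1 : p s = 1 := by simp only [hp, hdr s hs]; simp [hμ, hbr s hs]
    simp only [hK, hσ, h1, hηr s hs]
    simp
  · have : b (R ^ 2 / 2) = 1 := b.one_of_mem_closedBall (mem_closedBall_self b.rIn_pos.le)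
    simp only [hμ, this]
    linarith
  · have hA : HasDerivAt (fun s => K s * μ s - γ) _ s :=
      (((hKs.mul hμs).sub contDiff_const).differentiable (by simp) s).hasDerivAt
    have hF : HasDerivAt (fun s => 2 * K s * deriv μ s) _ s :=
      (((contDiff_const.mul hKs).mul hμ's).differentiable (by simp) s).hasDerivAt
    -- Here `σ` equals `A + s f + γ` with `A = K μ - γ` and `f = 2 K μ'`. Comparing its two
    -- derivatives gives `A' + s f' + f = -(d - 1) f / 2`, which is the required identity up to a
    -- factor 2.
    have hsum := (hA.add ((hasDerivAt_id s).mul hF)).add_const γ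
    have e : σ = fun s => (K s * μ s - γ) + s * (2 * K s * deriv μ s) + γ := by
      ext1 s
      have : σ s = K s * p s := by
        rw [hK]; exact (div_mul_cancel₀ _ (hpp s).ne').symm
      rw [this]
      simp only [hp]
      ring
    have h2 := hσd s
    rw [e] at h2
    have h3 := h2.unique hsum
    simp only [id] at h3
    linear_combination (-2) * h3

/-- The divergence of `A(|x|²) e_i + f(|x|²) x_i x`. -/
lemma sum_fderiv_radial_field {A f : ℝ → ℝ} (hA : ContDiff ℝ ∞ A) (hf : ContDiff ℝ ∞ f)
    (i : Fin d) (x : Space d) :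
    ∑ k, fderiv ℝ (fun y : Space d => A (‖y‖ ^ 2) * (basisVec i : Space d) k
        + f (‖y‖ ^ 2) * y i * y k) x (basisVec k)
      = (2 * deriv A (‖x‖ ^ 2) + 2 * ‖x‖ ^ 2 * deriv f (‖x‖ ^ 2) + (d + 1) * f (‖x‖ ^ 2)) * x i := by
  have hterm (k : Fin d) : fderiv ℝ (fun y : Space d => A (‖y‖ ^ 2) * (basisVec i : Space d) k
        + f (‖y‖ ^ 2) * y i * y k) x (basisVec k)
      = (if k = i then 2 * deriv A (‖x‖ ^ 2) * x k else 0)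
        + (if k = i then f (‖x‖ ^ 2) * x k else 0) + f (‖x‖ ^ 2) * x i
        + 2 * x i * deriv f (‖x‖ ^ 2) * (x k * x k) := by
    have d1 := (hasFDerivAt_radial (x := x) (hA.differentiable (by simp) (‖x‖ ^ 2))).mul_const
      ((basisVec i : Space d) k)
    have d2 := ((hasFDerivAt_radial (x := x) (hf.differentiable (by simp) (‖x‖ ^ 2))).mul
      (hasFDerivAt_coord i x)).mul (hasFDerivAt_coord k x)
    have e : fderiv ℝ (fun y : Space d => A (‖y‖ ^ 2) * (basisVec i : Space d) k
        + f (‖y‖ ^ 2) * y i * y k) x = _ := (d1.add d2).fderiv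
    rw [e]
    by_cases hik : k = i
    · subst hik
      simp [EuclideanSpace.inner_single_right]
      ring
    · have hik' : i ≠ k := fun h => hik h.symm
      simp [EuclideanSpace.inner_single_right, hik, hik']
      ring
  have hS : ∑ k, x k * x k = ‖x‖ ^ 2 := by
    rw [EuclideanSpace.real_norm_sq_eq]
    exact Finset.sum_congr rfl fun k _ => (sq _).symm
  rw [Finset.sum_congr rfl fun k _ => hterm k, Finset.sum_add_distrib, Finset.sum_add_distrib,
    Finset.sum_add_distrib, Finset.sum_ite_eq', Finset.sum_ite_eq', Finset.sum_const,
    ← Finset.mul_sum, hS, if_pos (Finset.mem_univ _), if_pos (Finset.mem_univ _), Finset.card_univ,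
    Fintype.card_fin, nsmul_eq_mul]
  ring

/-- A smooth divergence-free field of compact support is orthogonal to weak gradients. -/
lemma HasWeakGradient.integral_inner_eq_zero {u : Space d → ℝ} {G : Space d → Space d}
    (h : HasWeakGradient Set.univ u G) {Z : Fin d → Space d → ℝ} (hZ : ∀ k, ContDiff ℝ ∞ (Z k))
    (hZc : ∀ k, HasCompactSupport (Z k)) (hdiv : ∀ x, ∑ k, fderiv ℝ (Z k) x (basisVec k) = 0) :
    ∫ x, ∑ k, Z k x * G x k = 0 := by
  have hl := h.locallyIntegrable
  have hG (x : Space d) (k : Fin d) : G x k = inner ℝ (G x) (basisVec k) := by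
    rw [EuclideanSpace.inner_single_right]; simp
  have i1 (k : Fin d) : Integrable fun x => Z k x * G x k := by
    have := integrable_smul_of_locallyIntegrable (hZ k).continuous (hZc k) hl.2
    have := this.inner_const (𝕜 := ℝ) (basisVec k : Space d)
    refine this.congr (Eventually.of_forall fun x => ?_)
    simp only [hG, inner_smul_left]
    simp
  have i2 (k : Fin d) : Integrable fun x => u x * fderiv ℝ (Z k) x (basisVec k) := by
    have hc : Continuous fun x => fderiv ℝ (Z k) x (basisVec k) :=
      ((hZ k).continuous_fderiv (by simp)).clm_apply continuous_const
    have := integrable_smul_of_locallyIntegrable hc ((hZc k).fderiv_apply (𝕜 := ℝ) _) hl.1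
    refine this.congr (Eventually.of_forall fun x => ?_)
    simp [mul_comm]
  have e (k : Fin d) : ∫ x, Z k x * G x k = - ∫ x, u x * fderiv ℝ (Z k) x (basisVec k) := by
    rw [h.integral_inner_eq (hZ k) (hZc k), neg_neg]
    simp only [hG]
  rw [integral_finsetSum _ fun k _ => i1 k, Finset.sum_congr rfl fun k _ => e k,
    Finset.sum_neg_distrib, ← integral_finsetSum _ fun k _ => i2 k]
  simp only [← Finset.mul_sum, hdiv]
  simp

/-- There are neutral spherically symmetric inclusions. -/
theorem exists_neutral (hd : 2 ≤ d) (hγ : 0 < γ) (hR : 0 < R) :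
    ∃ D₁ : Space d → ℝ, IsPerturbation γ (ball 0 R) D₁ ∧ IsSphericallySymmetric D₁ ∧
      ¬ (D₁ =ᵐ[volume] fun _ => 0) ∧ LeadingTensorVanishes γ (ball 0 R) D₁ := by
  obtain ⟨μ, K, hμ, hK, hKpos, hout, hμ1, hode⟩ := exists_neutral_profile d hγ hR
  have hμ' := deriv_contDiff hμ
  have hR2 : 0 < R ^ 2 := by positivity
  set D₁ : Space d → ℝ := fun x => K (‖x‖ ^ 2) - γ with hD₁
  have hDs : ContDiff ℝ ∞ D₁ := (contDiff_radial hK).sub contDiff_const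
  set ρ : ℝ := √(3 * R ^ 2 / 4) with hρ
  have hρ2 {x : Space d} (hx : x ∉ closedBall (0 : Space d) ρ) : 3 * R ^ 2 / 4 ≤ ‖x‖ ^ 2 := by
    have : ρ < ‖x‖ := by simpa using hx
    rw [← Real.sq_sqrt (show 0 ≤ 3 * R ^ 2 / 4 by positivity)]
    gcongr
  have hρR : ρ < R := by
    rw [hρ, Real.sqrt_lt' hR]; linarith
  have hBρ {x : Space d} (hx : x ∉ ball (0 : Space d) R) : x ∉ closedBall (0 : Space d) ρ := by
    intro h
    apply hx
    have : ‖x‖ ≤ ρ := by simpa using h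
    simpa using this.trans_lt hρR
  have hD0 {x : Space d} (hx : x ∉ closedBall (0 : Space d) ρ) : D₁ x = 0 := by
    simp [hD₁, (hout _ (hρ2 hx)).2.1]
  have hDc : HasCompactSupport D₁ :=
    HasCompactSupport.intro (isCompact_closedBall (0 : Space d) ρ) fun x hx => hD0 hx
  set φ : Fin d → Space d → ℝ := fun i x => (μ (‖x‖ ^ 2) - 1) * x i with hφ
  have hφs (i : Fin d) : ContDiff ℝ ∞ (φ i) :=
    ((contDiff_radial hμ).sub contDiff_const).mul (contDiff_coord i)
  have hφc (i : Fin d) : HasCompactSupport (φ i) :=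
    HasCompactSupport.intro (isCompact_closedBall (0 : Space d) ρ) fun x hx => by
      simp [hφ, (hout _ (hρ2 hx)).1]
  -- `Z i` is the flux `(γ + D₁) ∇(x_i + φ_i)` minus its constant value `γ e_i` outside the
  -- inclusion: a smooth, compactly supported, divergence-free field.
  set Z : Fin d → Fin d → Space d → ℝ := fun i k x =>
    (K (‖x‖ ^ 2) * μ (‖x‖ ^ 2) - γ) * (basisVec i : Space d) k
      + 2 * K (‖x‖ ^ 2) * deriv μ (‖x‖ ^ 2) * x i * x k with hZ
  have hAs : ContDiff ℝ ∞ fun s => K s * μ s - γ := (hK.mul hμ).sub contDiff_const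
  have hFs : ContDiff ℝ ∞ fun s => 2 * K s * deriv μ s := (contDiff_const.mul hK).mul hμ'
  have hZs (i k : Fin d) : ContDiff ℝ ∞ (Z i k) :=
    ((contDiff_radial hAs).mul contDiff_const).add
      (((contDiff_radial hFs).mul (contDiff_coord i)).mul (contDiff_coord k))
  have hZc (i k : Fin d) : HasCompactSupport (Z i k) :=
    HasCompactSupport.intro (isCompact_closedBall (0 : Space d) ρ) fun x hx => by
      obtain ⟨h1, h2, h3⟩ := hout _ (hρ2 hx)
      simp [hZ, h1, h2, h3]
  have hdiv (i : Fin d) (x : Space d) : ∑ k, fderiv ℝ (Z i k) x (basisVec k) = 0 := by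
    have := sum_fderiv_radial_field hAs hFs i x
    rw [hode, zero_mul] at this
    exact this
  have hgφ (i k : Fin d) (x : Space d) : ∇ (φ i) x k
      = (μ (‖x‖ ^ 2) - 1) * (basisVec i : Space d) k + 2 * deriv μ (‖x‖ ^ 2) * x i * x k := by
    rw [gradient_apply]
    have := fderiv_radial_mul_coord (h := fun s => μ s - 1) (hμ.sub contDiff_const) i x (basisVec k)
    simp only [hφ]
    rw [this, EuclideanSpace.inner_single_right]
    have h2 : (basisVec k : Space d) i = (basisVec i : Space d) k := by
      simp [eq_comm]
    rw [h2, deriv_sub_const]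
    simp
    ring
  have hZeq (i k : Fin d) (x : Space d) :
      Z i k x = (γ + D₁ x) * ∇ (φ i) x k + D₁ x * (basisVec i : Space d) k := by
    rw [hgφ]
    simp only [hZ, hD₁]
    ring
  have hZin (i : Fin d) (x w : Space d) :
      ∑ k, Z i k x * w k
        = (γ + D₁ x) * inner ℝ w (∇ (φ i) x) + D₁ x * inner ℝ (basisVec i : Space d) w := by
    rw [inner_eq_sum, inner_eq_sum, Finset.mul_sum, Finset.mul_sum, ← Finset.sum_add_distrib]
    refine Finset.sum_congr rfl fun k _ => ?_
    rw [hZeq]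
    ring
  have hgc (i : Fin d) := (contDiff_gradient (hφs i)).continuous
  have hgcs (i : Fin d) := hasCompactSupport_gradient (hφc i)
  -- the key identity, for an arbitrary weak gradient
  have key (i : Fin d) {u : Space d → ℝ} {G : Space d → Space d}
      (h : HasWeakGradient Set.univ u G) :
      ∫ x, (γ + D₁ x) * inner ℝ (G x) (∇ (φ i) x) = - ∫ x, D₁ x * inner ℝ (basisVec i) (G x) := by
    have h1 := h.integral_inner_eq_zero (hZs i) (hZc i) (hdiv i)
    simp only [hZin] at h1
    have hl := h.locallyIntegrable.2
    have i1 : Integrable fun x => (γ + D₁ x) * inner ℝ (G x) (∇ (φ i) x) := by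
      have hcomp (k : Fin d) : Integrable fun x => ((γ + D₁ x) * ∇ (φ i) x k) * inner ℝ (G x) (basisVec k) := by
        have hc : Continuous fun x => (γ + D₁ x) * ∇ (φ i) x k :=
          (continuous_const.add hDs.continuous).mul
            ((EuclideanSpace.proj k : Space d →L[ℝ] ℝ).continuous.comp (hgc i))
        have hcs : HasCompactSupport fun x => (γ + D₁ x) * ∇ (φ i) x k :=
          HasCompactSupport.mul_left ((hgcs i).comp_left (g := fun y : Space d => y k) rfl)
        have := integrable_smul_of_locallyIntegrable hc hcs hl
        have := this.inner_const (𝕜 := ℝ) (basisVec k : Space d)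
        refine this.congr (Eventually.of_forall fun x => ?_)
        simp only [inner_smul_left]
        simp
      refine (integrable_finsetSum Finset.univ fun k _ => hcomp k).congr
        (Eventually.of_forall fun x => ?_)
      simp only
      rw [inner_eq_sum, Finset.mul_sum]
      refine Finset.sum_congr rfl fun k _ => ?_
      rw [EuclideanSpace.inner_single_right]
      simp
      ring
    have i2 : Integrable fun x => D₁ x * inner ℝ (basisVec i) (G x) := by
      have := integrable_smul_of_locallyIntegrable hDs.continuous hDc hl
      have := this.const_inner (𝕜 := ℝ) (basisVec i : Space d)
      refine this.congr (Eventually.of_forall fun x => ?_)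
      simp only [inner_smul_right]
    rw [integral_add i1 i2] at h1
    linarith
  have hBint (f : Space d → ℝ) : ∫ x in ball (0 : Space d) R, D₁ x * f x = ∫ x, D₁ x * f x := by
    refine setIntegral_eq_integral_of_forall_compl_eq_zero fun x hx => ?_
    rw [hD0 (hBρ hx), zero_mul]
  have hcorr (i : Fin d) : IsCorrector γ (ball 0 R) D₁ (Pi.single i 1) (φ i) (∇ (φ i)) := by
    rw [isCorrector_single_iff]
    refine ⟨⟨hasWeakGradient_of_contDiff (hφs i), fun S hS =>
      ⟨memLp_of_continuous_isBounded hS.isBounded (hφs i).continuous,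
        memLp_of_continuous_isBounded hS.isBounded (hgc i)⟩⟩, (hφs i).contDiffOn,
      fun v hv hvc => ?_, ?_⟩
    · have := key i (hasWeakGradient_of_contDiff hv)
      rw [hBint, ← this]
      simp only [real_inner_comm]
    · have : φ i =ᶠ[Bornology.cobounded (Space d)] fun _ => 0 := by
        filter_upwards [tendsto_norm_cobounded_atTop.eventually_gt_atTop ρ] with x hx
        have : x ∉ closedBall (0 : Space d) ρ := by simpa using hx
        simp [hφ, (hout _ (hρ2 this)).1]
      exact this.trans_isBigO (Asymptotics.isBigO_zero _ _)
  have hpert : IsPerturbation γ (ball 0 R) D₁ := by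
    refine ⟨hDs.continuous.memLp_of_hasCompactSupport hDc, Eventually.of_forall fun x hx =>
      hD0 (hBρ fun h => hx (subset_closure h)), ?_⟩
    obtain ⟨s₀, hs₀, hmin⟩ := (isCompact_Icc (a := (0 : ℝ)) (b := R ^ 2)).exists_isMinOn
      ⟨0, ⟨le_rfl, hR2.le⟩⟩ hK.continuous.continuousOn
    refine ⟨min (K s₀) γ, lt_min (hKpos _) hγ, Eventually.of_forall fun x => ?_⟩
    simp only [hD₁, add_sub_cancel]
    rcases le_total (‖x‖ ^ 2) (R ^ 2) with h | h
    · exact (min_le_left _ _).trans (hmin ⟨sq_nonneg _, h⟩)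
    · rw [(hout _ (le_trans (by linarith) h)).2.1]
      exact min_le_right _ _
  refine ⟨D₁, hpert, ⟨fun r => K (r ^ 2) - γ, Eventually.of_forall fun x => rfl⟩, fun h0 => ?_,
    fun i j hi hj => ?_⟩
  · -- a trivial inclusion has trivial correctors
    let i : Fin d := ⟨0, by omega⟩
    have heq := ((isCorrector_single_iff i).1 (hcorr i)).equation (φ i) (hφs i) (hφc i)
    rw [hBint] at heq
    have e1 : ∫ x, D₁ x * inner ℝ (basisVec i : Space d) (∇ (φ i) x) = 0 := by
      rw [← integral_zero (Space d) ℝ]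
      refine integral_congr_ae ?_
      filter_upwards [h0] with x hx
      rw [hx, zero_mul]
    have e2 : ∫ x, γ * ‖∇ (φ i) x‖ ^ 2 = 0 := by
      rw [e1, neg_zero] at heq
      rw [← heq]
      refine integral_congr_ae ?_
      filter_upwards [h0] with x hx
      rw [hx, add_zero, real_inner_self_eq_norm_sq]
    have hcont : Continuous fun x => γ * ‖∇ (φ i) x‖ ^ 2 :=
      continuous_const.mul ((hgc i).norm.pow 2)
    have hgz (x : Space d) : ∇ (φ i) x = 0 := by
      by_contra hne
      have := hcont.integral_pos_of_hasCompactSupport_nonneg_nonzero (μ := volume) (x := x)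
        ((hgcs i).mono fun y hy => by
          intro h; apply hy; simp [h]) (fun y => by positivity)
        (by have := norm_ne_zero_iff.2 hne; positivity)
      exact this.ne' e2
    have hconst := is_const_of_fderiv_eq_zero (𝕜 := ℝ) ((hφs i).differentiable (by simp))
      (fun x => by
        rw [← norm_eq_zero, ← norm_gradient, hgz, norm_zero])
    -- `φ i` vanishes at the origin but not at the point of squared norm `R ^ 2 / 2` on the `i`-th
    -- axis, where `μ ≠ 1`.
    have := hconst ((√(R ^ 2 / 2)) • basisVec i) 0
    simp only [hφ] at this
    have hn : ‖(√(R ^ 2 / 2)) • (basisVec i : Space d)‖ ^ 2 = R ^ 2 / 2 := by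
      rw [norm_smul, mul_pow, Real.norm_of_nonneg (Real.sqrt_nonneg _),
        Real.sq_sqrt (by positivity)]
      simp
    rw [hn] at this
    simp [sub_eq_zero, hμ1] at this
    exact hR.ne' (by simpa [Real.sqrt_sq hR.le] using this)
  · obtain ⟨k, rfl⟩ := eq_single_of_order_eq_one hi
    obtain ⟨l, rfl⟩ := eq_single_of_order_eq_one hj
    refine ⟨⟨_, _, hcorr l⟩, fun u G h => ?_⟩
    have hv := (isCorrector_single_iff l).1 h
    -- The pairing of an arbitrary corrector `u` of index `l` with the explicit `φ k` is computed
    -- twice. The identity `key` gives `-∫ D₁ e_k·G`, and the equation of `u` gives `-∫ D₁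
    -- e_l·∇φ_k`. Applying `key` to the coordinate `x_l`, and using `∫ ∇φ_k = 0`, evaluates the
    -- latter as `∫ D₁ e_k·e_l`. Hence the entry vanishes without any uniqueness of correctors.
    have e1 := key k hv.memH1Loc.1
    have e2 := hv.equation (φ k) (hφs k) (hφc k)
    rw [hBint] at e2
    have e3 := key k (hasWeakGradient_of_contDiff (contDiff_coord l))
    simp only [gradient_coord] at e3
    have j1 : Integrable fun x => D₁ x * inner ℝ (basisVec l) (∇ (φ k) x) :=
      (hDs.continuous.mul (continuous_const.inner (hgc k))).integrable_of_hasCompactSupport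
        hDc.mul_right
    have e4 : ∫ x, (γ + D₁ x) * inner ℝ (basisVec l : Space d) (∇ (φ k) x)
        = ∫ x, D₁ x * inner ℝ (basisVec l) (∇ (φ k) x) := by
      have j2 : Integrable fun x => γ * inner ℝ (basisVec l) (∇ (φ k) x) :=
        (continuous_const.mul (continuous_const.inner (hgc k))).integrable_of_hasCompactSupport
          (HasCompactSupport.mul_left ((hgcs k).comp_left (g := fun y => inner ℝ (basisVec l) y)
            (inner_zero_right _)))
      simp only [add_mul]
      rw [integral_add j2 j1, integral_const_mul]
      simp only [inner_gradient_right]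
      rw [integral_fderiv_eq_zero ((hφs k).of_le (by simp)) (hφc k)]
      simp
    have hDi : Integrable fun x => D₁ x * inner ℝ (basisVec l : Space d) (basisVec k) :=
      (hDs.continuous.mul continuous_const).integrable_of_hasCompactSupport hDc.mul_right
    have hGi : Integrable fun x => D₁ x * inner ℝ (G x) (basisVec k : Space d) := by
      have := integrable_smul_of_locallyIntegrable hDs.continuous hDc hv.memH1Loc.1.locallyIntegrable.2
      have := this.inner_const (𝕜 := ℝ) (basisVec k : Space d)
      refine this.congr (Eventually.of_forall fun x => ?_)
      simp only [inner_smul_left]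
      simp
    simp only [polarizationEntry, gradient_monomial_single]
    rw [hBint]
    simp only [inner_add_left, mul_add]
    rw [integral_add hDi hGi]
    simp only [real_inner_comm (basisVec k : Space d)] at *
    linarith

end Existence

/-! ### Control of functions by their gradient -/

section Control

variable {d : ℕ} {Ω : Set (Space d)}

lemma sq_lintegral_le {α : Type*} [MeasurableSpace α] {μ : Measure α} {f : α → ℝ≥0∞}
    (hf : AEMeasurable f μ) : (∫⁻ x, f x ∂μ) ^ 2 ≤ μ Set.univ * ∫⁻ x, f x ^ 2 ∂μ := by
  have h := ENNReal.lintegral_mul_le_Lp_mul_Lq μ Real.HolderConjugate.two_two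
    (aemeasurable_const (b := (1 : ℝ≥0∞))) hf
  simp only [Pi.mul_apply, one_mul, ENNReal.one_rpow, lintegral_one] at h
  have h2 := pow_le_pow_left₀ (zero_le) h 2
  rw [mul_pow, ← ENNReal.rpow_natCast, ← ENNReal.rpow_natCast, ← ENNReal.rpow_mul,
    ← ENNReal.rpow_natCast, ← ENNReal.rpow_mul] at h2
  simpa using h2

lemma enorm_sub_sq_le {f : ℝ → ℝ} (hf : ContDiff ℝ 1 f) {b : ℝ} (hb : 0 ≤ b) :
    ‖f b - f 0‖ₑ ^ 2 ≤ ENNReal.ofReal b * ∫⁻ t in Set.Ioo 0 b, ‖deriv f t‖ₑ ^ 2 := by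
  have hc : Continuous (deriv f) := hf.continuous_deriv le_rfl
  have h1 : f b - f 0 = ∫ t in (0 : ℝ)..b, deriv f t :=
    (intervalIntegral.integral_deriv_eq_sub (fun x _ => hf.differentiable one_ne_zero x)
      (hc.intervalIntegrable _ _)).symm
  rw [h1, intervalIntegral.integral_of_le hb, integral_Ioc_eq_integral_Ioo]
  refine (pow_le_pow_left₀ (zero_le) (enorm_integral_le_lintegral_enorm _) 2).trans ?_
  refine (sq_lintegral_le hc.enorm.measurable.aemeasurable).trans ?_
  rw [Measure.restrict_apply_univ, Real.volume_Ioo, sub_zero]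

lemma deriv_comp_line {v : Space d → ℝ} (hv : ContDiff ℝ ∞ v) (x h : Space d) (t : ℝ) :
    deriv (fun t : ℝ => v (x + t • h)) t = inner ℝ (∇ v (x + t • h)) h := by
  have h1 : HasDerivAt (fun t : ℝ => x + t • h) h t := by
    simpa using ((hasDerivAt_id t).smul_const h).const_add x
  have h2 := (hv.differentiable (by simp) (x + t • h)).hasFDerivAt.comp_hasDerivAt t h1
  rw [inner_gradient_left]
  exact h2.deriv

lemma enorm_sub_sq_le_line {v : Space d → ℝ} (hv : ContDiff ℝ ∞ v) (x h : Space d) {b : ℝ}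
    (hb : 0 ≤ b) : ‖v (x + b • h) - v x‖ₑ ^ 2
      ≤ ENNReal.ofReal b * ∫⁻ t in Set.Ioo 0 b, ‖h‖ₑ ^ 2 * ‖∇ v (x + t • h)‖ₑ ^ 2 := by
  have hf : ContDiff ℝ 1 fun t : ℝ => v (x + t • h) :=
    (hv.of_le (by simp)).comp (contDiff_const.add (contDiff_id.smul contDiff_const))
  have h1 := enorm_sub_sq_le hf hb
  simp only [zero_smul, add_zero, deriv_comp_line hv] at h1
  refine h1.trans (mul_le_mul_right (lintegral_mono fun t => ?_) _)
  rw [← mul_pow]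
  refine pow_le_pow_left₀ (zero_le) ?_ 2
  rw [← enorm_norm h, ← enorm_norm (∇ v _), ← enorm_mul, mul_comm]
  exact enorm_le_iff_norm_le.2 (by
    rw [norm_mul, norm_norm, norm_norm]; exact norm_inner_le_norm _ _)

lemma measurable_enorm_gradient {v : Space d → ℝ} (hv : ContDiff ℝ ∞ v) :
    Measurable fun x => ‖∇ v x‖ₑ ^ 2 :=
  (contDiff_gradient hv).continuous.enorm.measurable.pow_const 2

/-- The difference is integrated along the segment from `x` to `x + h`; by Tonelli and translation
invariance each intermediate translate of `A` costs at most the energy in `Ω`. -/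
lemma lintegral_translate_sub_le (hΩ : MeasurableSet Ω) {v : Space d → ℝ} (hv : ContDiff ℝ ∞ v)
    {A : Set (Space d)} (hA : MeasurableSet A) {h : Space d}
    (hAΩ : ∀ x ∈ A, ∀ t ∈ Set.Ioo (0 : ℝ) 1, x + t • h ∈ Ω) :
    ∫⁻ x in A, ‖v (x + h) - v x‖ₑ ^ 2 ≤ ‖h‖ₑ ^ 2 * ∫⁻ x in Ω, ‖∇ v x‖ₑ ^ 2 := by
  have hm := measurable_enorm_gradient hv
  have hm2 : Measurable fun p : Space d × ℝ => ‖h‖ₑ ^ 2 * ‖∇ v (p.1 + p.2 • h)‖ₑ ^ 2 :=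
    (hm.comp (by fun_prop : Measurable fun p : Space d × ℝ => p.1 + p.2 • h)).const_mul _
  calc ∫⁻ x in A, ‖v (x + h) - v x‖ₑ ^ 2
      ≤ ∫⁻ x in A, ∫⁻ t in Set.Ioo (0 : ℝ) 1, ‖h‖ₑ ^ 2 * ‖∇ v (x + t • h)‖ₑ ^ 2 := by
        refine lintegral_mono fun x => ?_
        simpa using enorm_sub_sq_le_line hv x h zero_le_one
    _ = ∫⁻ t in Set.Ioo (0 : ℝ) 1, ∫⁻ x in A, ‖h‖ₑ ^ 2 * ‖∇ v (x + t • h)‖ₑ ^ 2 :=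
        lintegral_lintegral_swap hm2.aemeasurable
    _ ≤ ∫⁻ _ in Set.Ioo (0 : ℝ) 1, ‖h‖ₑ ^ 2 * ∫⁻ x in Ω, ‖∇ v x‖ₑ ^ 2 := by
        refine setLIntegral_mono measurable_const fun t ht => ?_
        rw [lintegral_const_mul' _ _ (by simp)]
        refine mul_le_mul_right ?_ _
        rw [← lintegral_indicator hA, ← lintegral_indicator hΩ,
          ← lintegral_add_right_eq_self (Ω.indicator _) (t • h)]
        refine lintegral_mono fun x => ?_
        by_cases hx : x ∈ A
        · rw [Set.indicator_of_mem hx, Set.indicator_of_mem (hAΩ x hx t ht)]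
        · rw [Set.indicator_of_notMem hx]
          exact zero_le
    _ = _ := by
        rw [setLIntegral_const, Real.volume_Ioo]
        simp

/-- The `L²(μ)` norm is controlled by the `L²(ν)` norm and the Dirichlet energy in `Ω`. -/
def Controls (Ω : Set (Space d)) (μ ν : Measure (Space d)) : Prop :=
  ∃ C : ℝ≥0, ∀ v : Space d → ℝ, ContDiff ℝ ∞ v →
    ∫⁻ x, ‖v x‖ₑ ^ 2 ∂μ ≤ C * (∫⁻ x, ‖v x‖ₑ ^ 2 ∂ν + ∫⁻ x in Ω, ‖∇ v x‖ₑ ^ 2)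

lemma Controls.trans {μ ν ρ : Measure (Space d)} (h : Controls Ω μ ν) (h' : Controls Ω ν ρ) :
    Controls Ω μ ρ := by
  obtain ⟨C, hC⟩ := h
  obtain ⟨C', hC'⟩ := h'
  refine ⟨C * (C' + 1), fun v hv => (hC v hv).trans ?_⟩
  push_cast
  rw [mul_assoc]
  refine mul_le_mul_right ?_ _
  rw [add_mul, one_mul]
  exact add_le_add (hC' v hv) le_add_self

lemma Controls.mono_left {μ μ' ν : Measure (Space d)} (h : Controls Ω μ ν) (hμ : μ' ≤ μ) :
    Controls Ω μ' ν := by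
  obtain ⟨C, hC⟩ := h
  exact ⟨C, fun v hv => (lintegral_mono' hμ le_rfl).trans (hC v hv)⟩

lemma Controls.refl (μ : Measure (Space d)) : Controls Ω μ μ :=
  ⟨1, fun v _ => by simp⟩

lemma Controls.add {μ μ' ν : Measure (Space d)} (h : Controls Ω μ ν) (h' : Controls Ω μ' ν) :
    Controls Ω (μ + μ') ν := by
  obtain ⟨C, hC⟩ := h
  obtain ⟨C', hC'⟩ := h'
  refine ⟨C + C', fun v hv => ?_⟩
  rw [lintegral_add_measure]
  push_cast
  rw [add_mul]
  exact add_le_add (hC v hv) (hC' v hv)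

lemma Controls.restrict_union {μ ν : Measure (Space d)} {s t : Set (Space d)}
    (h : Controls Ω (μ.restrict s) ν) (h' : Controls Ω (μ.restrict t) ν) :
    Controls Ω (μ.restrict (s ∪ t)) ν :=
  (h.add h').mono_left (Measure.restrict_union_le s t)

lemma Controls.zero (ν : Measure (Space d)) : Controls Ω 0 ν :=
  ⟨0, fun v _ => by simp⟩

/-- Local control on a compact set gives control. -/
lemma Controls.of_isCompact {μ ν : Measure (Space d)} {K : Set (Space d)} (hK : IsCompact K)
    (h : ∀ x ∈ K, ∃ t ∈ 𝓝[K] x, Controls Ω (μ.restrict t) ν) : Controls Ω (μ.restrict K) ν :=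
  hK.induction_on (p := fun s => Controls Ω (μ.restrict s) ν)
    (by rw [Measure.restrict_empty]; exact Controls.zero ν)
    (fun _ _ hst ht => ht.mono_left (Measure.restrict_mono hst le_rfl))
    (fun _ _ hs ht => hs.restrict_union ht) h

lemma enorm_sq_le (a b : ℝ) : ‖a‖ₑ ^ 2 ≤ 2 * ‖b‖ₑ ^ 2 + 2 * ‖a - b‖ₑ ^ 2 := by
  have h : ‖a‖ₑ ≤ ‖b‖ₑ + ‖a - b‖ₑ := by
    calc ‖a‖ₑ = ‖b + (a - b)‖ₑ := by ring_nf
      _ ≤ _ := enorm_add_le _ _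
  refine (pow_le_pow_left₀ (zero_le) h 2).trans ?_
  rw [← mul_add]
  have h2 := ENNReal.rpow_add_le_mul_rpow_add_rpow ‖b‖ₑ ‖a - b‖ₑ (p := 2) (by norm_num)
  have h3 : (2 : ℝ) - 1 = 1 := by norm_num
  rw [h3, ENNReal.rpow_one] at h2
  exact_mod_cast h2

/-- Control of a translated set. -/
lemma controls_translate (hΩ : MeasurableSet Ω) {A : Set (Space d)} (hA : MeasurableSet A)
    {h : Space d} (hAΩ : ∀ x ∈ A, ∀ t ∈ Set.Ioo (0 : ℝ) 1, x + t • h ∈ Ω) :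
    Controls Ω (volume.restrict ((fun x => x - h) ⁻¹' A)) (volume.restrict A) := by
  refine ⟨2 + 2 * ‖h‖₊ ^ 2, fun v hv => ?_⟩
  have hA' : MeasurableSet ((fun x => x - h) ⁻¹' A) := hA.preimage (by fun_prop)
  have hvm : Measurable fun x => ‖v x‖ₑ ^ 2 := hv.continuous.enorm.measurable.pow_const 2
  calc ∫⁻ x in (fun x => x - h) ⁻¹' A, ‖v x‖ₑ ^ 2
      = ∫⁻ x in A, ‖v (x + h)‖ₑ ^ 2 := by
        rw [← lintegral_indicator hA', ← lintegral_indicator hA,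
          ← lintegral_add_right_eq_self _ h]
        refine lintegral_congr fun x => ?_
        by_cases hx : x ∈ A
        · rw [Set.indicator_of_mem hx, Set.indicator_of_mem (by simpa using hx)]
        · rw [Set.indicator_of_notMem hx, Set.indicator_of_notMem (by simpa using hx)]
    _ ≤ ∫⁻ x in A, (2 * ‖v x‖ₑ ^ 2 + 2 * ‖v (x + h) - v x‖ₑ ^ 2) :=
        lintegral_mono fun x => enorm_sq_le _ _
    _ = 2 * (∫⁻ x in A, ‖v x‖ₑ ^ 2) + 2 * (∫⁻ x in A, ‖v (x + h) - v x‖ₑ ^ 2) := by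
        rw [lintegral_add_left (hvm.const_mul 2), lintegral_const_mul _ hvm,
          lintegral_const_mul' _ _ (by simp)]
    _ ≤ 2 * (∫⁻ x in A, ‖v x‖ₑ ^ 2) + 2 * (‖h‖ₑ ^ 2 * ∫⁻ x in Ω, ‖∇ v x‖ₑ ^ 2) :=
        add_le_add le_rfl (mul_le_mul_right (lintegral_translate_sub_le hΩ hv hA hAΩ) _)
    _ ≤ _ := by
        rw [mul_add]
        push_cast
        refine add_le_add (mul_le_mul_left le_self_add _) ?_
        rw [← mul_assoc]
        refine mul_le_mul_left ?_ _
        rw [← enorm_eq_nnnorm]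
        exact le_add_self

/-- Chains of balls. -/
lemma controls_ball_of_isConnected (hΩ : IsOpen Ω) (hc : IsPreconnected Ω) {x₁ : Space d}
    (hx₁ : x₁ ∈ Ω) {r₁ : ℝ} (hr₁ : 0 < r₁) :
    ∀ x ∈ Ω, ∃ r, 0 < r ∧ Controls Ω (volume.restrict (ball x r)) (volume.restrict (ball x₁ r₁)) := by
  set S : Set (Space d) := {x | ∃ r, 0 < r ∧
    Controls Ω (volume.restrict (ball x r)) (volume.restrict (ball x₁ r₁))} with hS
  have hSo : IsOpen S := by
    refine isOpen_iff_mem_nhds.2 fun x ⟨r, hr, hx⟩ => ?_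
    filter_upwards [ball_mem_nhds x (half_pos hr)] with y hy
    refine ⟨r / 2, half_pos hr, hx.mono_left (Measure.restrict_mono ?_ le_rfl)⟩
    refine ball_subset_ball' ?_
    have := mem_ball.1 hy
    linarith
  have hsub : Ω ⊆ S := by
    -- The centres of controlled balls form an open set that is also closed relative to `Ω`: at a
    -- limit point, a small controlled ball is translated from a nearby centre.
    refine hc.subset_of_closure_inter_subset hSo ⟨x₁, hx₁, r₁, hr₁, Controls.refl _⟩ ?_
    rintro x ⟨hxS, hxΩ⟩
    obtain ⟨r, hr, hrΩ⟩ := Metric.isOpen_iff.1 hΩ x hxΩ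
    obtain ⟨y, ⟨r', hr', hy⟩, hxy⟩ := Metric.mem_closure_iff.1 hxS (r / 2) (half_pos hr)
    refine ⟨min r' (r / 2), lt_min hr' (half_pos hr), ?_⟩
    have h1 : Controls Ω (volume.restrict (ball y (min r' (r / 2))))
        (volume.restrict (ball x₁ r₁)) :=
      hy.mono_left (Measure.restrict_mono (ball_subset_ball (min_le_left _ _)) le_rfl)
    have h2 := controls_translate hΩ.measurableSet (A := ball y (min r' (r / 2))) measurableSet_ball
      (h := x - y) (fun z hz t ht => hrΩ ?_)
    · have e : (fun z => z - (x - y)) ⁻¹' ball y (min r' (r / 2)) = ball x (min r' (r / 2)) := by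
        ext z
        simp only [Set.mem_preimage, mem_ball, dist_eq_norm]
        congr! 2
        abel
      rw [e] at h2
      exact h2.trans h1
    · have hz' : ‖z - y‖ < r / 2 := by
        have := (mem_ball.1 hz).trans_le (min_le_right _ _)
        rwa [dist_eq_norm] at this
      rw [mem_ball, dist_eq_norm]
      have e : z + t • (x - y) - x = (z - y) + (1 - t) • (y - x) := by module
      rw [e]
      have h3 : ‖(1 - t) • (y - x)‖ ≤ ‖y - x‖ := by
        rw [norm_smul, Real.norm_of_nonneg (by linarith [ht.2])]
        exact mul_le_of_le_one_left (norm_nonneg _) (by linarith [ht.1])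
      have h4 : ‖y - x‖ < r / 2 := by rwa [← dist_eq_norm, dist_comm]
      linarith [norm_add_le (z - y) ((1 - t) • (y - x))]
  exact hsub

lemma controls_of_isCompact_subset (hΩ : IsOpen Ω) (hc : IsPreconnected Ω) {x₁ : Space d}
    (hx₁ : x₁ ∈ Ω) {r₁ : ℝ} (hr₁ : 0 < r₁) {K : Set (Space d)} (hK : IsCompact K) (hKΩ : K ⊆ Ω) :
    Controls Ω (volume.restrict K) (volume.restrict (ball x₁ r₁)) := by
  refine Controls.of_isCompact hK fun x hx => ?_
  obtain ⟨r, hr, h⟩ := controls_ball_of_isConnected hΩ hc hx₁ hr₁ x (hKΩ hx)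
  exact ⟨ball x r, mem_nhdsWithin_of_mem_nhds (ball_mem_nhds x hr), h⟩

/-- Poincaré's inequality in a ball, with a value of the function in place of its mean. -/
lemma exists_poincare_ball (hΩ : MeasurableSet Ω) {x₁ : Space d} {r₁ : ℝ} (hr₁ : 0 < r₁)
    (hB : ball x₁ r₁ ⊆ Ω) : ∃ C : ℝ≥0, ∀ v : Space d → ℝ, ContDiff ℝ ∞ v → ∃ c : ℝ,
      ∫⁻ x in ball x₁ r₁, ‖v x - c‖ₑ ^ 2 ≤ C * ∫⁻ x in Ω, ‖∇ v x‖ₑ ^ 2 := by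
  set B := ball x₁ r₁ with hBdef
  have hBm : MeasurableSet B := measurableSet_ball
  have hB0 : volume B ≠ 0 := (measure_ball_pos volume x₁ hr₁).ne'
  have hBt : volume B ≠ ⊤ := measure_ball_lt_top.ne
  set B2 := ball (0 : Space d) (2 * r₁)
  have hB2t : volume B2 ≠ ⊤ := measure_ball_lt_top.ne
  refine ⟨((volume B)⁻¹ * (ENNReal.ofReal (2 * r₁) ^ 2 * volume B2)).toNNReal, fun v hv => ?_⟩
  have hvm : Measurable v := hv.continuous.measurable
  set E := ∫⁻ x in Ω, ‖∇ v x‖ₑ ^ 2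
  have hm : Measurable fun p : Space d × Space d => ‖v p.2 - v p.1‖ₑ ^ 2 :=
    ((hvm.comp measurable_snd).sub (hvm.comp measurable_fst)).enorm.pow_const 2
  -- Substituting `x = y + h` with `|h| < 2 r₁` reduces the double integral to translation
  -- differences. Convexity of the ball keeps the connecting segments inside `Ω`.
  have key : ∫⁻ y in B, ∫⁻ x in B, ‖v x - v y‖ₑ ^ 2
      ≤ ENNReal.ofReal (2 * r₁) ^ 2 * volume B2 * E := by
    have e1 : ∀ y ∈ B, ∫⁻ x in B, ‖v x - v y‖ₑ ^ 2
        ≤ ∫⁻ h in B2, B.indicator (fun z => ‖v z - v y‖ₑ ^ 2) (y + h) := by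
      intro y hy
      rw [← lintegral_indicator hBm, ← lintegral_indicator measurableSet_ball,
        ← lintegral_add_left_eq_self _ y]
      refine lintegral_mono fun h => ?_
      by_cases hh : y + h ∈ B
      · have : h ∈ B2 := by
          rw [mem_ball_zero_iff]
          have h1 : ‖y + h - x₁‖ < r₁ := by rwa [← dist_eq_norm]
          have h2 : ‖y - x₁‖ < r₁ := by rwa [← dist_eq_norm]
          have e : h = (y + h - x₁) - (y - x₁) := by abel
          rw [e]
          linarith [norm_sub_le (y + h - x₁) (y - x₁)]
        rw [Set.indicator_of_mem this]
      · rw [Set.indicator_of_notMem hh]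
        exact zero_le
    have hm2 : Measurable fun p : Space d × Space d =>
        B.indicator (fun z => ‖v z - v p.1‖ₑ ^ 2) (p.1 + p.2) := by
      have e : (fun p : Space d × Space d => B.indicator (fun z => ‖v z - v p.1‖ₑ ^ 2) (p.1 + p.2))
          = ((fun p : Space d × Space d => p.1 + p.2) ⁻¹' B).indicator
            fun p => ‖v (p.1 + p.2) - v p.1‖ₑ ^ 2 := by
        ext1 p
        rfl
      rw [e]
      refine Measurable.indicator ?_ (hBm.preimage (by fun_prop))
      exact ((hvm.comp (by fun_prop)).sub (hvm.comp measurable_fst)).enorm.pow_const 2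
    calc ∫⁻ y in B, ∫⁻ x in B, ‖v x - v y‖ₑ ^ 2
        ≤ ∫⁻ y in B, ∫⁻ h in B2, B.indicator (fun z => ‖v z - v y‖ₑ ^ 2) (y + h) :=
          setLIntegral_mono' hBm e1
      _ = ∫⁻ h in B2, ∫⁻ y in B, B.indicator (fun z => ‖v z - v y‖ₑ ^ 2) (y + h) :=
          lintegral_lintegral_swap hm2.aemeasurable
      _ ≤ ∫⁻ _ in B2, ENNReal.ofReal (2 * r₁) ^ 2 * E := by
          refine setLIntegral_mono' measurableSet_ball fun h hh => ?_
          have hAm : MeasurableSet (B ∩ (fun y => y + h) ⁻¹' B) :=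
            hBm.inter (hBm.preimage (by fun_prop))
          have h1 := lintegral_translate_sub_le hΩ hv hAm (h := h) (fun y hy t ht => hB (by
            have := (convex_ball x₁ r₁) hy.1 hy.2 (a := 1 - t) (b := t) (by linarith [ht.2])
              ht.1.le (by ring)
            convert this using 1
            module))
          calc ∫⁻ y in B, B.indicator (fun z => ‖v z - v y‖ₑ ^ 2) (y + h)
              = ∫⁻ y in B ∩ (fun y => y + h) ⁻¹' B, ‖v (y + h) - v y‖ₑ ^ 2 := by
                rw [← lintegral_indicator hBm, ← lintegral_indicator hAm]
                refine lintegral_congr fun y => ?_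
                by_cases h1 : y ∈ B <;> by_cases h2 : y + h ∈ B <;>
                  simp [Set.indicator, h1, h2]
            _ ≤ ‖h‖ₑ ^ 2 * E := h1
            _ ≤ _ := by
                refine mul_le_mul_left (pow_le_pow_left₀ (zero_le) ?_ 2) _
                rw [← ofReal_norm]
                exact ENNReal.ofReal_le_ofReal (mem_ball_zero_iff.1 hh).le
      _ = _ := by
          rw [setLIntegral_const]
          ring
  -- Some `y` does no worse than the average over the ball, and `v y` serves as the constant.
  obtain ⟨y, hy, hle⟩ := exists_le_setLAverage hB0 hBt
    (f := fun y => ∫⁻ x in B, ‖v x - v y‖ₑ ^ 2) (by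
      have : Measurable fun y => ∫⁻ x in B, ‖v x - v y‖ₑ ^ 2 := hm.lintegral_prod_right'
      exact this.aemeasurable)
  refine ⟨v y, hle.trans ?_⟩
  rw [ENNReal.coe_toNNReal (ENNReal.mul_ne_top (ENNReal.inv_ne_top.2 hB0)
    (ENNReal.mul_ne_top (ENNReal.pow_ne_top ENNReal.ofReal_ne_top) hB2t)), setLAverage_eq, ENNReal.div_eq_inv_mul, mul_assoc]
  exact mul_le_mul_right key _

end Control

/-! ### The trace inequality -/

section Boundary

open scoped Pointwise

variable {d : ℕ} {Ω : Set (Space d)}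

lemma euclideanHausdorffMeasure_image_le {K : ℝ≥0} {f : Space d → Space d} (h : LipschitzWith K f)
    (n : ℕ) (s : Set (Space d)) :
    Measure.euclideanHausdorffMeasure n (f '' s)
      ≤ (K : ℝ≥0∞) ^ n * Measure.euclideanHausdorffMeasure n s := by
  simp only [Measure.euclideanHausdorffMeasure_def, Measure.smul_apply, ENNReal.smul_def,
    smul_eq_mul]
  rw [mul_left_comm]
  have := h.hausdorffMeasure_image_le (d := n) (Nat.cast_nonneg n) s
  rw [ENNReal.rpow_natCast] at this
  exact mul_le_mul_right this _

lemma euclideanHausdorffMeasure_self :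
    (Measure.euclideanHausdorffMeasure d : Measure (Space d)) = volume :=
  EuclideanSpace.euclideanHausdorffMeasure_eq_volume d

/-- The height of the graph of `h` above a point, in the direction `ν`. -/
def graphHeight (ν : Space d) (h : Space d → ℝ) (x : Space d) : ℝ := h (x - inner ℝ x ν • ν)

lemma graphHeight_add {ν : Space d} (hν : ‖ν‖ = 1) (h : Space d → ℝ) (x : Space d) (s : ℝ) :
    graphHeight ν h (x + s • ν) = graphHeight ν h x := by
  rw [graphHeight, graphHeight, inner_add_left, inner_smul_left, real_inner_self_eq_norm_sq, hν]
  congr 1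
  simp
  module

lemma lipschitzWith_graphHeight {ν : Space d} (hν : ‖ν‖ = 1) {K : ℝ≥0} {h : Space d → ℝ}
    (hh : LipschitzWith K h) : LipschitzWith K (graphHeight ν h) := by
  have h1 : LipschitzWith 1 fun x : Space d => x - inner ℝ x ν • ν := by
    refine LipschitzWith.of_dist_le_mul fun x y => ?_
    rw [dist_eq_norm, dist_eq_norm, NNReal.coe_one, one_mul]
    have e : x - inner ℝ x ν • ν - (y - inner ℝ y ν • ν)
        = (x - y) - inner ℝ (x - y) ν • ν := by
      rw [inner_sub_left]; module
    rw [e]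
    have h2 : ‖(x - y) - inner ℝ (x - y) ν • ν‖ ^ 2 ≤ ‖x - y‖ ^ 2 := by
      rw [norm_sub_sq_real, inner_smul_right, norm_smul, hν]
      simp only [Real.norm_eq_abs, mul_one, sq_abs]
      nlinarith [sq_nonneg (inner ℝ (x - y) ν)]
    exact (pow_le_pow_iff_left₀ (norm_nonneg _) (norm_nonneg _) two_ne_zero).1 h2
  have h2 := hh.comp h1
  rw [mul_one] at h2
  exact h2

/-- The shear `Ψ x = x + graphHeight ν h x • ν` is bi-Lipschitz and maps the hyperplane orthogonal
to `ν` onto the graph. The piece of the graph entering `t` after a shift by `s` is thus a Lipschitz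
image of the slice of `Ψ ⁻¹' t` at height `s`. Slicing the volume of `Ψ ⁻¹' t` by hyperplanes gives
the bound, at the price of powers of the Lipschitz constants. -/
lemma lintegral_measure_translate_graph_le {ν : Space d} (hν : ‖ν‖ = 1) {K : ℝ≥0}
    {h : Space d → ℝ} (hh : LipschitzWith K h) {Γ : Set (Space d)}
    (hΓ : ∀ x ∈ Γ, inner ℝ x ν = graphHeight ν h x) {t : Set (Space d)} (ht : MeasurableSet t) :
    ∫⁻ s : ℝ, Measure.euclideanHausdorffMeasure (d - 1) {x | x ∈ Γ ∧ x + s • ν ∈ t}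
      ≤ ((1 + K : ℝ≥0) : ℝ≥0∞) ^ (d - 1) * (((1 + K : ℝ≥0) : ℝ≥0∞) ^ d * volume t) := by
  have hH := lipschitzWith_graphHeight hν hh
  have hsm : LipschitzWith 1 fun s : ℝ => s • ν := by
    refine LipschitzWith.of_dist_le_mul fun x y => ?_
    rw [dist_eq_norm, ← sub_smul, norm_smul, hν, dist_eq_norm]
    simp
  have hHν : LipschitzWith K fun x => graphHeight ν h x • ν := by
    have h2 := hsm.comp hH
    rw [one_mul] at h2
    exact h2
  set Ψ : Space d → Space d := fun x => x + graphHeight ν h x • ν with hΨ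
  have hΨL : LipschitzWith (1 + K) Ψ := LipschitzWith.id.add hHν
  set Ψ' : Space d → Space d := fun x => x - graphHeight ν h x • ν with hΨ'
  have hΨ'L : LipschitzWith (1 + K) Ψ' := LipschitzWith.id.sub hHν
  have hinv (x : Space d) : Ψ' (Ψ x) = x := by
    simp only [hΨ, hΨ', graphHeight_add hν]
    abel
  have hsub (s : ℝ) : {x | x ∈ Γ ∧ x + s • ν ∈ t} ⊆ (fun z => Ψ (z - s • ν)) ''
      (Ψ ⁻¹' t ∩ (AffineSubspace.mk' (s • ν +ᵥ (0 : Space d)) (ℝ ∙ ν)ᗮ : Set (Space d))) := by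
    rintro x ⟨hx, hxt⟩
    have hxg := hΓ x hx
    have e1 : Ψ' x = x + (-graphHeight ν h x) • ν := by simp only [hΨ']; module
    have e2 : graphHeight ν h (Ψ' x) = graphHeight ν h x := by rw [e1, graphHeight_add hν]
    refine ⟨Ψ' x + s • ν, ⟨?_, ?_⟩, ?_⟩
    · have : Ψ (Ψ' x + s • ν) = x + s • ν := by
        simp only [hΨ]
        rw [graphHeight_add hν, e2, e1]
        module
      rw [Set.mem_preimage, this]
      exact hxt
    · rw [SetLike.mem_coe, AffineSubspace.mem_mk', Submodule.mem_orthogonal_singleton_iff_inner_left]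
      simp only [vadd_eq_add, add_zero, vsub_eq_sub, add_sub_cancel_right, hΨ']
      rw [inner_sub_left, inner_smul_left, real_inner_self_eq_norm_sq, hν, hxg]
      simp
    · simp only [add_sub_cancel_right, hΨ]
      rw [e2, e1]
      module
  have hL (s : ℝ) : LipschitzWith (1 + K) fun z => Ψ (z - s • ν) := by
    have : LipschitzWith 1 fun z : Space d => z - s • ν := by
      refine LipschitzWith.of_dist_le_mul fun x y => ?_
      simp
    have h2 := hΨL.comp this
    rw [mul_one] at h2
    exact h2
  have hν0 : ν ≠ 0 := by
    intro h0; rw [h0, norm_zero] at hν; exact zero_ne_one hν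
  have hfub := EuclideanGeometry.euclideanHausdorffMeasure_eq_lintegral (0 : Space d) hν0
    (ht.preimage hΨL.continuous.measurable)
  have hfin : Module.finrank ℝ (Space d) = d := by simp
  rw [hfin, euclideanHausdorffMeasure_self, ← enorm_norm, hν, enorm_one, one_mul] at hfub
  calc ∫⁻ s : ℝ, Measure.euclideanHausdorffMeasure (d - 1) {x | x ∈ Γ ∧ x + s • ν ∈ t}
      ≤ ∫⁻ s : ℝ, ((1 + K : ℝ≥0) : ℝ≥0∞) ^ (d - 1) * Measure.euclideanHausdorffMeasure (d - 1)
        (Ψ ⁻¹' t ∩ (AffineSubspace.mk' (s • ν +ᵥ (0 : Space d)) (ℝ ∙ ν)ᗮ : Set (Space d))) :=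
        lintegral_mono fun s => (measure_mono (hsub s)).trans
          (euclideanHausdorffMeasure_image_le (hL s) _ _)
    _ = ((1 + K : ℝ≥0) : ℝ≥0∞) ^ (d - 1) * volume (Ψ ⁻¹' t) := by
        rw [lintegral_const_mul' _ _ (ENNReal.pow_ne_top ENNReal.coe_ne_top), hfub]
    _ ≤ _ := by
        refine mul_le_mul_right ?_ _
        have hsub2 : Ψ ⁻¹' t ⊆ Ψ' '' t := fun x hx => ⟨Ψ x, hx, hinv x⟩
        refine (measure_mono hsub2).trans ?_
        have := euclideanHausdorffMeasure_image_le hΨ'L d t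
        rwa [euclideanHausdorffMeasure_self] at this

/-- A compact piece of a Lipschitz graph has finite measure, and integrals over the translates of
the graph are controlled by volume integrals. -/
lemma exists_lintegral_graph_le {ν : Space d} (hν : ‖ν‖ = 1) {K : ℝ≥0}
    {h : Space d → ℝ} (hh : LipschitzWith K h) {Γ : Set (Space d)} (hΓc : IsCompact Γ)
    (hΓ : ∀ x ∈ Γ, inner ℝ x ν = graphHeight ν h x) :
    Measure.euclideanHausdorffMeasure (d - 1) Γ < ⊤ ∧
    ∃ C : ℝ≥0, ∀ (A : Set ℝ) (T : Set (Space d)), MeasurableSet A → MeasurableSet T →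
      (∀ x ∈ Γ, ∀ s ∈ A, x + s • ν ∈ T) → ∀ f : Space d → ℝ≥0∞, Measurable f →
      ∫⁻ x in Γ, (∫⁻ s in A, f (x + s • ν)) ∂(Measure.euclideanHausdorffMeasure (d - 1))
        ≤ C * ∫⁻ x in T, f x := by
  set C : ℝ≥0 := (1 + K) ^ (d - 1) * (1 + K) ^ d with hC
  have key {t : Set (Space d)} (ht : MeasurableSet t) :
      ∫⁻ s : ℝ, Measure.euclideanHausdorffMeasure (d - 1) {x | x ∈ Γ ∧ x + s • ν ∈ t}
        ≤ C * volume t := by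
    refine (lintegral_measure_translate_graph_le hν hh hΓ ht).trans_eq ?_
    rw [hC]
    push_cast
    ring
  have hfin : Measure.euclideanHausdorffMeasure (d - 1) Γ < ⊤ := by
    have hT : IsCompact (Γ + (fun s : ℝ => s • ν) '' Set.Icc 0 1) :=
      hΓc.add ((isCompact_Icc).image (by fun_prop))
    -- For all shifts `s` in the unit interval the whole of `Γ` lands in one compact set, so its
    -- measure is at most a multiple of a finite volume.
    have h1 : Measure.euclideanHausdorffMeasure (d - 1) Γ
        ≤ C * volume (Γ + (fun s : ℝ => s • ν) '' Set.Icc 0 1) := by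
      calc Measure.euclideanHausdorffMeasure (d - 1) Γ
          = ∫⁻ _ in Set.Icc (0 : ℝ) 1, Measure.euclideanHausdorffMeasure (d - 1) Γ := by simp
        _ ≤ ∫⁻ s in Set.Icc (0 : ℝ) 1, Measure.euclideanHausdorffMeasure (d - 1)
              {x | x ∈ Γ ∧ x + s • ν ∈ Γ + (fun s : ℝ => s • ν) '' Set.Icc 0 1} := by
            refine setLIntegral_mono' measurableSet_Icc fun s hs => measure_mono fun x hx =>
              ⟨hx, Set.add_mem_add hx ⟨s, hs, rfl⟩⟩
        _ ≤ _ := (setLIntegral_le_lintegral _ _).trans (key hT.measurableSet)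
    exact h1.trans_lt (ENNReal.mul_lt_top ENNReal.coe_lt_top hT.measure_lt_top)
  refine ⟨hfin, C, fun A T hA hT hAT f hf => ?_⟩
  have : IsFiniteMeasure ((Measure.euclideanHausdorffMeasure (d - 1)).restrict Γ) :=
    ⟨by rwa [Measure.restrict_apply_univ]⟩
  have hm : Measurable fun p : Space d × ℝ => p.1 + p.2 • ν := by fun_prop
  -- The volume bound for sets says that the image of (surface measure) × `ds` under `(x, s) ↦ x + s
  -- ν` is dominated by a multiple of volume on `T`; the bound for functions follows by integration.
  have hle : (((Measure.euclideanHausdorffMeasure (d - 1)).restrict Γ).prod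
      (volume.restrict A)).map (fun p : Space d × ℝ => p.1 + p.2 • ν)
      ≤ (C : ℝ≥0∞) • volume.restrict T := by
    refine Measure.le_iff.2 fun t ht => ?_
    rw [Measure.map_apply hm ht, Measure.prod_apply_symm (hm ht), Measure.smul_apply, smul_eq_mul,
      Measure.restrict_apply ht]
    refine le_trans ?_ (key (ht.inter hT))
    refine le_trans (setLIntegral_mono' hA fun s hs => ?_) (setLIntegral_le_lintegral A _)
    rw [Measure.restrict_apply' hΓc.measurableSet]
    refine measure_mono fun x hx => ⟨hx.2, hx.1, hAT x hx.2 s hs⟩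
  calc ∫⁻ x in Γ, (∫⁻ s in A, f (x + s • ν)) ∂(Measure.euclideanHausdorffMeasure (d - 1))
      = ∫⁻ p, f (p.1 + p.2 • ν) ∂(((Measure.euclideanHausdorffMeasure (d - 1)).restrict Γ).prod
      (volume.restrict A)) := (lintegral_prod _ (hf.comp hm).aemeasurable).symm
    _ = ∫⁻ x, f x ∂((((Measure.euclideanHausdorffMeasure (d - 1)).restrict Γ).prod
      (volume.restrict A)).map (fun p : Space d × ℝ => p.1 + p.2 • ν)) :=
        (lintegral_map hf hm).symm
    _ ≤ ∫⁻ x, f x ∂((C : ℝ≥0∞) • volume.restrict T) := lintegral_mono' hle le_rfl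
    _ = _ := by rw [lintegral_smul_measure, smul_eq_mul]

/-- The value at a boundary point is compared with those at the points `x + s ν` with `b/2 < s < b`,
the difference being bounded by the energy along the segment, and then averaged over `s`. Keeping
`s` away from zero places the comparison points in a compact subset of `Ω`. -/
lemma controls_graph (hΩ : MeasurableSet Ω) {ν : Space d} (hν : ‖ν‖ = 1) {K : ℝ≥0}
    {h : Space d → ℝ} (hh : LipschitzWith K h) {Γ : Set (Space d)} (hΓc : IsCompact Γ)
    (hΓ : ∀ x ∈ Γ, inner ℝ x ν = graphHeight ν h x) {b : ℝ} (hb : 0 < b)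
    (hΩΓ : ∀ x ∈ Γ, ∀ s ∈ Set.Ioc 0 b, x + s • ν ∈ Ω) :
    ∃ I : Set (Space d), IsCompact I ∧ I ⊆ Ω ∧
      Controls Ω ((Measure.euclideanHausdorffMeasure (d - 1)).restrict Γ) (volume.restrict I) := by
  obtain ⟨-, C, hC⟩ := exists_lintegral_graph_le hν hh hΓc hΓ
  set I : Set (Space d) := Γ + (fun s : ℝ => s • ν) '' Set.Icc (b / 2) b with hI
  have hIc : IsCompact I := hΓc.add (isCompact_Icc.image (by fun_prop))
  refine ⟨I, hIc, ?_, ?_⟩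
  · rintro _ ⟨x, hx, _, ⟨s, hs, rfl⟩, rfl⟩
    exact hΩΓ x hx s ⟨by linarith [hs.1], hs.2⟩
  set β := ENNReal.ofReal (b / 2) with hβ
  have hβ0 : β ≠ 0 := by simp [hβ, hb]
  have hβt : β ≠ ⊤ := ENNReal.ofReal_ne_top
  refine ⟨(β⁻¹ * (2 * C + β * 2 * ENNReal.ofReal b * C)).toNNReal, fun v hv => ?_⟩
  have hCt : β⁻¹ * (2 * C + β * 2 * ENNReal.ofReal b * C) ≠ ⊤ := by
    refine ENNReal.mul_ne_top (ENNReal.inv_ne_top.2 hβ0) (ENNReal.add_ne_top.2 ⟨?_, ?_⟩)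
    · exact ENNReal.mul_ne_top (by simp) ENNReal.coe_ne_top
    · exact ENNReal.mul_ne_top (ENNReal.mul_ne_top (ENNReal.mul_ne_top hβt (by simp))
        ENNReal.ofReal_ne_top) ENNReal.coe_ne_top
  rw [ENNReal.coe_toNNReal hCt]
  set μ : Measure (Space d) := Measure.euclideanHausdorffMeasure (d - 1) with hμ
  have hvm : Measurable fun x => ‖v x‖ₑ ^ 2 := hv.continuous.enorm.measurable.pow_const 2
  have hgm := measurable_enorm_gradient hv
  set E := ∫⁻ x in Ω, ‖∇ v x‖ₑ ^ 2
  have hpt (x : Space d) : β * ‖v x‖ₑ ^ 2 ≤ 2 * (∫⁻ s in Set.Ioo (b / 2) b, ‖v (x + s • ν)‖ₑ ^ 2)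
      + β * 2 * ENNReal.ofReal b * ∫⁻ t in Set.Ioo 0 b, ‖∇ v (x + t • ν)‖ₑ ^ 2 := by
    have h1 : ∀ s ∈ Set.Ioo (b / 2) b, ‖v x‖ₑ ^ 2 ≤ 2 * ‖v (x + s • ν)‖ₑ ^ 2
        + 2 * (ENNReal.ofReal b * ∫⁻ t in Set.Ioo 0 b, ‖∇ v (x + t • ν)‖ₑ ^ 2) := by
      intro s hs
      refine (enorm_sq_le (v x) (v (x + s • ν))).trans (add_le_add le_rfl (mul_le_mul_right ?_ _))
      rw [← enorm_neg, neg_sub]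
      refine (enorm_sub_sq_le_line hv x ν (by linarith [hs.1])).trans ?_
      rw [← enorm_norm ν, hν]
      simp only [enorm_one, one_pow, one_mul]
      exact mul_le_mul' (ENNReal.ofReal_le_ofReal hs.2.le)
        (lintegral_mono_set (Set.Ioo_subset_Ioo_right hs.2.le))
    have hvol : volume (Set.Ioo (b / 2) b) = β := by
      rw [Real.volume_Ioo, hβ]; congr 1; ring
    calc β * ‖v x‖ₑ ^ 2 = ∫⁻ _ in Set.Ioo (b / 2) b, ‖v x‖ₑ ^ 2 := by
          rw [setLIntegral_const, hvol, mul_comm]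
      _ ≤ ∫⁻ s in Set.Ioo (b / 2) b, (2 * ‖v (x + s • ν)‖ₑ ^ 2
        + 2 * (ENNReal.ofReal b * ∫⁻ t in Set.Ioo 0 b, ‖∇ v (x + t • ν)‖ₑ ^ 2)) :=
          setLIntegral_mono' measurableSet_Ioo h1
      _ = _ := by
          rw [lintegral_add_right _ measurable_const, setLIntegral_const, hvol,
            lintegral_const_mul' _ _ (by simp)]
          ring
  have hm1 : Measurable fun x => ∫⁻ s in Set.Ioo (b / 2) b, ‖v (x + s • ν)‖ₑ ^ 2 := by
    have : Measurable fun p : Space d × ℝ => ‖v (p.1 + p.2 • ν)‖ₑ ^ 2 :=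
      hvm.comp (by fun_prop : Measurable fun p : Space d × ℝ => p.1 + p.2 • ν)
    exact this.lintegral_prod_right'
  have hint : β * ∫⁻ x in Γ, ‖v x‖ₑ ^ 2 ∂μ
      ≤ 2 * (C * ∫⁻ x in I, ‖v x‖ₑ ^ 2) + β * 2 * ENNReal.ofReal b * (C * E) := by
    rw [← lintegral_const_mul _ hvm]
    refine (lintegral_mono hpt).trans ?_
    rw [lintegral_add_left (hm1.const_mul 2), lintegral_const_mul' _ _ (by simp),
      lintegral_const_mul' _ _ (ENNReal.mul_ne_top (ENNReal.mul_ne_top hβt (by simp))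
        ENNReal.ofReal_ne_top)]
    refine add_le_add (mul_le_mul_right ?_ _) (mul_le_mul_right ?_ _)
    · exact hC _ I measurableSet_Ioo hIc.measurableSet (fun x hx s hs =>
        Set.add_mem_add hx ⟨s, ⟨hs.1.le, hs.2.le⟩, rfl⟩) _ hvm
    · exact hC _ Ω measurableSet_Ioo hΩ (fun x hx s hs => hΩΓ x hx s ⟨hs.1, hs.2.le⟩) _ hgm
  calc ∫⁻ x in Γ, ‖v x‖ₑ ^ 2 ∂μ = β⁻¹ * (β * ∫⁻ x in Γ, ‖v x‖ₑ ^ 2 ∂μ) := by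
        rw [← mul_assoc, ENNReal.inv_mul_cancel hβ0 hβt, one_mul]
    _ ≤ β⁻¹ * (2 * (C * ∫⁻ x in I, ‖v x‖ₑ ^ 2) + β * 2 * ENNReal.ofReal b * (C * E)) :=
        mul_le_mul_right hint _
    _ ≤ β⁻¹ * ((2 * C + β * 2 * ENNReal.ofReal b * C) * ((∫⁻ x in I, ‖v x‖ₑ ^ 2) + E)) := by
        refine mul_le_mul_right ?_ _
        rw [mul_add, add_mul, add_mul, ← mul_assoc, ← mul_assoc]
        exact add_le_add le_self_add le_add_self
    _ = _ := (mul_assoc _ _ _).symm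

/-- The boundary integral is controlled by the integral over a ball. -/
lemma IsLipschitzDomain.controls_surfaceMeasure (hΩ : IsLipschitzDomain Ω)
    {x₁ : Space d} (hx₁ : x₁ ∈ Ω) {r₁ : ℝ} (hr₁ : 0 < r₁) :
    Controls Ω (surfaceMeasure Ω) (volume.restrict (ball x₁ r₁)) := by
  have hfc : IsCompact (frontier Ω) :=
    isCompact_of_isClosed_isBounded isClosed_frontier
      (hΩ.isBounded.closure.subset frontier_subset_closure)
  refine Controls.of_isCompact hfc fun p hp => ?_
  obtain ⟨ν, r, K, h, hν, hr, hh, hgr⟩ := hΩ.lipschitz p hp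
  have hH := (lipschitzWith_graphHeight hν hh).continuous
  refine ⟨frontier Ω ∩ closedBall p (r / 4), inter_mem_nhdsWithin _
    (closedBall_mem_nhds p (by positivity)), ?_⟩
  -- A frontier point outside the open set `Ω` lies on or below the graph; strictly below, a
  -- neighbourhood would miss `Ω`.
  have hΓ : ∀ x ∈ frontier Ω ∩ closedBall p (r / 4), inner ℝ x ν = graphHeight ν h x := by
    rintro x ⟨hx, hxp⟩
    have hxr : x ∈ ball p r := closedBall_subset_ball (by linarith) hxp
    have hxΩ : x ∉ Ω := by
      rw [hΩ.isOpen.frontier_eq] at hx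
      exact hx.2
    have h1 : inner ℝ x ν ≤ graphHeight ν h x := by
      have := mt (hgr x hxr).2 hxΩ
      exact not_lt.1 this
    refine le_antisymm h1 (not_lt.1 fun hlt => ?_)
    have hopen : ∀ᶠ y in 𝓝 x, inner ℝ y ν < graphHeight ν h y ∧ y ∈ ball p r :=
      ((ContinuousAt.eventually_lt (by fun_prop) hH.continuousAt hlt)).and
        (isOpen_ball.mem_nhds hxr)
    obtain ⟨y, hy, hyΩ⟩ := mem_closure_iff_nhds.1 (frontier_subset_closure hx) _ hopen
    have := (hgr y hy.2).1 hyΩ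
    exact absurd hy.1 (not_lt.2 this.le)
  -- Points within `r/4` of `p`, pushed by at most `r/2`, stay within `3r/4 < r`, where the graph
  -- description is valid.
  obtain ⟨I, hI, hIΩ, hc⟩ := controls_graph hΩ.isOpen.measurableSet hν hh
    (hfc.inter_right isClosed_closedBall) hΓ (b := r / 2) (by positivity) (by
      rintro x hx s ⟨hs0, hsb⟩
      have hxp : dist x p ≤ r / 4 := hx.2
      have hmem : x + s • ν ∈ ball p r := by
        rw [mem_ball]
        have h1 : dist (x + s • ν) x ≤ r / 2 := by
          rw [dist_eq_norm, add_sub_cancel_left, norm_smul, hν, mul_one, Real.norm_of_nonneg hs0.le]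
          exact hsb
        linarith [dist_triangle (x + s • ν) x p]
      refine (hgr _ hmem).2 ?_
      have e := graphHeight_add hν h x s
      rw [graphHeight] at e
      rw [e, ← hΓ x hx, inner_add_left, inner_smul_left, real_inner_self_eq_norm_sq, hν]
      simpa using hs0)
  exact hc.trans (controls_of_isCompact_subset hΩ.isOpen hΩ.isConnected.isPreconnected hx₁ hr₁ hI hIΩ)

/-- The trace inequality applied to the constant function 1 bounds the surface measure by a multiple
of the volume of a ball. -/
lemma IsLipschitzDomain.isFiniteMeasure_surfaceMeasure (hΩ : IsLipschitzDomain Ω) :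
    IsFiniteMeasure (surfaceMeasure Ω) := by
  obtain ⟨x₁, hx₁⟩ := hΩ.isConnected.nonempty
  obtain ⟨C, hC⟩ := hΩ.controls_surfaceMeasure hx₁ one_pos
  have h := hC (fun _ => 1) contDiff_const
  have hg : ∀ x : Space d, ∇ (fun _ : Space d => (1 : ℝ)) x = 0 := fun x => by simp [gradient]
  simp only [hg, enorm_zero, enorm_one, one_pow, lintegral_one, ne_eq, OfNat.ofNat_ne_zero,
    not_false_eq_true, zero_pow, lintegral_zero, add_zero, Measure.restrict_apply_univ] at h
  exact ⟨h.trans_lt (ENNReal.mul_lt_top ENNReal.coe_lt_top measure_ball_lt_top)⟩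

/-- The Poincaré trace inequality, tested with data of mean zero. -/
theorem IsLipschitzDomain.exists_abs_integral_boundary_le (hΩ : IsLipschitzDomain Ω) : ∃ C : ℝ, 0 ≤ C ∧ ∀ g : Space d → ℝ, IsNeumannData Ω g →
      ∀ v : Space d → ℝ, ContDiff ℝ ∞ v →
        |∫ x, g x * v x ∂(surfaceMeasure Ω)|
          ≤ C * (lpNorm g 2 (surfaceMeasure Ω) * lpNorm (∇ v) 2 (volume.restrict Ω)) := by
  have hfin := hΩ.isFiniteMeasure_surfaceMeasure
  obtain ⟨x₁, hx₁⟩ := hΩ.isConnected.nonempty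
  obtain ⟨r₁, hr₁, hB⟩ := Metric.isOpen_iff.1 hΩ.isOpen x₁ hx₁
  obtain ⟨C, hC⟩ := hΩ.controls_surfaceMeasure hx₁ hr₁
  obtain ⟨C', hC'⟩ := exists_poincare_ball hΩ.isOpen.measurableSet hr₁ hB
  refine ⟨√(C * (C' + 1)), Real.sqrt_nonneg _, fun g hg v hv => ?_⟩
  obtain ⟨c, hc⟩ := hC' v hv
  have hvc : ContDiff ℝ ∞ fun x => v x - c := hv.sub contDiff_const
  have h1 := hC _ hvc
  simp only [gradient_sub_const] at h1
  set E := ∫⁻ x in Ω, ‖∇ v x‖ₑ ^ 2 with hE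
  have h2 : ∫⁻ x, ‖v x - c‖ₑ ^ 2 ∂(surfaceMeasure Ω) ≤ C * (C' + 1) * E := by
    refine h1.trans ?_
    rw [mul_assoc, add_mul, one_mul]
    exact mul_le_mul_right (add_le_add_left hc _) _
  have hgm : MemLp (∇ v) 2 (volume.restrict Ω) :=
    memLp_of_continuous_isBounded hΩ.isBounded (contDiff_gradient hv).continuous
  have hvm : MemLp (fun x => v x - c) 2 (surfaceMeasure Ω) := by
    refine MemLp.of_bound hvc.continuous.aestronglyMeasurable
      (C := (hΩ.isBounded.isCompact_closure.exists_bound_of_continuousOn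
        hvc.continuous.continuousOn).choose) ?_
    refine ae_restrict_of_forall_mem isClosed_frontier.measurableSet fun x hx => ?_
    exact (hΩ.isBounded.isCompact_closure.exists_bound_of_continuousOn
        hvc.continuous.continuousOn).choose_spec x (frontier_subset_closure hx)
  have hEe : E = eLpNorm (∇ v) 2 (volume.restrict Ω) ^ 2 := (eLpNorm_two_sq _).symm
  have h3 : lpNorm (fun x => v x - c) 2 (surfaceMeasure Ω)
      ≤ √(C * (C' + 1)) * lpNorm (∇ v) 2 (volume.restrict Ω) := by
    rw [← toReal_eLpNorm hvm.1, ← toReal_eLpNorm hgm.1]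
    refine Real.le_sqrt_of_sq_le ?_ |>.trans_eq (Real.sqrt_mul_self (by positivity))
    rw [← eLpNorm_two_sq, hEe] at h2
    have h4 := ENNReal.toReal_mono (by
      exact ENNReal.mul_ne_top (ENNReal.mul_ne_top ENNReal.coe_ne_top (by simp))
        (ENNReal.pow_ne_top hgm.2.ne)) h2
    rw [ENNReal.toReal_pow, ENNReal.toReal_mul, ENNReal.toReal_mul, ENNReal.toReal_pow,
      ENNReal.toReal_add (by simp) (by simp)] at h4
    simp only [ENNReal.coe_toReal, ENNReal.toReal_one] at h4
    refine h4.trans_eq ?_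
    rw [mul_mul_mul_comm, Real.mul_self_sqrt (by positivity), sq]
  have hgi : Integrable g (surfaceMeasure Ω) := hg.1.integrable (by norm_num)
  have hgv : Integrable (fun x => g x * (v x - c)) (surfaceMeasure Ω) := hg.1.integrable_mul hvm
  -- Mean-zero data do not see the constant `c`, so only the gradient of `v` survives in the bound.
  have e1 : ∫ x, g x * v x ∂(surfaceMeasure Ω)
      = ∫ x, 1 * inner ℝ (g x) (v x - c) ∂(surfaceMeasure Ω) := by
    have : ∫ x, g x * v x ∂(surfaceMeasure Ω) = ∫ x, (g x * (v x - c) + c * g x) ∂(surfaceMeasure Ω) :=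
      integral_congr_ae (Eventually.of_forall fun x => by simp only; ring)
    rw [this, integral_add hgv (hgi.const_mul c), integral_const_mul, hg.2, mul_zero, add_zero]
    refine integral_congr_ae (Eventually.of_forall fun x => ?_)
    simp [mul_comm]
  rw [e1]
  refine (abs_integral_mul_inner_le zero_le_one (by simp) hg.1 hvm).trans ?_
  rw [one_mul]
  calc _ ≤ lpNorm g 2 (surfaceMeasure Ω)
        * (√(C * (C' + 1)) * lpNorm (∇ v) 2 (volume.restrict Ω)) :=
        mul_le_mul_of_nonneg_left h3 lpNorm_nonneg
    _ = _ := by ring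

end Boundary

/-! ### Decay of the Fourier transform and regularity -/

section FourierDecay

open scoped FourierTransform

variable {d : ℕ}

lemma integral_fourier_smul_eq_flip {f g : Space d → ℂ} (hf : Integrable f) (hg : Integrable g) :
    ∫ ξ, 𝓕 f ξ • g ξ = ∫ x, f x • 𝓕 g x := by
  simpa using! VectorFourier.integral_fourierIntegral_smul_eq_flip (L := innerₗ (Space d))
    Real.continuous_fourierChar continuous_inner hf hg

/-- Fourier inversion almost everywhere. -/
lemma fourierInv_fourier_ae_eq {f : Space d → ℂ} (hf : Integrable f) (h'f : Integrable (𝓕 f)) :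
    f =ᵐ[volume] 𝓕⁻ (𝓕 f) := by
  have hneg : Integrable fun ξ => 𝓕 f (-ξ) := h'f.comp_neg
  have hcont : Continuous (𝓕⁻ (𝓕 f)) := by
    rw [Real.fourierInv_eq_fourier_comp_neg]
    exact VectorFourier.fourierIntegral_continuous Real.continuous_fourierChar
      (L := innerₗ (Space d)) continuous_inner hneg
  -- Both sides are integrated against a test function and the transforms are moved onto it; as a
  -- Schwartz function it satisfies the inversion formula.
  refine ae_eq_of_integral_contDiff_smul_eq hf.locallyIntegrable hcont.locallyIntegrable
    fun g hg hgc => ?_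
  have hgc' : HasCompactSupport fun x => (g x : ℂ) := hgc.comp_left (g := fun t : ℝ => (t : ℂ)) rfl
  have hg' : ContDiff ℝ ∞ fun x => (g x : ℂ) := Complex.ofRealCLM.contDiff.comp hg
  let s : SchwartzMap (Space d) ℂ := hgc'.toSchwartzMap hg'
  have hs (x : Space d) : s x = (g x : ℂ) := rfl
  have e0 (u : Space d → ℂ) : ∫ x, g x • u x = ∫ x, u x • s x :=
    integral_congr_ae (Eventually.of_forall fun x => by
      simp only [hs, Complex.real_smul, smul_eq_mul]; ring)
  rw [e0, e0]
  have e1 : ∫ x, f x • s x = ∫ ξ, 𝓕 f ξ • (𝓕⁻ s) ξ := by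
    rw [integral_fourier_smul_eq_flip hf (𝓕⁻ s).integrable, ← SchwartzMap.fourier_coe,
      FourierTransform.fourier_fourierInv_eq s]
  have e2 : ∫ x, 𝓕⁻ (𝓕 f) x • s x = ∫ ξ, 𝓕 f (-ξ) • (𝓕 s) ξ := by
    rw [Real.fourierInv_eq_fourier_comp_neg, integral_fourier_smul_eq_flip hneg s.integrable]
    rfl
  rw [e1, e2, ← integral_neg_eq_self]
  refine integral_congr_ae (Eventually.of_forall fun ξ => ?_)
  simp only
  rw [SchwartzMap.fourierInv_coe, SchwartzMap.fourier_coe, Real.fourierInv_eq_fourier_neg, neg_neg]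

/-- The inversion integral defines the representative. Of the decay exponent `d + 2`, an excess over
`d` of one is spent on integrability and another on the factor `|ξ|` produced by the difference of
two exponentials. -/
lemma exists_lipschitz_representative (d : ℕ) : ∃ c : ℝ, 0 ≤ c ∧ ∀ (f : Space d → ℝ) (A : ℝ),
    Integrable f → 0 ≤ A →
    (∀ ξ, ‖𝓕 (fun x => (f x : ℂ)) ξ‖ ≤ A * (1 + ‖ξ‖) ^ (-((d : ℝ) + 2))) →
    ∃ g : Space d → ℝ, f =ᵐ[volume] g ∧ (∀ x, |g x| ≤ c * A) ∧
      ∀ x y, |g x - g y| ≤ c * A * ‖x - y‖ := by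
  set J : Space d → ℝ := fun ξ => (1 + ‖ξ‖) ^ (-((d : ℝ) + 1)) with hJ
  have hJi : Integrable J := integrable_one_add_norm (by simp)
  have hJ0 (ξ : Space d) : 0 ≤ J ξ := by positivity
  have hc0 : 0 ≤ ∫ ξ, J ξ := integral_nonneg hJ0
  refine ⟨2 * Real.pi * ∫ ξ, J ξ, by positivity, fun f A hf hA hdec => ?_⟩
  set F := 𝓕 (fun x => (f x : ℂ)) with hF
  have hfc : Integrable fun x => (f x : ℂ) := hf.ofReal
  have hFc : Continuous F := VectorFourier.fourierIntegral_continuous Real.continuous_fourierChar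
      (L := innerₗ (Space d)) continuous_inner hfc
  have hpos (ξ : Space d) : 0 < 1 + ‖ξ‖ := by positivity
  have hb1 (ξ : Space d) : (1 + ‖ξ‖) * ‖F ξ‖ ≤ A * J ξ := by
    calc (1 + ‖ξ‖) * ‖F ξ‖ ≤ (1 + ‖ξ‖) * (A * (1 + ‖ξ‖) ^ (-((d : ℝ) + 2))) :=
          mul_le_mul_of_nonneg_left (hdec ξ) (hpos ξ).le
      _ = A * ((1 + ‖ξ‖) ^ (1 : ℝ) * (1 + ‖ξ‖) ^ (-((d : ℝ) + 2))) := by rw [Real.rpow_one]; ring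
      _ = _ := by
        rw [← Real.rpow_add (hpos ξ)]
        congr 2
        ring
  have hb0 (ξ : Space d) : ‖F ξ‖ ≤ A * J ξ :=
    (le_mul_of_one_le_left (norm_nonneg _) (by linarith [norm_nonneg ξ])).trans (hb1 ξ)
  have hbn (ξ : Space d) : ‖ξ‖ * ‖F ξ‖ ≤ A * J ξ :=
    (mul_le_mul_of_nonneg_right (by linarith) (norm_nonneg _)).trans (hb1 ξ)
  have hFi : Integrable F := (hJi.const_mul A).mono' hFc.aestronglyMeasurable
    (Eventually.of_forall hb0)
  have hinv := fourierInv_fourier_ae_eq hfc hFi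
  have hpi : (1 : ℝ) ≤ 2 * Real.pi := by linarith [Real.pi_gt_three]
  have hint (x : Space d) : Integrable fun v => Complex.exp (((2 * Real.pi * inner ℝ v x : ℝ) : ℂ) * Complex.I) • F v := by
    refine hFi.norm.mono' ?_ (Eventually.of_forall fun v => ?_)
    · have hce : Continuous fun v : Space d =>
          Complex.exp (((2 * Real.pi * inner ℝ v x : ℝ) : ℂ) * Complex.I) := by fun_prop
      exact (hce.smul hFc).aestronglyMeasurable
    · rw [norm_smul, Complex.norm_exp_ofReal_mul_I, one_mul]
  refine ⟨fun x => (𝓕⁻ F x).re, ?_, fun x => ?_, fun x y => ?_⟩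
  · filter_upwards [hinv] with x hx
    rw [← hx, Complex.ofReal_re]
  · refine (Complex.abs_re_le_norm _).trans ?_
    rw [Real.fourierInv_eq']
    refine (norm_integral_le_integral_norm _).trans ?_
    simp only [norm_smul, Complex.norm_exp_ofReal_mul_I, one_mul]
    calc ∫ v, ‖F v‖ ≤ ∫ v, A * J v := integral_mono hFi.norm (hJi.const_mul A) hb0
      _ = A * ∫ v, J v := integral_const_mul _ _
      _ ≤ 2 * Real.pi * (A * ∫ v, J v) := le_mul_of_one_le_left (by positivity) hpi
      _ = _ := by ring
  · rw [← Complex.sub_re]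
    refine (Complex.abs_re_le_norm _).trans ?_
    rw [Real.fourierInv_eq', Real.fourierInv_eq', ← integral_sub (hint x) (hint y)]
    have hle (v : Space d) : ‖Complex.exp (((2 * Real.pi * inner ℝ v x : ℝ) : ℂ) * Complex.I) • F v
        - Complex.exp (((2 * Real.pi * inner ℝ v y : ℝ) : ℂ) * Complex.I) • F v‖
        ≤ 2 * Real.pi * ‖x - y‖ * (A * J v) := by
      rw [← sub_smul, norm_smul]
      have h1 : ‖Complex.exp (((2 * Real.pi * inner ℝ v x : ℝ) : ℂ) * Complex.I)
          - Complex.exp (((2 * Real.pi * inner ℝ v y : ℝ) : ℂ) * Complex.I)‖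
          ≤ 2 * Real.pi * (‖v‖ * ‖x - y‖) := by
        have e : Complex.exp (((2 * Real.pi * inner ℝ v x : ℝ) : ℂ) * Complex.I)
            = Complex.exp (((2 * Real.pi * inner ℝ v y : ℝ) : ℂ) * Complex.I)
              * Complex.exp (Complex.I * ((2 * Real.pi * inner ℝ v (x - y) : ℝ) : ℂ)) := by
          rw [← Complex.exp_add]
          congr 1
          rw [inner_sub_right]
          push_cast
          ring
        rw [e, ← mul_sub_one, norm_mul, Complex.norm_exp_ofReal_mul_I, one_mul]
        refine Real.norm_exp_I_mul_ofReal_sub_one_le.trans ?_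
        rw [norm_mul, Real.norm_of_nonneg (by positivity)]
        exact mul_le_mul_of_nonneg_left (norm_inner_le_norm _ _) (by positivity)
      calc _ ≤ 2 * Real.pi * (‖v‖ * ‖x - y‖) * ‖F v‖ :=
            mul_le_mul_of_nonneg_right h1 (norm_nonneg _)
        _ = 2 * Real.pi * ‖x - y‖ * (‖v‖ * ‖F v‖) := by ring
        _ ≤ _ := mul_le_mul_of_nonneg_left (hbn v) (by positivity)
    calc _ ≤ ∫ v, 2 * Real.pi * ‖x - y‖ * (A * J v) :=
          norm_integral_le_of_norm_le ((hJi.const_mul A).const_mul _) (Eventually.of_forall hle)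
      _ = _ := by
        rw [integral_const_mul, integral_const_mul]
        ring

end FourierDecay

/-! ### Interior regularity of solution fields -/

section Regularity

variable {d : ℕ} {Ω : Set (Space d)} {D₀ : Space d → ℝ}

/-- Test functions on `Ω`. -/
structure IsTest (Ω : Set (Space d)) (θ : Space d → ℝ) : Prop where
  contDiff : ContDiff ℝ ∞ θ
  hasCompactSupport : HasCompactSupport θ
  tsupport_subset : tsupport θ ⊆ Ω

lemma IsTest.mul_contDiffOn {θ q : Space d → ℝ} (h : IsTest Ω θ) (hΩ : IsOpen Ω)
    (hq : ContDiffOn ℝ ∞ q Ω) : IsTest Ω fun x => θ x * q x := by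
  refine ⟨contDiff_iff_contDiffAt.2 fun x => ?_, h.hasCompactSupport.mul_right,
    (tsupport_mul_subset_left).trans h.tsupport_subset⟩
  by_cases hx : x ∈ tsupport θ
  · exact h.contDiff.contDiffAt.mul (hq.contDiffAt (hΩ.mem_nhds (h.tsupport_subset hx)))
  · have : (fun x => θ x * q x) =ᶠ[𝓝 x] fun _ => 0 := by
      filter_upwards [(isClosed_tsupport θ).isOpen_compl.mem_nhds hx] with y hy
      rw [image_eq_zero_of_notMem_tsupport hy, zero_mul]
    exact contDiffAt_const.congr_of_eventuallyEq this

lemma IsTest.mul {θ q : Space d → ℝ} (h : IsTest Ω θ) (hq : ContDiff ℝ ∞ q) :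
    IsTest Ω fun x => θ x * q x :=
  ⟨h.contDiff.mul hq, h.hasCompactSupport.mul_right,
    (tsupport_mul_subset_left).trans h.tsupport_subset⟩

lemma IsTest.fderiv {θ : Space d → ℝ} (h : IsTest Ω θ) (v : Space d) :
    IsTest Ω fun x => fderiv ℝ θ x v :=
  ⟨(h.contDiff.fderiv_right (m := ∞) (by simp)).clm_apply contDiff_const,
    h.hasCompactSupport.fderiv_apply (𝕜 := ℝ) v,
    (tsupport_fderiv_apply_subset ℝ v).trans h.tsupport_subset⟩

lemma IsTest.eq_zero {θ : Space d → ℝ} (h : IsTest Ω θ) {x : Space d} (hx : x ∉ Ω) : θ x = 0 :=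
  image_eq_zero_of_notMem_tsupport fun h' => hx (h.tsupport_subset h')

/-- A square integrable curl-free solution of `∇ · (D₀ F) = 0` in `Ω`. -/
structure IsSolutionField (Ω : Set (Space d)) (D₀ : Space d → ℝ) (F : Space d → Space d) : Prop where
  memLp : MemLp F 2 (volume.restrict Ω)
  curl : ∀ θ, IsTest Ω θ → ∀ i j, ∫ x in Ω, fderiv ℝ θ x (basisVec j) * F x i
    = ∫ x in Ω, fderiv ℝ θ x (basisVec i) * F x j
  div : ∀ η, IsTest Ω η → ∫ x in Ω, D₀ x * inner ℝ (F x) (∇ η x) = 0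

/-- Plane waves. -/
def wave (ξ : Space d) (α : ℝ) (x : Space d) : ℝ := Real.cos (2 * Real.pi * inner ℝ x ξ + α)

lemma contDiff_wave (ξ : Space d) (α : ℝ) : ContDiff ℝ ∞ (wave ξ α) :=
  Real.contDiff_cos.comp
    ((contDiff_const.mul (contDiff_id.inner ℝ contDiff_const)).add contDiff_const)

lemma abs_wave_le (ξ : Space d) (α : ℝ) (x : Space d) : |wave ξ α x| ≤ 1 := Real.abs_cos_le_one _

/-- Differentiation shifts the phase by a quarter period, so real waves with an arbitrary phase form
a family closed under differentiation, up to scalar factors. -/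
lemma fderiv_wave (ξ : Space d) (α : ℝ) (x v : Space d) :
    fderiv ℝ (wave ξ (α - Real.pi / 2)) x v = 2 * Real.pi * inner ℝ v ξ * wave ξ α x := by
  have h1 : HasFDerivAt (fun y : Space d => inner ℝ y ξ) (innerSL ℝ ξ) x := by
    have := (innerSL ℝ ξ).hasFDerivAt (x := x)
    refine this.congr_of_eventuallyEq (Eventually.of_forall fun y => ?_)
    rw [innerSL_apply_apply, real_inner_comm]
  have h2 := ((h1.const_mul (2 * Real.pi)).add_const (α - Real.pi / 2)).cos
  have e : fderiv ℝ (wave ξ (α - Real.pi / 2)) x = _ := h2.fderiv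
  rw [e, wave]
  have h3 : 2 * Real.pi * inner ℝ x ξ + (α - Real.pi / 2)
      = (2 * Real.pi * inner ℝ x ξ + α) - Real.pi / 2 := by ring
  rw [h3, Real.sin_sub_pi_div_two]
  simp only [neg_neg, smul_apply, innerSL_apply_apply, smul_eq_mul, real_inner_comm v ξ]
  ring

lemma IsTest.memLp_smul {m : Space d → ℝ} (hm : IsTest Ω m) (v : Space d) :
    MemLp (fun x => m x • v) 2 (volume.restrict Ω) :=
  ((hm.contDiff.continuous.smul continuous_const).memLp_of_hasCompactSupport
    hm.hasCompactSupport.smul_right).restrict Ω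

lemma coord_eq_inner (w : Space d) (k : Fin d) (t : ℝ) :
    t * w k = inner ℝ (t • (basisVec k : Space d)) w := by
  rw [inner_smul_left, EuclideanSpace.inner_single_left]
  simp

lemma IsTest.integrable_mul {m : Space d → ℝ} (hm : IsTest Ω m) {F : Space d → Space d}
    (hF : MemLp F 2 (volume.restrict Ω)) (k : Fin d) :
    Integrable (fun x => m x * F x k) (volume.restrict Ω) := by
  simp only [coord_eq_inner]
  simpa using integrable_mul_inner (D := fun _ => (1 : ℝ)) (K := 1) aestronglyMeasurable_const
    (by simp) (hm.memLp_smul (basisVec k)) hF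

/-- Testing `∇·(D₀ F) = 0` with `ψ / D₀` puts the equation in nondivergence form: the divergence of
`F` becomes a term of order zero with the smooth coefficient `p = ∇ log D₀`. -/
lemma IsSolutionField.sum_div (hΩ : IsOpen Ω) (hD : ContDiffOn ℝ ∞ D₀ Ω) (hD0 : ∀ x ∈ Ω, D₀ x ≠ 0)
    {F : Space d → Space d} (h : IsSolutionField Ω D₀ F) {ψ : Space d → ℝ} (hψ : IsTest Ω ψ)
    {p : Fin d → Space d → ℝ}
    (hp : p = fun k x => -(D₀ x) * fderiv ℝ (fun y => (D₀ y)⁻¹) x (basisVec k))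
    (hps : ∀ k, ContDiffOn ℝ ∞ (p k) Ω) :
    ∑ k, ∫ x in Ω, fderiv ℝ ψ x (basisVec k) * F x k = ∑ k, ∫ x in Ω, (ψ x * p k x) * F x k := by
  have hη : IsTest Ω fun x => ψ x * (D₀ x)⁻¹ := hψ.mul_contDiffOn hΩ (hD.inv hD0)
  have h1 := h.div _ hη
  rw [← integral_finsetSum _ fun k _ => (hψ.fderiv _).integrable_mul h.memLp k,
    ← integral_finsetSum _ fun k _ => (hψ.mul_contDiffOn hΩ (hps k)).integrable_mul h.memLp k,
    ← sub_eq_zero, ← integral_sub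
      (integrable_finsetSum _ fun k _ => (hψ.fderiv _).integrable_mul h.memLp k)
      (integrable_finsetSum _ fun k _ => (hψ.mul_contDiffOn hΩ (hps k)).integrable_mul h.memLp k),
    ← h1]
  refine setIntegral_congr_fun hΩ.measurableSet fun x hx => ?_
  have hDx : DifferentiableAt ℝ (fun y => (D₀ y)⁻¹) x :=
    ((hD.inv hD0).contDiffAt (hΩ.mem_nhds hx)).differentiableAt (by simp)
  have hψx := hψ.contDiff.differentiable (by simp) x
  simp only
  rw [inner_eq_sum, Finset.mul_sum, ← Finset.sum_sub_distrib]
  refine Finset.sum_congr rfl fun k _ => ?_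
  rw [gradient_apply, fderiv_fun_mul hψx hDx, add_apply, smul_apply, smul_apply, hp]
  have := hD0 x hx
  simp only [smul_eq_mul]
  field_simp
  ring

/-- The Fourier coefficients of a localized solution field gain one order of decay. -/
lemma IsSolutionField.norm_mul_abs_le (hΩ : IsOpen Ω) (hD : ContDiffOn ℝ ∞ D₀ Ω)
    (hD0 : ∀ x ∈ Ω, D₀ x ≠ 0) {F : Space d → Space d} (h : IsSolutionField Ω D₀ F)
    {χ : Space d → ℝ} (hχ : IsTest Ω χ) {p : Fin d → Space d → ℝ}
    (hp : p = fun k x => -(D₀ x) * fderiv ℝ (fun y => (D₀ y)⁻¹) x (basisVec k))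
    (hps : ∀ k, ContDiffOn ℝ ∞ (p k) Ω) (j : Fin d) (ξ : Space d) (α : ℝ) :
    ‖ξ‖ * |∫ x in Ω, (χ x * wave ξ α x) * F x j|
      ≤ ∑ i, (|∫ x in Ω, (fderiv ℝ χ x (basisVec j) * wave ξ (α - Real.pi / 2) x) * F x i|
        + |∫ x in Ω, (fderiv ℝ χ x (basisVec i) * wave ξ (α - Real.pi / 2) x) * F x j|
        + |∫ x in Ω, ((χ x * p i x) * wave ξ (α - Real.pi / 2) x) * F x i|
        + |∫ x in Ω, (fderiv ℝ χ x (basisVec i) * wave ξ (α - Real.pi / 2) x) * F x i|) := by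
  set w' := wave ξ (α - Real.pi / 2) with hw'
  set A : Fin d → ℝ := fun i => ∫ x in Ω, (χ x * wave ξ α x) * F x i with hA
  set B : Fin d → Fin d → ℝ := fun i k => ∫ x in Ω, (fderiv ℝ χ x (basisVec k) * w' x) * F x i with hB
  set P : Fin d → ℝ := fun i => ∫ x in Ω, ((χ x * p i x) * w' x) * F x i with hP
  have hψ : IsTest Ω fun x => χ x * w' x := hχ.mul (contDiff_wave _ _)
  have hder (x : Space d) (k : Fin d) : fderiv ℝ (fun x => χ x * w' x) x (basisVec k)
      = fderiv ℝ χ x (basisVec k) * w' x + 2 * Real.pi * ξ k * (χ x * wave ξ α x) := by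
    rw [fderiv_fun_mul (hχ.contDiff.differentiable (by simp) x)
      ((contDiff_wave _ _).differentiable (by simp) x), add_apply, smul_apply, smul_apply, hw',
      fderiv_wave, EuclideanSpace.inner_single_left]
    simp
    ring
  have hJ (i k : Fin d) : ∫ x in Ω, fderiv ℝ (fun x => χ x * w' x) x (basisVec k) * F x i
      = B i k + 2 * Real.pi * ξ k * A i := by
    simp only [hder, hA, hB]
    rw [← integral_const_mul, ← integral_add
      (((hχ.fderiv _).mul (contDiff_wave _ _)).integrable_mul h.memLp i)
      (((hχ.mul (contDiff_wave _ _)).integrable_mul h.memLp i).const_mul _)]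
    refine integral_congr_ae (Eventually.of_forall fun x => ?_)
    simp only
    ring
  -- `A i` is a Fourier coefficient of `χ F_i`. The terms `B` and `P`, in which a derivative falls
  -- on `χ` or on `D₀`, carry no factor `ξ`.
  have hcurl (i : Fin d) : B i j + 2 * Real.pi * ξ j * A i = B j i + 2 * Real.pi * ξ i * A j := by
    rw [← hJ, ← hJ]
    exact h.curl _ hψ i j
  have hdiv : ∑ i, (B i i + 2 * Real.pi * ξ i * A i) = ∑ i, P i := by
    have := h.sum_div hΩ hD hD0 hψ hp hps
    simp only [hJ] at this
    rw [this]
    refine Finset.sum_congr rfl fun i _ => integral_congr_ae (Eventually.of_forall fun x => ?_)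
    simp only
    ring
  have hS : ∑ k, ξ k * ξ k = ‖ξ‖ ^ 2 := by
    rw [EuclideanSpace.real_norm_sq_eq]
    exact Finset.sum_congr rfl fun k _ => (sq _).symm
  -- Curl relations replace `ξ_i A_j` by `ξ_j A_i` and the divergence relation removes `∑ ξ_i A_i`,
  -- so `|ξ|² A_j` is bounded by `|ξ|` times terms of order zero.
  have key : 2 * Real.pi * ‖ξ‖ ^ 2 * A j = ∑ i, (ξ i * (B i j - B j i) + ξ j * (P i - B i i)) := by
    rw [← hS, Finset.sum_add_distrib, ← Finset.mul_sum (a := ξ j), Finset.sum_sub_distrib, ← hdiv,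
      Finset.sum_add_distrib, add_sub_cancel_left, Finset.mul_sum, Finset.mul_sum, Finset.sum_mul,
      ← Finset.sum_add_distrib]
    refine Finset.sum_congr rfl fun i _ => ?_
    linear_combination (-ξ i) * hcurl i
  set S := ∑ i, (|B i j| + |B j i| + |P i| + |B i i|) with hSdef
  have hle : 2 * Real.pi * ‖ξ‖ ^ 2 * |A j| ≤ ‖ξ‖ * S := by
    have e : 2 * Real.pi * ‖ξ‖ ^ 2 * |A j| = |2 * Real.pi * ‖ξ‖ ^ 2 * A j| := by
      rw [abs_mul, abs_of_nonneg (a := 2 * Real.pi * ‖ξ‖ ^ 2) (by positivity)]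
    rw [e, key, hSdef, Finset.mul_sum]
    refine (Finset.abs_sum_le_sum_abs _ _).trans (Finset.sum_le_sum fun i _ => ?_)
    have h1 (k : Fin d) : |ξ k| ≤ ‖ξ‖ := PiLp.norm_apply_le ξ k
    refine (abs_add_le _ _).trans ?_
    rw [abs_mul, abs_mul]
    have h2 : |ξ i| * |B i j - B j i| ≤ ‖ξ‖ * (|B i j| + |B j i|) :=
      mul_le_mul (h1 i) (abs_sub _ _) (abs_nonneg _) (norm_nonneg _)
    have h3 : |ξ j| * |P i - B i i| ≤ ‖ξ‖ * (|P i| + |B i i|) :=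
      mul_le_mul (h1 j) (abs_sub _ _) (abs_nonneg _) (norm_nonneg _)
    linarith
  have hS0 : 0 ≤ S := Finset.sum_nonneg fun i _ => by positivity
  rcases eq_or_ne ξ 0 with rfl | hξ
  · simpa using hS0
  · have hξ0 : 0 < ‖ξ‖ := norm_pos_iff.2 hξ
    have h4 : 2 * Real.pi * ‖ξ‖ * |A j| ≤ S := by
      refine le_of_mul_le_mul_left ?_ hξ0
      linarith
    have hpi : (1 : ℝ) ≤ 2 * Real.pi := by linarith [Real.pi_gt_three]
    calc ‖ξ‖ * |A j| ≤ 2 * Real.pi * (‖ξ‖ * |A j|) := le_mul_of_one_le_left (by positivity) hpi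
      _ = 2 * Real.pi * ‖ξ‖ * |A j| := by ring
      _ ≤ S := h4

/-- Each induction step gains one power of `|ξ|` and replaces the cutoff by a derivative of it or by
a product with `p i`. Hence the cutoff and the phase are quantified inside the induction, and only
the `L²` norm of `F` appears in the bound. -/
lemma exists_fourier_decay (hΩ : IsOpen Ω) (hD : ContDiffOn ℝ ∞ D₀ Ω) (hD0 : ∀ x ∈ Ω, D₀ x ≠ 0)
    (n : ℕ) : ∀ χ : Space d → ℝ, IsTest Ω χ → ∀ j : Fin d, ∃ C : ℝ, 0 ≤ C ∧
      ∀ F, IsSolutionField Ω D₀ F → ∀ (ξ : Space d) (α : ℝ),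
        ‖ξ‖ ^ n * |∫ x in Ω, (χ x * wave ξ α x) * F x j| ≤ C * lpNorm F 2 (volume.restrict Ω) := by
  set p : Fin d → Space d → ℝ :=
    fun k x => -(D₀ x) * fderiv ℝ (fun y => (D₀ y)⁻¹) x (basisVec k) with hp
  have hps (k : Fin d) : ContDiffOn ℝ ∞ (p k) Ω :=
    hD.neg.mul (((hD.inv hD0).fderiv_of_isOpen hΩ (m := ∞) (by simp)).clm_apply contDiffOn_const)
  induction n with
  | zero =>
    intro χ hχ j
    refine ⟨lpNorm (fun x => χ x • (basisVec j : Space d)) 2 (volume.restrict Ω), lpNorm_nonneg,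
      fun F hF ξ α => ?_⟩
    have := abs_integral_mul_inner_le (D := wave ξ α) zero_le_one
      (Eventually.of_forall (abs_wave_le ξ α)) (hχ.memLp_smul (basisVec j)) hF.memLp
    rw [pow_zero, one_mul]
    rw [one_mul] at this
    refine le_trans (le_of_eq ?_) this
    congr 1
    refine integral_congr_ae (Eventually.of_forall fun x => ?_)
    simp only
    rw [← coord_eq_inner]
    ring
  | succ n ih =>
    intro χ hχ j
    choose! C hC0 hC using ih
    refine ⟨∑ i, (C (fun x => fderiv ℝ χ x (basisVec j)) i + C (fun x => fderiv ℝ χ x (basisVec i)) j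
      + C (fun x => χ x * p i x) i + C (fun x => fderiv ℝ χ x (basisVec i)) i), ?_, fun F hF ξ α => ?_⟩
    · refine Finset.sum_nonneg fun i _ => ?_
      have h1 := hC0 _ (hχ.fderiv (basisVec j)) i
      have h2 := hC0 _ (hχ.fderiv (basisVec i)) j
      have h3 := hC0 _ (hχ.mul_contDiffOn hΩ (hps i)) i
      have h4 := hC0 _ (hχ.fderiv (basisVec i)) i
      positivity
    · rw [pow_succ, mul_assoc]
      refine (mul_le_mul_of_nonneg_left (hF.norm_mul_abs_le hΩ hD hD0 hχ hp hps j ξ α)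
        (by positivity)).trans ?_
      rw [Finset.mul_sum, Finset.sum_mul]
      refine Finset.sum_le_sum fun i _ => ?_
      have h1 := hC _ (hχ.fderiv (basisVec j)) i F hF ξ (α - Real.pi / 2)
      have h2 := hC _ (hχ.fderiv (basisVec i)) j F hF ξ (α - Real.pi / 2)
      have h3 := hC _ (hχ.mul_contDiffOn hΩ (hps i)) i F hF ξ (α - Real.pi / 2)
      have h4 := hC _ (hχ.fderiv (basisVec i)) i F hF ξ (α - Real.pi / 2)
      rw [mul_add, mul_add, mul_add, add_mul, add_mul, add_mul]
      exact add_le_add (add_le_add (add_le_add h1 h2) h3) h4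

open scoped FourierTransform in
-- The real and imaginary parts of the transform are, up to sign, the integrals against the waves of
-- phases `0` and `-π/2`.
lemma norm_fourier_le {f : Space d → ℝ} (hf : Integrable f) (ξ : Space d) :
    ‖𝓕 (fun x => (f x : ℂ)) ξ‖
      ≤ |∫ x, f x * wave ξ 0 x| + |∫ x, f x * wave ξ (-(Real.pi / 2)) x| := by
  have hi (α : ℝ) : Integrable fun x => f x * wave ξ α x :=
    hf.mul_bdd (c := 1) (contDiff_wave ξ α).continuous.aestronglyMeasurable
      (Eventually.of_forall (abs_wave_le ξ α))
  have e : 𝓕 (fun x => (f x : ℂ)) ξ = ((∫ x, f x * wave ξ 0 x : ℝ) : ℂ)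
      + (-Complex.I) * ((∫ x, f x * wave ξ (-(Real.pi / 2)) x : ℝ) : ℂ) := by
    have c (α : ℝ) : ((∫ x, f x * wave ξ α x : ℝ) : ℂ) = ∫ x, ((f x * wave ξ α x : ℝ) : ℂ) :=
      integral_ofReal.symm
    rw [Real.fourier_eq', c, c, ← integral_const_mul,
      ← integral_add (hi _).ofReal ((hi _).ofReal.const_mul _)]
    refine integral_congr_ae (Eventually.of_forall fun x => ?_)
    simp only [wave, add_zero]
    have h1 : 2 * Real.pi * inner ℝ x ξ + -(Real.pi / 2)
      = 2 * Real.pi * inner ℝ x ξ - Real.pi / 2 := by ring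
    rw [h1, Real.cos_sub_pi_div_two, Complex.exp_mul_I, ← Complex.ofReal_cos, ← Complex.ofReal_sin]
    have h2 : -2 * Real.pi * inner ℝ x ξ = -(2 * Real.pi * inner ℝ x ξ) := by ring
    rw [h2, Real.cos_neg, Real.sin_neg, smul_eq_mul]
    push_cast
    ring
  rw [e]
  refine (norm_add_le _ _).trans ?_
  rw [norm_mul]
  simp

/-- Solution fields are Lipschitz continuous in the interior, with uniform bounds. -/
theorem exists_regularity (hΩ : IsOpen Ω) (hD : ContDiffOn ℝ ∞ D₀ Ω) (hD0 : ∀ x ∈ Ω, D₀ x ≠ 0)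
    {x₀ : Space d} (hx₀ : x₀ ∈ Ω) : ∃ ρ C : ℝ, 0 < ρ ∧ 0 ≤ C ∧ ball x₀ ρ ⊆ Ω ∧
      ∀ F, IsSolutionField Ω D₀ F → ∃ g : Space d → Space d,
        (∀ᵐ x, x ∈ ball x₀ ρ → F x = g x) ∧
        ‖g x₀‖ ≤ C * lpNorm F 2 (volume.restrict Ω) ∧
        ∀ x, ‖g x - g x₀‖ ≤ C * lpNorm F 2 (volume.restrict Ω) * ‖x - x₀‖ := by
  obtain ⟨r, hr, hrΩ⟩ := Metric.isOpen_iff.1 hΩ x₀ hx₀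
  let χ : ContDiffBump x₀ := ⟨r / 4, r / 2, by positivity, by linarith⟩
  have hχ : IsTest Ω χ := by
    refine ⟨χ.contDiff, χ.hasCompactSupport, ?_⟩
    rw [χ.tsupport_eq]
    exact (closedBall_subset_ball (by change r / 2 < r; linarith)).trans hrΩ
  obtain ⟨c, hc0, hc⟩ := exists_lipschitz_representative d
  -- The bound of order zero handles small frequencies and that of order `d + 2` large ones;
  -- together they control `(1 + |ξ|)^(d+2)`.
  have h0 := exists_fourier_decay hΩ hD hD0 0 χ hχ
  have hn := exists_fourier_decay hΩ hD hD0 (d + 2) χ hχ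
  choose C0 hC00 hC0 using h0
  choose Cn hCn0 hCn using hn
  set A : Fin d → ℝ := fun j => 2 ^ (d + 2) * (2 * (C0 j + Cn j)) with hA
  have hA0 (j : Fin d) : 0 ≤ A j := by
    have := hC00 j; have := hCn0 j; positivity
  refine ⟨r / 4, ∑ j, c * A j, by positivity, Finset.sum_nonneg fun j _ => mul_nonneg hc0 (hA0 j),
    (ball_subset_ball (by linarith)).trans hrΩ, fun F hF => ?_⟩
  set N := lpNorm F 2 (volume.restrict Ω) with hN
  have hN0 : 0 ≤ N := lpNorm_nonneg
  have hfi (j : Fin d) : Integrable fun x => χ x * F x j := by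
    have h1 := hχ.integrable_mul hF.memLp j
    refine (integrableOn_iff_integrable_of_support_subset fun x hx => ?_).1 h1
    by_contra hxΩ
    exact hx (by simp [hχ.eq_zero hxΩ])
  have hint (j : Fin d) (ξ : Space d) (α : ℝ) : ∫ x, (χ x * F x j) * wave ξ α x
      = ∫ x in Ω, (χ x * wave ξ α x) * F x j := by
    rw [← setIntegral_eq_integral_of_forall_compl_eq_zero (s := Ω)]
    · refine integral_congr_ae (Eventually.of_forall fun x => ?_)
      simp only
      ring
    · intro x hx
      rw [hχ.eq_zero hx]
      simp
  have hdec (j : Fin d) (ξ : Space d) : ‖FourierTransform.fourier (fun x => ((χ x * F x j : ℝ) : ℂ)) ξ‖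
      ≤ A j * N * (1 + ‖ξ‖) ^ (-((d : ℝ) + 2)) := by
    have hpos : 0 < 1 + ‖ξ‖ := by positivity
    set T := |∫ x in Ω, (χ x * wave ξ 0 x) * F x j|
      + |∫ x in Ω, (χ x * wave ξ (-(Real.pi / 2)) x) * F x j| with hT
    have hT0 : 0 ≤ T := by positivity
    have h1 := norm_fourier_le (hfi j) ξ
    rw [hint, hint] at h1
    have h2 : T ≤ 2 * C0 j * N := by
      have a1 := hC0 j F hF ξ 0
      have a2 := hC0 j F hF ξ (-(Real.pi / 2))
      rw [pow_zero, one_mul] at a1 a2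
      linarith
    have h3 : ‖ξ‖ ^ (d + 2) * T ≤ 2 * Cn j * N := by
      have a1 := hCn j F hF ξ 0
      have a2 := hCn j F hF ξ (-(Real.pi / 2))
      rw [hT, mul_add]
      linarith
    have h4 : (1 + ‖ξ‖) ^ (d + 2) ≤ 2 ^ (d + 2) * (1 + ‖ξ‖ ^ (d + 2)) := by
      refine (add_pow_le zero_le_one (norm_nonneg ξ) (d + 2)).trans ?_
      rw [one_pow]
      exact mul_le_mul_of_nonneg_right (pow_le_pow_right₀ one_le_two (by omega)) (by positivity)
    have h5 : (1 + ‖ξ‖) ^ (d + 2) * T ≤ A j * N := by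
      calc (1 + ‖ξ‖) ^ (d + 2) * T ≤ 2 ^ (d + 2) * (1 + ‖ξ‖ ^ (d + 2)) * T :=
            mul_le_mul_of_nonneg_right h4 hT0
        _ = 2 ^ (d + 2) * (T + ‖ξ‖ ^ (d + 2) * T) := by ring
        _ ≤ 2 ^ (d + 2) * (2 * C0 j * N + 2 * Cn j * N) :=
            mul_le_mul_of_nonneg_left (add_le_add h2 h3) (by positivity)
        _ = A j * N := by rw [hA]; ring
    refine h1.trans ?_
    rw [Real.rpow_neg hpos.le, ← div_eq_mul_inv, le_div_iff₀ (Real.rpow_pos_of_pos hpos _), mul_comm]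
    have e : (1 + ‖ξ‖) ^ ((d : ℝ) + 2) = (1 + ‖ξ‖) ^ (d + 2) := by
      rw [← Real.rpow_natCast]
      push_cast
      rfl
    rw [e]
    exact h5
  choose g hg1 hg2 hg3 using fun j => hc _ (A j * N) (hfi j) (mul_nonneg (hA0 j) hN0) (hdec j)
  have hle (v : Space d) : ‖v‖ ≤ ∑ j, |v j| := by
    conv_lhs => rw [← sum_smul_basisVec v]
    refine (norm_sum_le _ _).trans (Finset.sum_le_sum fun j _ => ?_)
    rw [norm_smul]
    simp
  refine ⟨fun x => WithLp.toLp 2 fun j => g j x, ?_, ?_, fun x => ?_⟩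
  · filter_upwards [ae_all_iff.2 hg1] with x hx hxb
    ext j
    have h1 : χ x = 1 := χ.one_of_mem_closedBall (ball_subset_closedBall hxb)
    have h2 := hx j
    rw [h1, one_mul] at h2
    exact h2
  · refine (hle _).trans ?_
    rw [Finset.sum_mul]
    refine Finset.sum_le_sum fun j _ => (hg2 j x₀).trans_eq ?_
    ring
  · refine (hle _).trans ?_
    rw [Finset.sum_mul, Finset.sum_mul]
    refine Finset.sum_le_sum fun j _ => (hg3 j x x₀).trans_eq ?_
    ring

end Regularity

/-! ### Limits of gradients and the auxiliary Neumann problem -/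

section GradientLimits

variable {d : ℕ} {Ω : Set (Space d)} {D D₀ : Space d → ℝ}

/-- `H` is the limit in `L²(Ω)` of gradients of smooth functions on `ℝ^d`. -/
def IsGradientLimit (Ω : Set (Space d)) (H : Space d → Space d) : Prop :=
  MemLp H 2 (volume.restrict Ω) ∧
    ∃ w : ℕ → Space d → ℝ, (∀ n, ContDiff ℝ ∞ (w n)) ∧
      Tendsto (fun n => eLpNorm (fun x => ∇ (w n) x - H x) 2 (volume.restrict Ω)) atTop (𝓝 0)

/-- A bounded measurable coefficient on `Ω`. -/
def IsBoundedCoeff (Ω : Set (Space d)) (D : Space d → ℝ) : Prop :=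
  AEStronglyMeasurable D (volume.restrict Ω) ∧ ∃ K : ℝ, 0 ≤ K ∧ ∀ᵐ x ∂(volume.restrict Ω), |D x| ≤ K

lemma memLp_gradient (hΩ : Bornology.IsBounded Ω) {w : Space d → ℝ} (hw : ContDiff ℝ ∞ w) :
    MemLp (∇ w) 2 (volume.restrict Ω) :=
  memLp_of_continuous_isBounded hΩ (contDiff_gradient hw).continuous

lemma lpNorm_congr_ae {α E : Type*} [MeasurableSpace α] {μ : Measure α} [NormedAddCommGroup E]
    {p : ℝ≥0∞} {f g : α → E} (hf : AEStronglyMeasurable f μ) (h : f =ᵐ[μ] g) :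
    lpNorm f p μ = lpNorm g p μ := by
  rw [← toReal_eLpNorm hf, ← toReal_eLpNorm (hf.congr h), eLpNorm_congr_ae h]

lemma eLpNorm_sub_le_add {α E : Type*} [MeasurableSpace α] {μ : Measure α} [NormedAddCommGroup E]
    {a b a' b' : α → E} (h : AEStronglyMeasurable (fun x => a x - a' x) μ)
    (h' : AEStronglyMeasurable (fun x => b x - b' x) μ) :
    eLpNorm (fun x => (a x - b x) - (a' x - b' x)) 2 μ
      ≤ eLpNorm (fun x => a x - a' x) 2 μ + eLpNorm (fun x => b x - b' x) 2 μ := by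
  have e : (fun x => (a x - b x) - (a' x - b' x))
      = (fun x => a x - a' x) - fun x => b x - b' x := by
    ext x
    simp only [Pi.sub_apply]
    abel
  rw [e]
  exact eLpNorm_sub_le h h' (by norm_num)

lemma tendsto_eLpNorm_sub_sub {α E : Type*} [MeasurableSpace α] {μ : Measure α}
    [NormedAddCommGroup E] {a b : ℕ → α → E} {a' b' : α → E}
    (ha : ∀ n, AEStronglyMeasurable (a n) μ) (hb : ∀ n, AEStronglyMeasurable (b n) μ)
    (ha' : AEStronglyMeasurable a' μ) (hb' : AEStronglyMeasurable b' μ)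
    (h : Tendsto (fun n => eLpNorm (fun x => a n x - a' x) 2 μ) atTop (𝓝 0))
    (h' : Tendsto (fun n => eLpNorm (fun x => b n x - b' x) 2 μ) atTop (𝓝 0)) :
    Tendsto (fun n => eLpNorm (fun x => (a n x - b n x) - (a' x - b' x)) 2 μ) atTop (𝓝 0) := by
  have h0 := h.add h'
  rw [add_zero] at h0
  exact tendsto_of_tendsto_of_tendsto_of_le_of_le tendsto_const_nhds h0 (fun _ => zero_le)
    fun n => eLpNorm_sub_le_add ((ha n).sub ha') ((hb n).sub hb')

lemma IsGradientLimit.sub (hΩ : Bornology.IsBounded Ω) {G H : Space d → Space d}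
    (hG : IsGradientLimit Ω G) (hH : IsGradientLimit Ω H) :
    IsGradientLimit Ω fun x => G x - H x := by
  obtain ⟨hG, v, hv, hvl⟩ := hG
  obtain ⟨hH, w, hw, hwl⟩ := hH
  refine ⟨hG.sub hH, fun n x => v n x - w n x, fun n => (hv n).sub (hw n), ?_⟩
  have e (n : ℕ) (x : Space d) : ∇ (fun x => v n x - w n x) x = ∇ (v n) x - ∇ (w n) x :=
    gradient_sub ((hv n).differentiable (by simp) x) ((hw n).differentiable (by simp) x)
  simp only [e]
  exact tendsto_eLpNorm_sub_sub (fun n => (memLp_gradient hΩ (hv n)).1)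
    (fun n => (memLp_gradient hΩ (hw n)).1) hG.1 hH.1 hvl hwl

/-- For a smooth `w` both sides equal minus the integral of `w` times a mixed second derivative of
`θ`, which is symmetric; the identity then passes to the `L²` limit. -/
lemma IsGradientLimit.curl (hΩ : Bornology.IsBounded Ω) {H : Space d → Space d}
    (hH : IsGradientLimit Ω H) {θ : Space d → ℝ} (hθ : IsTest Ω θ) (i j : Fin d) :
    ∫ x in Ω, fderiv ℝ θ x (basisVec j) * H x i = ∫ x in Ω, fderiv ℝ θ x (basisVec i) * H x j := by
  obtain ⟨hH, w, hw, hwl⟩ := hH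
  have hc (k : Fin d) : Continuous fun x => fderiv ℝ θ x (basisVec k) :=
    (hθ.fderiv (basisVec k)).contDiff.continuous
  have hm (k l : Fin d) : MemLp (fun x => fderiv ℝ θ x (basisVec k) • (basisVec l : Space d)) 2
      (volume.restrict Ω) :=
    memLp_of_continuous_isBounded hΩ ((hc k).smul continuous_const)
  have hlim (k l : Fin d) : Tendsto
      (fun n => ∫ x in Ω, fderiv ℝ θ x (basisVec k) * fderiv ℝ (w n) x (basisVec l)) atTop
      (𝓝 (∫ x in Ω, fderiv ℝ θ x (basisVec k) * H x l)) := by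
    have h := tendsto_integral_mul_inner_right (D := fun _ => 1) (K := 1)
      aestronglyMeasurable_const (Eventually.of_forall fun _ => by simp) hH
      (fun n => memLp_gradient hΩ (hw n)) (hm k l) hwl
    have e (x v : Space d) : inner ℝ (fderiv ℝ θ x (basisVec k) • (basisVec l : Space d)) v
        = fderiv ℝ θ x (basisVec k) * v l := by
      rw [real_inner_smul_left, EuclideanSpace.inner_single_left]
      simp
    simpa only [one_mul, e, gradient_apply] using h
  have hset (k l : Fin d) (v : Space d → ℝ) :
      ∫ x in Ω, fderiv ℝ θ x (basisVec k) * fderiv ℝ v x (basisVec l)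
        = ∫ x, fderiv ℝ θ x (basisVec k) * fderiv ℝ v x (basisVec l) :=
    setIntegral_eq_integral_of_forall_compl_eq_zero fun x hx => by
      rw [(hθ.fderiv (basisVec k)).eq_zero hx, zero_mul]
  refine tendsto_nhds_unique (hlim j i) ((hlim i j).congr fun n => ?_)
  rw [hset, hset]
  have hθ2 (k : Fin d) : ContDiff ℝ 1 fun x => fderiv ℝ θ x (basisVec k) :=
    (hθ.fderiv (basisVec k)).contDiff.of_le (by norm_cast)
  have hw1 : ContDiff ℝ 1 (w n) := (hw n).of_le (by norm_cast)
  rw [integral_mul_fderiv_eq (hθ2 i) hw1 (Or.inl (hθ.fderiv (basisVec i)).hasCompactSupport),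
    integral_mul_fderiv_eq (hθ2 j) hw1 (Or.inl (hθ.fderiv (basisVec j)).hasCompactSupport)]
  refine congrArg Neg.neg (integral_congr_ae (Eventually.of_forall fun x => ?_))
  have hs : IsSymmSndFDerivAt ℝ θ x := (hθ.contDiff.contDiffAt).isSymmSndFDerivAt (by simp; norm_cast)
  have e (k l : Fin d) : fderiv ℝ (fun x => fderiv ℝ θ x (basisVec k)) x (basisVec l)
      = fderiv ℝ (fderiv ℝ θ) x (basisVec l) (basisVec k) := by
    have hd : DifferentiableAt ℝ (fderiv ℝ θ) x :=
      (hθ.contDiff.fderiv_right (m := ∞) (by simp)).differentiable (by simp) x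
    rw [fderiv_clm_apply hd (differentiableAt_const _)]
    simp
  simp only [e]
  rw [hs.eq]

lemma integral_boundary_eq_zero (hΩ : IsOpen Ω) {η : Space d → ℝ} (h : ∀ x ∉ Ω, η x = 0)
    (g : Space d → ℝ) : ∫ x, g x * η x ∂(surfaceMeasure Ω) = 0 := by
  refine setIntegral_eq_zero_of_forall_eq_zero fun x hx => ?_
  rw [h x fun hx' => ?_, mul_zero]
  rw [hΩ.frontier_eq] at hx
  exact hx.2 hx'

lemma memLp_surfaceMeasure_of_continuous (hΩ : IsLipschitzDomain Ω) {v : Space d → ℝ}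
    (hv : Continuous v) : MemLp v 2 (surfaceMeasure Ω) := by
  have hfin := hΩ.isFiniteMeasure_surfaceMeasure
  have hfb : Bornology.IsBounded (frontier Ω) :=
    hΩ.isBounded.closure.subset frontier_subset_closure
  obtain ⟨C, hC⟩ := (hfb.isCompact_closure.image hv).isBounded.exists_norm_le
  refine MemLp.of_bound hv.aestronglyMeasurable C ?_
  refine (ae_restrict_iff' isClosed_frontier.measurableSet).2 (Eventually.of_forall fun x hx => ?_)
  exact hC _ ⟨x, subset_closure hx, rfl⟩

/-- `F` solves `∇ · D F = 0` in `Ω` with flux `g` across the boundary. -/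
def SolvesNeumann (Ω : Set (Space d)) (D g : Space d → ℝ) (F : Space d → Space d) : Prop :=
  ∀ v : Space d → ℝ, ContDiff ℝ ∞ v →
    ∫ x in Ω, D x * inner ℝ (F x) (∇ v x) = ∫ x, g x * v x ∂(surfaceMeasure Ω)

/-- Test functions supported in the open set `Ω` vanish on the boundary, so the flux does not enter.
-/
lemma SolvesNeumann.isSolutionField (hΩ : IsLipschitzDomain Ω) {g : Space d → ℝ}
    {F : Space d → Space d} (h : SolvesNeumann Ω D₀ g F) (hF : IsGradientLimit Ω F) :
    IsSolutionField Ω D₀ F :=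
  ⟨hF.1, fun _ hθ i j => hF.curl hΩ.isBounded hθ i j, fun η hη => by
    rw [h η hη.contDiff, integral_boundary_eq_zero hΩ.isOpen fun x hx => hη.eq_zero hx]⟩

lemma IsGradientLimit.tendsto_integral (hΩ : Bornology.IsBounded Ω) (hD : IsBoundedCoeff Ω D)
    {F H : Space d → Space d} (hF : MemLp F 2 (volume.restrict Ω)) {w : ℕ → Space d → ℝ}
    (hw : ∀ n, ContDiff ℝ ∞ (w n)) (hH : MemLp H 2 (volume.restrict Ω))
    (h : Tendsto (fun n => eLpNorm (fun x => ∇ (w n) x - H x) 2 (volume.restrict Ω)) atTop (𝓝 0)) :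
    Tendsto (fun n => ∫ x in Ω, D x * inner ℝ (F x) (∇ (w n) x)) atTop
      (𝓝 (∫ x in Ω, D x * inner ℝ (F x) (H x))) := by
  obtain ⟨hDm, K, -, hK⟩ := hD
  exact tendsto_integral_mul_inner_right hDm hK hH (fun n => memLp_gradient hΩ (hw n)) hF h

/-- Two fields with the same flux have the same action on limits of gradients. -/
lemma SolvesNeumann.integral_eq (hΩ : Bornology.IsBounded Ω) (hD : IsBoundedCoeff Ω D)
    (hD₀ : IsBoundedCoeff Ω D₀) {g : Space d → ℝ} {F F₀ H : Space d → Space d}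
    (hF : MemLp F 2 (volume.restrict Ω)) (hF₀ : MemLp F₀ 2 (volume.restrict Ω))
    (h : SolvesNeumann Ω D g F) (h₀ : SolvesNeumann Ω D₀ g F₀) (hH : IsGradientLimit Ω H) :
    ∫ x in Ω, D x * inner ℝ (F x) (H x) = ∫ x in Ω, D₀ x * inner ℝ (F₀ x) (H x) := by
  obtain ⟨hH, w, hw, hwl⟩ := hH
  refine tendsto_nhds_unique (IsGradientLimit.tendsto_integral hΩ hD hF hw hH hwl)
    ((IsGradientLimit.tendsto_integral hΩ hD₀ hF₀ hw hH hwl).congr fun n => ?_)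
  rw [h _ (hw n), h₀ _ (hw n)]

lemma tendsto_lpNorm {α E : Type*} [MeasurableSpace α] {μ : Measure α} [NormedAddCommGroup E]
    {F : ℕ → α → E} {F₀ : α → E} (hF₀ : MemLp F₀ 2 μ) (hF : ∀ n, MemLp (F n) 2 μ)
    (h : Tendsto (fun n => eLpNorm (fun x => F n x - F₀ x) 2 μ) atTop (𝓝 0)) :
    Tendsto (fun n => lpNorm (F n) 2 μ) atTop (𝓝 (lpNorm F₀ 2 μ)) := by
  have h1 : Tendsto (fun n => (hF n).toLp (F n)) atTop (𝓝 (hF₀.toLp F₀)) :=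
    (Lp.tendsto_Lp_iff_tendsto_eLpNorm'' _ hF _ hF₀).2 h
  have h2 := h1.norm
  simp only [Lp.norm_toLp] at h2
  rw [toReal_eLpNorm hF₀.1] at h2
  refine h2.congr fun n => toReal_eLpNorm (hF n).1

/-- The energy estimate for the Neumann problem. -/
lemma SolvesNeumann.mul_lpNorm_le (hΩ : IsLipschitzDomain Ω) (hD : IsBoundedCoeff Ω D) {c C : ℝ}
    (hc : ∀ᵐ x ∂(volume.restrict Ω), c ≤ D x) {g : Space d → ℝ}
    (hC : ∀ v : Space d → ℝ, ContDiff ℝ ∞ v → |∫ x, g x * v x ∂(surfaceMeasure Ω)|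
      ≤ C * (lpNorm g 2 (surfaceMeasure Ω) * lpNorm (∇ v) 2 (volume.restrict Ω)))
    (hC0 : 0 ≤ C)
    {F : Space d → Space d} (h : SolvesNeumann Ω D g F) (hF : IsGradientLimit Ω F) :
    c * lpNorm F 2 (volume.restrict Ω) ≤ C * lpNorm g 2 (surfaceMeasure Ω) := by
  have hF' := hF
  obtain ⟨hF, w, hw, hwl⟩ := hF
  have h1 := IsGradientLimit.tendsto_integral hΩ.isBounded hD hF hw hF hwl
  have h2 := tendsto_lpNorm hF (fun n => memLp_gradient hΩ.isBounded (hw n)) hwl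
  have h3 : ∫ x in Ω, D x * inner ℝ (F x) (F x)
      ≤ C * (lpNorm g 2 (surfaceMeasure Ω) * lpNorm F 2 (volume.restrict Ω)) := by
    refine le_of_tendsto_of_tendsto' h1 ((h2.const_mul _).const_mul C) fun n => ?_
    rw [h _ (hw n)]
    exact (le_abs_self _).trans (hC _ (hw n))
  obtain ⟨hDm, K, -, hK⟩ := hD
  have h4 := mul_lpNorm_sq_le_integral hDm hK hc hF
  rcases (lpNorm_nonneg : 0 ≤ lpNorm F 2 (volume.restrict Ω)).eq_or_lt with h0 | h0
  · rw [← h0, mul_zero]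
    exact mul_nonneg hC0 lpNorm_nonneg
  · refine le_of_mul_le_mul_right ?_ h0
    nlinarith [h3, h4]

/-- Solvability of the Neumann problem, in terms of the gradient of the solution. -/
theorem exists_solvesNeumann (hΩ : IsLipschitzDomain Ω) (hD : IsBoundedCoeff Ω D) {c : ℝ}
    (hc0 : 0 < c) (hc : ∀ᵐ x ∂(volume.restrict Ω), c ≤ D x) {g : Space d → ℝ}
    (hg : IsNeumannData Ω g) : ∃ F, IsGradientLimit Ω F ∧ SolvesNeumann Ω D g F := by
  have hb := hΩ.isBounded
  have hfin := hΩ.isFiniteMeasure_surfaceMeasure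
  obtain ⟨C, hC0, hC⟩ := hΩ.exists_abs_integral_boundary_le
  specialize hC g hg
  obtain ⟨hDm, K, hK0, hK⟩ := hD
  set μ := volume.restrict Ω with hμ
  have hgi (v : Space d → ℝ) (hv : ContDiff ℝ ∞ v) :
      Integrable (fun x => g x * v x) (surfaceMeasure Ω) :=
    hg.1.integrable_mul (memLp_surfaceMeasure_of_continuous hΩ hv.continuous)
  -- Working with gradients removes the undetermined additive constant: the Hilbert space is the
  -- `L²` closure of the smooth gradients.
  let S : Submodule ℝ (Lp (Space d) 2 μ) :=
    { carrier := {f | ∃ v : Space d → ℝ, ContDiff ℝ ∞ v ∧ f =ᵐ[μ] ∇ v}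
      add_mem' := by
        rintro f f' ⟨v, hv, hf⟩ ⟨v', hv', hf'⟩
        refine ⟨fun x => v x + v' x, hv.add hv', ?_⟩
        filter_upwards [Lp.coeFn_add f f', hf, hf'] with x h1 h2 h3
        rw [h1, Pi.add_apply, h2, h3,
          gradient_add (hv.differentiable (by simp) x) (hv'.differentiable (by simp) x)]
      zero_mem' := by
        refine ⟨fun _ => 0, contDiff_const, ?_⟩
        filter_upwards [Lp.coeFn_zero (Space d) 2 μ] with x h1
        rw [h1]
        simp [gradient]
      smul_mem' := by
        rintro a f ⟨v, hv, hf⟩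
        refine ⟨fun x => a * v x, contDiff_const.mul hv, ?_⟩
        filter_upwards [Lp.coeFn_smul a f, hf] with x h1 h2
        rw [h1, Pi.smul_apply, h2, gradient, gradient,
          fderiv_const_mul (hv.differentiable (by simp) x), map_smul] }
  choose V hV hSV using fun f : S => f.2
  have hlp (f : S) : lpNorm (∇ (V f)) 2 μ = ‖f‖ := by
    rw [← lpNorm_congr_ae (Lp.aestronglyMeasurable _) (hSV f), ← toReal_eLpNorm (Lp.aestronglyMeasurable _)]
    rfl
  -- the functional only depends on the gradient
  have hdep (v w : Space d → ℝ) (hv : ContDiff ℝ ∞ v) (hw : ContDiff ℝ ∞ w) (h : ∇ v =ᵐ[μ] ∇ w) :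
      ∫ x, g x * v x ∂(surfaceMeasure Ω) = ∫ x, g x * w x ∂(surfaceMeasure Ω) := by
    have h1 := hC (fun x => v x - w x) (hv.sub hw)
    have h2 : ∇ (fun x => v x - w x) =ᵐ[μ] 0 := by
      filter_upwards [h] with x hx
      rw [gradient_sub (hv.differentiable (by simp) x) (hw.differentiable (by simp) x), hx, sub_self]
      rfl
    rw [lpNorm_congr_ae (memLp_gradient hb (hv.sub hw)).1 h2, lpNorm_zero, mul_zero, mul_zero] at h1
    have h3 := abs_eq_zero.1 (le_antisymm h1 (abs_nonneg _))
    simp only [mul_sub] at h3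
    rw [integral_sub (hgi v hv) (hgi w hw)] at h3
    linarith
  let ℓ₀ : S →ₗ[ℝ] ℝ :=
    { toFun := fun f => ∫ x, g x * V f x ∂(surfaceMeasure Ω)
      map_add' := fun f f' => by
        rw [← integral_add (hgi _ (hV f)) (hgi _ (hV f'))]
        simp only [← mul_add]
        refine hdep _ _ (hV _) ((hV f).add (hV f')) ?_
        filter_upwards [hSV (f + f'), hSV f, hSV f',
          Lp.coeFn_add (f : Lp (Space d) 2 μ) (f' : Lp (Space d) 2 μ)] with x h1 h2 h3 h4
        rw [gradient_add ((hV f).differentiable (by simp) x) ((hV f').differentiable (by simp) x),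
          ← h1, ← h2, ← h3]
        exact h4
      map_smul' := fun a f => by
        rw [RingHom.id_apply, smul_eq_mul, ← integral_const_mul]
        simp only [mul_left_comm a]
        refine hdep _ (fun x => a * V f x) (hV _) (contDiff_const.mul (hV f)) ?_
        filter_upwards [hSV (a • f), hSV f, Lp.coeFn_smul a (f : Lp (Space d) 2 μ)] with x h1 h2 h3
        have e : ∇ (fun x => a * V f x) x = a • ∇ (V f) x := by
          rw [gradient, gradient, fderiv_const_mul ((hV f).differentiable (by simp) x), map_smul]
        rw [e, ← h1, ← h2]
        exact h3 }
  let ℓ₁ : S →L[ℝ] ℝ := ℓ₀.mkContinuous (C * lpNorm g 2 (surfaceMeasure Ω)) fun f => by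
    have := hC (V f) (hV f)
    rw [hlp] at this
    rw [mul_assoc]
    exact this
  -- Hahn–Banach gives a bounded functional on all of `L²`; Lax–Milgram uses only its restriction to
  -- the closure of `S`.
  obtain ⟨ℓ, hℓ, -⟩ := exists_extension_norm_eq S ℓ₁
  let X := S.topologicalClosure
  have hXc : CompleteSpace X := S.isClosed_topologicalClosure.completeSpace_coe
  have hint (f f' : X) : Integrable (fun x => D x * inner ℝ ((f : Lp (Space d) 2 μ) x)
      ((f' : Lp (Space d) 2 μ) x)) μ := integrable_mul_inner hDm hK (Lp.memLp _) (Lp.memLp _)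
  have hnorm (f : Lp (Space d) 2 μ) : lpNorm f 2 μ = ‖f‖ := by
    rw [← toReal_eLpNorm (Lp.aestronglyMeasurable _)]
    rfl
  let B₀ : X →ₗ[ℝ] X →ₗ[ℝ] ℝ := LinearMap.mk₂ ℝ
    (fun f f' => ∫ x, D x * inner ℝ ((f : Lp (Space d) 2 μ) x) ((f' : Lp (Space d) 2 μ) x) ∂μ)
    (fun f₁ f₂ f => by
      rw [← integral_add (hint _ _) (hint _ _)]
      refine integral_congr_ae ?_
      filter_upwards [Lp.coeFn_add (f₁ : Lp (Space d) 2 μ) (f₂ : Lp (Space d) 2 μ)] with x hx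
      rw [Submodule.coe_add, hx, Pi.add_apply, inner_add_left, mul_add])
    (fun a f₁ f => by
      rw [smul_eq_mul, ← integral_const_mul]
      refine integral_congr_ae ?_
      filter_upwards [Lp.coeFn_smul a (f₁ : Lp (Space d) 2 μ)] with x hx
      rw [Submodule.coe_smul, hx, Pi.smul_apply, real_inner_smul_left]
      ring)
    (fun f f₁ f₂ => by
      rw [← integral_add (hint _ _) (hint _ _)]
      refine integral_congr_ae ?_
      filter_upwards [Lp.coeFn_add (f₁ : Lp (Space d) 2 μ) (f₂ : Lp (Space d) 2 μ)] with x hx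
      rw [Submodule.coe_add, hx, Pi.add_apply, inner_add_right, mul_add])
    (fun a f f₁ => by
      rw [smul_eq_mul, ← integral_const_mul]
      refine integral_congr_ae ?_
      filter_upwards [Lp.coeFn_smul a (f₁ : Lp (Space d) 2 μ)] with x hx
      rw [Submodule.coe_smul, hx, Pi.smul_apply, real_inner_smul_right]
      ring)
  let B : X →L[ℝ] X →L[ℝ] ℝ := B₀.mkContinuous₂ K fun f f' => by
    have := abs_integral_mul_inner_le hK0 hK (Lp.memLp (f : Lp (Space d) 2 μ))
      (Lp.memLp (f' : Lp (Space d) 2 μ))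
    rw [hnorm, hnorm, ← mul_assoc] at this
    exact this
  have hBc : IsCoercive B := by
    refine ⟨c, hc0, fun f => ?_⟩
    have := mul_lpNorm_sq_le_integral hDm hK hc (Lp.memLp (f : Lp (Space d) 2 μ))
    rw [hnorm, pow_two, ← mul_assoc] at this
    exact this
  let q : X := (InnerProductSpace.toDual ℝ X).symm (ℓ.comp X.subtypeL)
  let F : X := hBc.continuousLinearEquivOfBilin.symm q
  have hF (f : X) : ∫ x, D x * inner ℝ ((F : Lp (Space d) 2 μ) x) ((f : Lp (Space d) 2 μ) x) ∂μ
      = ℓ f := by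
    have h1 : B F f = inner ℝ q f := by
      rw [← hBc.continuousLinearEquivOfBilin_apply, ContinuousLinearEquiv.apply_symm_apply]
    rw [InnerProductSpace.toDual_symm_apply] at h1
    exact h1
  refine ⟨(F : Lp (Space d) 2 μ), ⟨Lp.memLp _, ?_⟩, fun v hv => ?_⟩
  · have hFc : (F : Lp (Space d) 2 μ) ∈ closure (S : Set (Lp (Space d) 2 μ)) := F.2
    obtain ⟨f, hf, hfl⟩ := mem_closure_iff_seq_limit.1 hFc
    choose w hw hfw using hf
    refine ⟨w, hw, ?_⟩
    have h1 := (Lp.tendsto_Lp_iff_tendsto_eLpNorm' _ _).1 hfl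
    refine h1.congr fun n => eLpNorm_congr_ae ?_
    filter_upwards [hfw n] with x hx
    rw [Pi.sub_apply, hx]
  · have hvm := memLp_gradient hb hv
    have hvS : hvm.toLp (∇ v) ∈ S := ⟨v, hv, hvm.coeFn_toLp⟩
    have h1 := hF ⟨hvm.toLp (∇ v), S.le_topologicalClosure hvS⟩
    have h2 := hℓ ⟨hvm.toLp (∇ v), hvS⟩
    have h3 : ℓ₁ ⟨hvm.toLp (∇ v), hvS⟩ = ∫ x, g x * v x ∂(surfaceMeasure Ω) := by
      refine hdep _ _ (hV _) hv ?_
      filter_upwards [hSV ⟨hvm.toLp (∇ v), hvS⟩, hvm.coeFn_toLp] with x h1 h2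
      rw [← h1, ← h2]
    rw [← h3, ← h2]
    refine Eq.trans (integral_congr_ae ?_) h1
    filter_upwards [hvm.coeFn_toLp] with x hx
    rw [hx]

end GradientLimits

/-! ### Rescaled correctors -/

section Rescaling

variable {d : ℕ} {x₀ : Space d} {ε : ℝ}

lemma measurable_rescale (x₀ : Space d) (ε : ℝ) :
    Measurable fun x : Space d => ε⁻¹ • (x - x₀) := by fun_prop

lemma map_rescale (x₀ : Space d) (hε : 0 < ε) :
    Measure.map (fun x : Space d => ε⁻¹ • (x - x₀)) volume
      = ENNReal.ofReal (ε ^ d) • (volume : Measure (Space d)) := by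
  have h1 : (fun x : Space d => ε⁻¹ • (x - x₀)) = (fun x => ε⁻¹ • x) ∘ fun x => x - x₀ := rfl
  rw [h1, ← Measure.map_map (by fun_prop) (by fun_prop), map_sub_right_eq_self,
    Measure.map_addHaar_smul _ (inv_ne_zero hε.ne'), finrank_euclideanSpace_fin, inv_pow, inv_inv,
    abs_of_pos (by positivity)]

lemma quasiMeasurePreserving_rescale (x₀ : Space d) (hε : 0 < ε) :
    Measure.QuasiMeasurePreserving (fun x : Space d => ε⁻¹ • (x - x₀)) := by
  refine ⟨measurable_rescale x₀ ε, ?_⟩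
  rw [map_rescale x₀ hε]
  exact Measure.smul_absolutelyContinuous

lemma integral_rescale (x₀ : Space d) (hε : 0 < ε) (f : Space d → ℝ) :
    ∫ x, f (ε⁻¹ • (x - x₀)) = ε ^ d * ∫ x, f x := by
  rw [integral_sub_right_eq_self (fun x => f (ε⁻¹ • x)) x₀,
    Measure.integral_comp_inv_smul_of_nonneg _ _ hε.le, finrank_euclideanSpace_fin, smul_eq_mul]

variable {E : Type*} [NormedAddCommGroup E]

lemma eLpNorm_rescale (x₀ : Space d) (hε : 0 < ε) {f : Space d → E}
    (hf : AEStronglyMeasurable f volume) :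
    eLpNorm (fun x => f (ε⁻¹ • (x - x₀))) 2 volume
      = ENNReal.ofReal (√(ε ^ d)) * eLpNorm f 2 volume := by
  have h1 := eLpNorm_map_measure (μ := volume) (p := 2) (g := f)
    (f := fun x : Space d => ε⁻¹ • (x - x₀))
    (by rw [map_rescale x₀ hε]; exact hf.smul_measure _) (measurable_rescale x₀ ε).aemeasurable
  rw [map_rescale x₀ hε, eLpNorm_smul_measure_of_ne_top (by norm_num)] at h1
  have h2 : (fun x => f (ε⁻¹ • (x - x₀))) = f ∘ fun x : Space d => ε⁻¹ • (x - x₀) := rfl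
  rw [h2, ← h1, smul_eq_mul, ENNReal.ofReal_rpow_of_nonneg (by positivity) (by positivity),
    Real.sqrt_eq_rpow]
  norm_num

lemma memLp_rescale (x₀ : Space d) (hε : 0 < ε) {f : Space d → E} (hf : MemLp f 2 volume) :
    MemLp (fun x => f (ε⁻¹ • (x - x₀))) 2 volume := by
  refine ⟨hf.1.comp_quasiMeasurePreserving (quasiMeasurePreserving_rescale x₀ hε), ?_⟩
  rw [eLpNorm_rescale x₀ hε hf.1]
  exact ENNReal.mul_lt_top ENNReal.ofReal_lt_top hf.2

lemma lpNorm_restrict_rescale_le (x₀ : Space d) (hε : 0 < ε) {f : Space d → E}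
    (hf : MemLp f 2 volume) (S : Set (Space d)) :
    lpNorm (fun x => f (ε⁻¹ • (x - x₀))) 2 (volume.restrict S) ≤ √(ε ^ d) * lpNorm f 2 volume := by
  have h := memLp_rescale x₀ hε hf
  rw [← toReal_eLpNorm (h.restrict S).1, ← toReal_eLpNorm hf.1,
    ← ENNReal.toReal_ofReal (Real.sqrt_nonneg (ε ^ d)), ← ENNReal.toReal_mul,
    ← eLpNorm_rescale x₀ hε hf.1]
  exact ENNReal.toReal_mono h.2.ne (eLpNorm_mono_measure _ Measure.restrict_le_self)

end Rescaling

/-! ### Compactly supported correctors and their rescaled equations in the domain. -/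

section Correctors

variable {d : ℕ} {γ R ε : ℝ} {D₁ : Space d → ℝ} {b x₀ : Space d} {Ω : Set (Space d)}

/-- `F` is the gradient of a corrector that vanishes outside the inclusion, for a background
gradient `b`. -/
structure IsCompactCorrector (γ R : ℝ) (D₁ : Space d → ℝ) (b : Space d)
    (F : Space d → Space d) : Prop where
  memLp : MemLp F 2 volume
  eq_zero : ∀ x ∉ closedBall (0 : Space d) R, F x = 0
  weak : ∃ φ : Space d → ℝ, HasWeakGradient Set.univ φ F ∧ ∀ x ∉ closedBall (0 : Space d) R, φ x = 0
  equation : ∀ v : Space d → ℝ, ContDiff ℝ ∞ v → HasCompactSupport v →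
    ∫ x, (γ + D₁ x) * inner ℝ (F x) (∇ v x) = - ∫ x, D₁ x * inner ℝ b (∇ v x)

/-- The correctors of the coordinate directions are combined linearly. The bound is uniform over
directions, as needed because `b = F(x₀)` varies with the data. -/
theorem exists_compactCorrector (hd : 2 ≤ d) (hγ : 0 < γ) (hR : 0 < R)
    (hD : IsPerturbation γ (ball 0 R) D₁) (hs : IsSphericallySymmetric D₁)
    (hM : LeadingTensorVanishes γ (ball 0 R) D₁) :
    ∃ C : ℝ, 0 ≤ C ∧ ∀ b : Space d, ∃ F, IsCompactCorrector γ R D₁ b F ∧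
      lpNorm F 2 volume ≤ C * ‖b‖ := by
  obtain ⟨φ, G, h⟩ := exists_compact_correctors hd hγ hR hD hs hM
  obtain ⟨K, hK0, hK⟩ := hD.exists_bound
  have hm := hD.memLp.1
  refine ⟨∑ j, lpNorm (G j) 2 volume, Finset.sum_nonneg fun j _ => lpNorm_nonneg, fun b =>
    ⟨fun x => ∑ j, b j • G j x, ⟨?_, ?_, ⟨fun x => ∑ j, b j * φ j x, ?_, ?_⟩, ?_⟩, ?_⟩⟩
  · exact memLp_finsetSum _ fun j _ => (h j).2.1.const_smul (b j)
  · exact fun x hx => Finset.sum_eq_zero fun j _ => by rw [(h j).2.2.2.1 x hx, smul_zero]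
  · have key : ∀ s : Finset (Fin d), s.Nonempty → HasWeakGradient Set.univ
        (fun x => ∑ j ∈ s, b j * φ j x) (fun x => ∑ j ∈ s, b j • G j x) := by
      intro s hs
      induction hs using Finset.Nonempty.cons_induction with
      | singleton a => simpa using (h a).1.const_mul (b a)
      | cons a s ha hs ih =>
        simp only [Finset.sum_cons]
        exact ((h a).1.const_mul (b a)).add ih
    exact key Finset.univ ⟨⟨0, by lia⟩, Finset.mem_univ _⟩
  · exact fun x hx => Finset.sum_eq_zero fun j _ => by rw [(h j).2.2.1 x hx, mul_zero]
  · intro v hv hc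
    have hvm : MemLp (∇ v) 2 volume :=
      (contDiff_gradient hv).continuous.memLp_of_hasCompactSupport (hasCompactSupport_gradient hc)
    have hi (j : Fin d) : Integrable fun x => (γ + D₁ x) * inner ℝ (G j x) (∇ v x) := by
      refine integrable_mul_inner (K := γ + K) (aestronglyMeasurable_const.add hm) ?_ (h j).2.1 hvm
      filter_upwards [hK] with x hx
      exact (abs_add_le _ _).trans (by rw [abs_of_pos hγ]; linarith)
    have hi' (j : Fin d) : Integrable fun x => D₁ x * inner ℝ (basisVec j) (∇ v x) := by
      have h1 : Integrable fun x => inner ℝ (basisVec j) (∇ v x) :=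
        (((contDiff_gradient hv).continuous.integrable_of_hasCompactSupport
          (hasCompactSupport_gradient hc)).const_inner _)
      exact h1.bdd_mul (c := K) hm hK
    have e1 (x : Space d) : (γ + D₁ x) * inner ℝ (∑ j, b j • G j x) (∇ v x)
        = ∑ j, b j * ((γ + D₁ x) * inner ℝ (G j x) (∇ v x)) := by
      rw [sum_inner, Finset.mul_sum]
      refine Finset.sum_congr rfl fun j _ => ?_
      rw [real_inner_smul_left]
      ring
    have e2 (x : Space d) : D₁ x * inner ℝ b (∇ v x)
        = ∑ j, b j * (D₁ x * inner ℝ (basisVec j) (∇ v x)) := by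
      conv_lhs => rw [← sum_smul_basisVec b]
      rw [sum_inner, Finset.mul_sum]
      refine Finset.sum_congr rfl fun j _ => ?_
      rw [real_inner_smul_left]
      ring
    simp only [e1, e2]
    rw [integral_finsetSum _ fun j _ => (hi j).const_mul _,
      integral_finsetSum _ fun j _ => (hi' j).const_mul _, ← Finset.sum_neg_distrib]
    refine Finset.sum_congr rfl fun j _ => ?_
    rw [integral_const_mul, integral_const_mul, (h j).2.2.2.2 v hv hc, mul_neg]
  · have e : (fun x => ∑ j, b j • G j x) = ∑ j, fun x => b j • G j x := by
      ext1 x; rw [Finset.sum_apply]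
    rw [e, Finset.sum_mul]
    refine (lpNorm_sum_le (fun j _ => (h j).2.1.const_smul (b j)) (by norm_num)).trans
      (Finset.sum_le_sum fun j _ => ?_)
    have e2 : lpNorm (fun x => b j • G j x) 2 volume = ‖b j‖ * lpNorm (G j) 2 volume :=
      lpNorm_const_smul (b j) (G j) volume
    refine e2.trans_le ?_
    rw [mul_comm]
    exact mul_le_mul_of_nonneg_left (PiLp.norm_apply_le b j) lpNorm_nonneg

/-- The prefactor `ε` cancels the `ε⁻¹` of the chain rule, so potentials scale while their gradients
are merely transplanted. -/
lemma gradient_rescale {w : Space d → ℝ} (hw : ContDiff ℝ ∞ w) (hε : 0 < ε) (x : Space d) :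
    ∇ (fun x => ε * w (ε⁻¹ • (x - x₀))) x = ∇ w (ε⁻¹ • (x - x₀)) := by
  refine ext_inner_right ℝ fun v => ?_
  rw [inner_gradient_left, inner_gradient_left]
  have h1 : HasFDerivAt (fun x : Space d => ε⁻¹ • (x - x₀))
      (ε⁻¹ • ContinuousLinearMap.id ℝ (Space d)) x :=
    ((hasFDerivAt_id x).sub_const x₀).const_smul ε⁻¹
  have h2 := ((hw.differentiable (by simp) (ε⁻¹ • (x - x₀))).hasFDerivAt.comp x h1).const_mul ε
  have h3 : fderiv ℝ (fun x => ε * w (ε⁻¹ • (x - x₀))) x = _ := h2.fderiv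
  rw [h3]
  simp [hε.ne']

lemma norm_rescale_le_iff (hε : 0 < ε) {r : ℝ} {x : Space d} :
    ε⁻¹ • (x - x₀) ∈ closedBall (0 : Space d) r ↔ x ∈ closedBall x₀ (ε * r) := by
  rw [mem_closedBall_zero_iff, mem_closedBall_iff_norm, norm_smul, norm_inv, Real.norm_eq_abs,
    abs_of_pos hε, inv_mul_le_iff₀ hε]

/-- A field without sources in `Ω` is orthogonal to the rescaled corrector. -/
lemma IsCompactCorrector.integral_rescale_eq_zero (hΩ : IsLipschitzDomain Ω) {D : Space d → ℝ}
    (hDb : IsBoundedCoeff Ω D) {F G : Space d → Space d} (hF : IsCompactCorrector γ R D₁ b F)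
    (hε : 0 < ε) (hB : closedBall x₀ (ε * (R + 1)) ⊆ Ω) (hR : 0 < R)
    {g : Space d → ℝ} (hG : MemLp G 2 (volume.restrict Ω)) (h : SolvesNeumann Ω D g G) :
    ∫ x in Ω, D x * inner ℝ (G x) (F (ε⁻¹ • (x - x₀))) = 0 := by
  obtain ⟨φ, hφ, hφ0⟩ := hF.weak
  obtain ⟨w, hw, hws, hwc, hlim⟩ :=
    exists_testFunction_approx hφ hF.memLp (isCompact_closedBall 0 R) hφ0
  -- Mollification enlarges the support by at most 1; hence the margin `R + 1` in the hypothesis on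
  -- the rescaled ball.
  have hws' (n : ℕ) : tsupport (w n) ⊆ closedBall 0 (R + 1) := by
    refine (hws n).trans ?_
    rw [cthickening_closedBall (by positivity) hR.le, add_comm]
    refine closedBall_subset_closedBall (add_le_add le_rfl ?_)
    rw [div_le_one (by positivity)]
    linarith [(Nat.cast_nonneg n : (0 : ℝ) ≤ n)]
  have hv (n : ℕ) : ContDiff ℝ ∞ fun x => ε * w n (ε⁻¹ • (x - x₀)) :=
    contDiff_const.mul ((hw n).comp (by fun_prop : ContDiff ℝ ∞ fun x => ε⁻¹ • (x - x₀)))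
  have hmw (n : ℕ) : AEStronglyMeasurable (fun x => ∇ (w n) x - F x) volume :=
    (contDiff_gradient (hw n)).continuous.aestronglyMeasurable.sub hF.memLp.1
  have hl : Tendsto (fun n => eLpNorm (fun x => ∇ (fun x => ε * w n (ε⁻¹ • (x - x₀))) x
      - F (ε⁻¹ • (x - x₀))) 2 (volume.restrict Ω)) atTop (𝓝 0) := by
    have h1 := ENNReal.Tendsto.const_mul (a := ENNReal.ofReal (√(ε ^ d))) hlim
      (Or.inr ENNReal.ofReal_ne_top)
    rw [mul_zero] at h1
    refine tendsto_of_tendsto_of_tendsto_of_le_of_le tendsto_const_nhds h1 (fun _ => zero_le)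
      fun n => ?_
    simp only [gradient_rescale (hw n) hε]
    rw [← eLpNorm_rescale x₀ hε (hmw n)]
    exact eLpNorm_mono_measure _ Measure.restrict_le_self
  refine tendsto_nhds_unique (IsGradientLimit.tendsto_integral hΩ.isBounded hDb hG hv
    ((memLp_rescale x₀ hε hF.memLp).restrict Ω) hl) (tendsto_const_nhds.congr fun n => ?_)
  rw [h _ (hv n), integral_boundary_eq_zero hΩ.isOpen]
  intro x hx
  have h0 : w n (ε⁻¹ • (x - x₀)) = 0 := image_eq_zero_of_notMem_tsupport fun h' =>
    hx (hB ((norm_rescale_le_iff hε).1 (hws' n h')))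
  simp only [h0, mul_zero]

lemma IsPerturbation.isBoundedCoeff_rescale (hD : IsPerturbation γ (ball 0 R) D₁) (x₀ : Space d)
    (hε : 0 < ε) (Ω : Set (Space d)) : IsBoundedCoeff Ω fun x => D₁ (ε⁻¹ • (x - x₀)) := by
  obtain ⟨K, hK0, hK⟩ := hD.exists_bound
  exact ⟨(hD.memLp.1.comp_quasiMeasurePreserving (quasiMeasurePreserving_rescale x₀ hε)).restrict,
    K, hK0, ae_restrict_of_ae ((quasiMeasurePreserving_rescale x₀ hε).ae hK)⟩

lemma IsPerturbation.rescale_eq_zero (hD : IsPerturbation γ (ball 0 R) D₁) (hR : 0 < R)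
    (x₀ : Space d) (hε : 0 < ε) : ∀ᵐ x, x ∉ closedBall x₀ (ε * R) → D₁ (ε⁻¹ • (x - x₀)) = 0 := by
  filter_upwards [(quasiMeasurePreserving_rescale x₀ hε).ae hD.vanish] with x hx h
  refine hx fun h' => h ?_
  rw [closure_ball _ hR.ne'] at h'
  exact (norm_rescale_le_iff hε).1 h'

lemma IsBoundedCoeff.const_add {D : Space d → ℝ} (h : IsBoundedCoeff Ω D) (c : ℝ) :
    IsBoundedCoeff Ω fun x => c + D x := by
  obtain ⟨hm, K, hK0, hK⟩ := h
  refine ⟨aestronglyMeasurable_const.add hm, |c| + K, by positivity, hK.mono fun x hx => ?_⟩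
  exact (abs_add_le _ _).trans (by linarith)

/-- The equation of the rescaled corrector. -/
lemma IsCompactCorrector.integral_rescale_eq (hΩ : IsLipschitzDomain Ω)
    (hD : IsPerturbation γ (ball 0 R) D₁) {F H : Space d → Space d}
    (hF : IsCompactCorrector γ R D₁ b F) (hε : 0 < ε) (hB : closedBall x₀ (ε * R) ⊆ Ω)
    (hR : 0 < R) (hH : IsGradientLimit Ω H) :
    ∫ x in Ω, (γ + D₁ (ε⁻¹ • (x - x₀))) * inner ℝ (F (ε⁻¹ • (x - x₀))) (H x)
      = - ∫ x in Ω, D₁ (ε⁻¹ • (x - x₀)) * inner ℝ b (H x) := by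
  obtain ⟨hH, w, hw, hwl⟩ := hH
  have hb := hD.isBoundedCoeff_rescale x₀ hε Ω
  have hbm : MemLp (fun _ => b) 2 (volume.restrict Ω) :=
    memLp_of_continuous_isBounded hΩ.isBounded continuous_const
  refine tendsto_nhds_unique (IsGradientLimit.tendsto_integral hΩ.isBounded (hb.const_add γ)
    ((memLp_rescale x₀ hε hF.memLp).restrict Ω) hw hH hwl) (Tendsto.congr (fun n => ?_)
    (IsGradientLimit.tendsto_integral hΩ.isBounded hb hbm hw hH hwl).neg)
  let χ : ContDiffBump (0 : Space d) := ⟨R + 1, R + 2, by linarith, by linarith⟩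
  -- `w n` is transported to the scale of the inclusion and cut off. The cutoff equals 1 near the
  -- closed ball of radius `R`, and both integrands vanish outside it, up to a null set.
  set v : Space d → ℝ := fun y => χ y * (ε⁻¹ * w n (x₀ + ε • y)) with hv
  have hvs : ContDiff ℝ ∞ v :=
    χ.contDiff.mul (contDiff_const.mul ((hw n).comp
      (by fun_prop : ContDiff ℝ ∞ fun y => x₀ + ε • y)))
  have hvc : HasCompactSupport v := χ.hasCompactSupport.mul_right
  have hgrad (y : Space d) (hy : y ∈ closedBall (0 : Space d) R) :
      ∇ v y = ∇ (w n) (x₀ + ε • y) := by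
    have h1 : v =ᶠ[𝓝 y] fun y => ε⁻¹ * w n (x₀ + ε • y) := by
      have h2 : ball (0 : Space d) (R + 1) ∈ 𝓝 y :=
        isOpen_ball.mem_nhds (closedBall_subset_ball (by linarith) hy)
      filter_upwards [h2] with z hz
      rw [hv]
      simp only
      rw [χ.one_of_mem_closedBall (ball_subset_closedBall hz), one_mul]
    -- The inverse map `y ↦ x₀ + ε y` is again a rescaling, with factor `ε⁻¹` and centre `-(ε⁻¹
    -- x₀)`.
    have h3 := gradient_rescale (x₀ := -(ε⁻¹ • x₀)) (hw n) (inv_pos.2 hε) y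
    have h4 (z : Space d) : ε⁻¹⁻¹ • (z - -(ε⁻¹ • x₀)) = x₀ + ε • z := by
      rw [inv_inv, sub_neg_eq_add, smul_add, smul_inv_smul₀ hε.ne', add_comm]
    simp only [h4] at h3
    rw [← h3, gradient, gradient, h1.fderiv_eq]
  have heq := hF.equation v hvs hvc
  have e1 : ∫ x in Ω, (γ + D₁ (ε⁻¹ • (x - x₀))) * inner ℝ (F (ε⁻¹ • (x - x₀))) (∇ (w n) x)
      = ε ^ d * ∫ x, (γ + D₁ x) * inner ℝ (F x) (∇ v x) := by
    rw [← integral_rescale x₀ hε, setIntegral_eq_integral_of_forall_compl_eq_zero]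
    · refine integral_congr_ae (Eventually.of_forall fun x => ?_)
      by_cases hx : ε⁻¹ • (x - x₀) ∈ closedBall (0 : Space d) R
      · simp only
        rw [hgrad _ hx, smul_inv_smul₀ hε.ne', add_sub_cancel]
      · simp only
        rw [hF.eq_zero _ hx, inner_zero_left, inner_zero_left]
    · intro x hx
      rw [hF.eq_zero _ fun h => hx (hB ((norm_rescale_le_iff hε).1 h)), inner_zero_left, mul_zero]
  have e2 : ∫ x in Ω, D₁ (ε⁻¹ • (x - x₀)) * inner ℝ b (∇ (w n) x)
      = ε ^ d * ∫ x, D₁ x * inner ℝ b (∇ v x) := by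
    have h0 := hD.rescale_eq_zero hR x₀ hε
    rw [← integral_rescale x₀ hε, setIntegral_eq_integral_of_ae_compl_eq_zero]
    · refine integral_congr_ae ?_
      filter_upwards [h0] with x h0
      by_cases hx : ε⁻¹ • (x - x₀) ∈ closedBall (0 : Space d) R
      · rw [hgrad _ hx, smul_inv_smul₀ hε.ne', add_sub_cancel]
      · rw [h0 fun h => hx ((norm_rescale_le_iff hε).2 h), zero_mul, zero_mul]
    · filter_upwards [h0] with x h0 hx
      rw [h0 fun h => hx (hB h), zero_mul]
  rw [e1, e2, heq, mul_neg]

end Correctors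

/-! ### The influence of the inclusion on the boundary values -/

section Influence

variable {d : ℕ} {γ R ε : ℝ} {D₀ D₁ : Space d → ℝ} {x₀ : Space d} {Ω B : Set (Space d)}

lemma IsBackground.isBoundedCoeff (hΩ : IsLipschitzDomain Ω) (h : IsBackground Ω D₀) :
    IsBoundedCoeff Ω D₀ := by
  have hc : ContinuousOn D₀ (closure Ω) := h.1.continuousOn
  obtain ⟨K, hK⟩ := (hΩ.isBounded.isCompact_closure.image_of_continuousOn hc).isBounded.exists_norm_le
  refine ⟨(hc.mono subset_closure).aestronglyMeasurable hΩ.isOpen.measurableSet, max K 0,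
    le_max_right _ _, ?_⟩
  refine (ae_restrict_iff' hΩ.isOpen.measurableSet).2 (Eventually.of_forall fun x hx => ?_)
  exact (hK _ ⟨x, subset_closure hx, rfl⟩).trans (le_max_left _ _)

lemma IsBoundedCoeff.add {D D' : Space d → ℝ} (h : IsBoundedCoeff Ω D) (h' : IsBoundedCoeff Ω D') :
    IsBoundedCoeff Ω fun x => D x + D' x := by
  obtain ⟨hm, K, hK0, hK⟩ := h
  obtain ⟨hm', K', hK0', hK'⟩ := h'
  refine ⟨hm.add hm', K + K', by positivity, ?_⟩
  filter_upwards [hK, hK'] with x hx hx'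
  exact (abs_add_le _ _).trans (add_le_add hx hx')

lemma IsBoundedCoeff.integrable {D : Space d → ℝ} (h : IsBoundedCoeff Ω D)
    {F G : Space d → Space d} (hF : MemLp F 2 (volume.restrict Ω))
    (hG : MemLp G 2 (volume.restrict Ω)) : IntegrableOn (fun x => D x * inner ℝ (F x) (G x)) Ω := by
  obtain ⟨hm, K, -, hK⟩ := h
  exact integrable_mul_inner hm hK hF hG

/-- Differentiability at `x₀` suffices, since only the deviation from the value at the centre is
needed. -/
lemma IsBackground.exists_abs_sub_le (hΩ : IsLipschitzDomain Ω) (h : IsBackground Ω D₀)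
    (hx₀ : x₀ ∈ Ω) : ∃ L δ : ℝ, 0 ≤ L ∧ 0 < δ ∧ ∀ x ∈ ball x₀ δ, |D₀ x - D₀ x₀| ≤ L * ‖x - x₀‖ := by
  have h1 : ContDiffAt ℝ ∞ D₀ x₀ :=
    (h.1.mono subset_closure).contDiffAt (hΩ.isOpen.mem_nhds hx₀)
  obtain ⟨L, hL0, hL⟩ := (h1.differentiableAt (by simp)).isBigO_sub.exists_nonneg
  obtain ⟨δ, hδ, hδL⟩ := Metric.eventually_nhds_iff.1 hL.bound
  exact ⟨L, δ, hL0, hδ, fun x hx => hδL hx⟩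

lemma lpNorm_restrict_mono {S S' : Set (Space d)} (h : S ⊆ S') {F : Space d → Space d}
    (hF : MemLp F 2 (volume.restrict S')) :
    lpNorm F 2 (volume.restrict S) ≤ lpNorm F 2 (volume.restrict S') := by
  have hm := Measure.restrict_mono_set (volume : Measure (Space d)) h
  rw [← toReal_eLpNorm hF.1, ← toReal_eLpNorm (hF.1.mono_measure hm)]
  exact ENNReal.toReal_mono hF.2.ne (eLpNorm_mono_measure _ hm)

lemma abs_setIntegral_mul_inner_le (hB : MeasurableSet B) (hΩ : MeasurableSet Ω) (hBΩ : B ⊆ Ω)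
    {D : Space d → ℝ} {K : ℝ} (hK0 : 0 ≤ K) {F G : Space d → Space d}
    (hK : ∀ᵐ x, x ∈ B → |D x| ≤ K) (h0 : ∀ᵐ x, x ∉ B → D x * inner ℝ (F x) (G x) = 0)
    (hF : MemLp F 2 (volume.restrict Ω)) (hG : MemLp G 2 (volume.restrict Ω)) :
    |∫ x in Ω, D x * inner ℝ (F x) (G x)|
      ≤ K * (lpNorm F 2 (volume.restrict B) * lpNorm G 2 (volume.restrict B)) := by
  have hm := Measure.restrict_mono_set (volume : Measure (Space d)) hBΩ
  rw [setIntegral_eq_of_subset_of_ae_sdiff_eq_zero hΩ.nullMeasurableSet hBΩ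
    (h0.mono fun x hx h => hx h.2)]
  exact abs_integral_mul_inner_le hK0 ((ae_restrict_iff' hB).2 hK) (hF.mono_measure hm)
    (hG.mono_measure hm)

/-- Source of the factors `ε^{d/2}`: a pointwise bound times the square root of the volume of the
inclusion. -/
lemma lpNorm_restrict_closedBall_le (hε : 0 < ε) (hR : 0 ≤ R) {F : Space d → Space d} {M : ℝ}
    (hM : 0 ≤ M) (hFm : AEStronglyMeasurable F (volume.restrict (closedBall x₀ (ε * R))))
    (hF : ∀ᵐ x, x ∈ closedBall x₀ (ε * R) → ‖F x‖ ≤ M) :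
    lpNorm F 2 (volume.restrict (closedBall x₀ (ε * R)))
      ≤ M * (√(ε ^ d) * √(volume.real (closedBall (0 : Space d) R))) := by
  have hF' : ∀ᵐ x ∂(volume.restrict (closedBall x₀ (ε * R))), ‖F x‖ ≤ M :=
    (ae_restrict_iff' measurableSet_closedBall).2 hF
  have hfin : IsFiniteMeasure (volume.restrict (closedBall x₀ (ε * R))) :=
    ⟨by rw [Measure.restrict_apply_univ]; exact measure_closedBall_lt_top⟩
  have hFp : MemLp F 2 (volume.restrict (closedBall x₀ (ε * R))) := MemLp.of_bound hFm M hF'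
  refine abs_le_of_sq_le_sq' ?_ (by positivity) |>.2
  rw [← integral_norm_sq_eq_lpNorm hFp, mul_pow, mul_pow, Real.sq_sqrt (by positivity),
    Real.sq_sqrt measureReal_nonneg]
  have hv : volume.real (closedBall x₀ (ε * R))
      = ε ^ d * volume.real (closedBall (0 : Space d) R) := by
    rw [measureReal_def, Measure.addHaar_closedBall_mul _ _ hε.le hR, ENNReal.toReal_mul,
      ENNReal.toReal_ofReal (by positivity), finrank_euclideanSpace_fin, measureReal_def]
  rw [← hv]
  calc ∫ x in closedBall x₀ (ε * R), ‖F x‖ ^ 2 ≤ ∫ _ in closedBall x₀ (ε * R), M ^ 2 := by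
        refine integral_mono_ae ((memLp_two_iff_integrable_sq_norm hFm).1 hFp)
          (integrable_const _) ?_
        filter_upwards [hF'] with x hx
        exact pow_le_pow_left₀ (norm_nonneg _) hx 2
    _ = M ^ 2 * volume.real (closedBall x₀ (ε * R)) := by
        rw [setIntegral_const, smul_eq_mul, mul_comm]

/-- The perturbation of the field is controlled by the background field on the inclusion. -/
lemma mul_lpNorm_sub_le (hΩ : IsLipschitzDomain Ω) (hB : MeasurableSet B) (hBΩ : B ⊆ Ω)
    {D : Space d → ℝ} {K m : ℝ} (hK0 : 0 ≤ K) (hK : ∀ᵐ x, |D x| ≤ K)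
    (hDB : ∀ᵐ x, x ∉ B → D x = 0) (hD : IsBoundedCoeff Ω D) (hD₀ : IsBoundedCoeff Ω D₀)
    (hm : ∀ᵐ x ∂(volume.restrict Ω), m ≤ D₀ x + D x) {g : Space d → ℝ} {G G₀ : Space d → Space d}
    (hG : IsGradientLimit Ω G) (hG₀ : IsGradientLimit Ω G₀)
    (h : SolvesNeumann Ω (fun x => D₀ x + D x) g G) (h₀ : SolvesNeumann Ω D₀ g G₀) :
    m * lpNorm (fun x => G x - G₀ x) 2 (volume.restrict Ω)
      ≤ K * lpNorm G₀ 2 (volume.restrict B) := by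
  have hE := hG.sub hΩ.isBounded hG₀
  set E := fun x => G x - G₀ x with hEd
  have hDD := hD₀.add hD
  have h1 := h.integral_eq hΩ.isBounded hDD hD₀ hG.1 hG₀.1 h₀ hE
  -- The difference of the fields satisfies the perturbed equation with source `-D G₀`, supported in
  -- `B`, so the energy estimate sees `G₀` only on `B`.
  have e1 : ∫ x in Ω, (D₀ x + D x) * inner ℝ (E x) (E x)
      = - ∫ x in Ω, D x * inner ℝ (G₀ x) (E x) := by
    have e2 : ∫ x in Ω, (D₀ x + D x) * inner ℝ (E x) (E x)
        = ∫ x in Ω, ((D₀ x + D x) * inner ℝ (G x) (E x)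
          - (D₀ x * inner ℝ (G₀ x) (E x) + D x * inner ℝ (G₀ x) (E x))) := by
      refine integral_congr_ae (Eventually.of_forall fun x => ?_)
      simp only
      conv_lhs => rw [hEd]
      simp only
      rw [inner_sub_left]
      ring
    have i1 : IntegrableOn (fun x => D₀ x * inner ℝ (G₀ x) (E x) + D x * inner ℝ (G₀ x) (E x)) Ω :=
      (hD₀.integrable hG₀.1 hE.1).add (hD.integrable hG₀.1 hE.1)
    rw [e2, integral_sub (hDD.integrable hG.1 hE.1) i1,
      integral_add (hD₀.integrable hG₀.1 hE.1) (hD.integrable hG₀.1 hE.1), h1]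
    ring
  have h2 := abs_setIntegral_mul_inner_le hB hΩ.isOpen.measurableSet hBΩ hK0
    (hK.mono fun x hx _ => hx) (hDB.mono fun x hx h' => by rw [hx h', zero_mul]) hG₀.1 hE.1
  obtain ⟨hDm, K', -, hK'⟩ := hDD
  have h3 := mul_lpNorm_sq_le_integral hDm hK' hm hE.1
  rw [e1] at h3
  have h4 := lpNorm_restrict_mono hBΩ hE.1
  have h5 : m * lpNorm E 2 (volume.restrict Ω) ^ 2
      ≤ K * (lpNorm G₀ 2 (volume.restrict B) * lpNorm E 2 (volume.restrict Ω)) :=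
    (h3.trans (neg_le_abs _)).trans (h2.trans (mul_le_mul_of_nonneg_left
      (mul_le_mul_of_nonneg_left h4 lpNorm_nonneg) hK0))
  rcases (lpNorm_nonneg : 0 ≤ lpNorm E 2 (volume.restrict Ω)).eq_or_lt with h0 | h0
  · rw [← h0, mul_zero]
    exact mul_nonneg hK0 lpNorm_nonneg
  · refine le_of_mul_le_mul_right ?_ h0
    nlinarith [h5]

/-- The influence of the perturbation, tested with a solution of the background problem. -/
lemma integral_sub_eq_neg (hΩ : IsLipschitzDomain Ω) {D : Space d → ℝ}
    (hD : IsBoundedCoeff Ω D) (hD₀ : IsBoundedCoeff Ω D₀) {g : Space d → ℝ}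
    {F G G₀ : Space d → Space d} (hF : IsGradientLimit Ω F)
    (hG : IsGradientLimit Ω G) (hG₀ : IsGradientLimit Ω G₀)
    (h : SolvesNeumann Ω (fun x => D₀ x + D x) g G) (h₀ : SolvesNeumann Ω D₀ g G₀) :
    ∫ x in Ω, D₀ x * inner ℝ (F x) (G x - G₀ x) = - ∫ x in Ω, D x * inner ℝ (F x) (G x) := by
  have h1 := h.integral_eq hΩ.isBounded (hD₀.add hD) hD₀ hG.1 hG₀.1 h₀ hF
  have e1 : ∫ x in Ω, D₀ x * inner ℝ (F x) (G x - G₀ x)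
      = ∫ x in Ω, ((D₀ x + D x) * inner ℝ (G x) (F x) - D₀ x * inner ℝ (G₀ x) (F x)
        - D x * inner ℝ (F x) (G x)) := by
    refine integral_congr_ae (Eventually.of_forall fun x => ?_)
    simp only
    rw [inner_sub_right, real_inner_comm (G x) (F x), real_inner_comm (G₀ x) (F x)]
    ring
  have i1 := (hD₀.add hD).integrable hG.1 hF.1
  have i2 := hD₀.integrable hG₀.1 hF.1
  have i3 : IntegrableOn (fun x => (D₀ x + D x) * inner ℝ (G x) (F x)
      - D₀ x * inner ℝ (G₀ x) (F x)) Ω := i1.sub i2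
  rw [e1, integral_sub i3 (hD.integrable hF.1 hG.1), integral_sub i1 i2, h1, sub_self,
    zero_sub]

/-- The leading order of the influence is removed by the rescaled corrector. -/
lemma IsCompactCorrector.integral_eq (hΩ : IsLipschitzDomain Ω) (hR : 0 < R)
    (hD : IsPerturbation γ (ball 0 R) D₁) (hD₀ : IsBoundedCoeff Ω D₀) (hε : 0 < ε)
    (hB : closedBall x₀ (ε * (R + 1)) ⊆ Ω) {g : Space d → ℝ} {F G Ψ : Space d → Space d}
    {b : Space d} (hΨ : IsCompactCorrector γ R D₁ b Ψ)
    (hF : MemLp F 2 (volume.restrict Ω)) (hG : IsGradientLimit Ω G)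
    (h : SolvesNeumann Ω (fun x => D₀ x + D₁ (ε⁻¹ • (x - x₀))) g G) :
    ∫ x in Ω, D₁ (ε⁻¹ • (x - x₀)) * inner ℝ (F x) (G x)
      = (∫ x in Ω, D₁ (ε⁻¹ • (x - x₀)) * inner ℝ (F x - b) (G x))
        + ∫ x in Ω, (D₀ x - γ) * inner ℝ (Ψ (ε⁻¹ • (x - x₀))) (G x) := by
  have hDε := hD.isBoundedCoeff_rescale x₀ hε Ω
  have hBR : closedBall x₀ (ε * R) ⊆ Ω :=
    (closedBall_subset_closedBall (mul_le_mul_of_nonneg_left (by linarith) hε.le)).trans hB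
  have hbm : MemLp (fun _ => b) 2 (volume.restrict Ω) :=
    memLp_of_continuous_isBounded hΩ.isBounded continuous_const
  have hΨm := (memLp_rescale x₀ hε hΨ.memLp).restrict Ω
  have h1 := hΨ.integral_rescale_eq_zero hΩ (hD₀.add hDε) hε hB hR hG.1 h
  have h2 := hΨ.integral_rescale_eq hΩ hD hε hBR hR hG
  have e1 : ∫ x in Ω, D₁ (ε⁻¹ • (x - x₀)) * inner ℝ (F x) (G x)
      = (∫ x in Ω, D₁ (ε⁻¹ • (x - x₀)) * inner ℝ (F x - b) (G x))
        + ∫ x in Ω, D₁ (ε⁻¹ • (x - x₀)) * inner ℝ b (G x) := by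
    have hFb : MemLp (fun x => F x - b) 2 (volume.restrict Ω) := hF.sub hbm
    rw [← integral_add (hDε.integrable hFb hG.1) (hDε.integrable hbm hG.1)]
    refine integral_congr_ae (Eventually.of_forall fun x => ?_)
    simp only
    rw [inner_sub_left]
    ring
  -- Since `D₀ - γ = (D₀ + D₁^ε) - (γ + D₁^ε)`, the first part vanishes by the equation of `u^ε` and
  -- the second is given by that of the corrector.
  have e2 : ∫ x in Ω, (D₀ x - γ) * inner ℝ (Ψ (ε⁻¹ • (x - x₀))) (G x)
      = (∫ x in Ω, (D₀ x + D₁ (ε⁻¹ • (x - x₀))) * inner ℝ (G x) (Ψ (ε⁻¹ • (x - x₀))))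
        - ∫ x in Ω, (γ + D₁ (ε⁻¹ • (x - x₀))) * inner ℝ (Ψ (ε⁻¹ • (x - x₀))) (G x) := by
    rw [← integral_sub ((hD₀.add hDε).integrable hG.1 hΨm) ((hDε.const_add γ).integrable hΨm hG.1)]
    refine integral_congr_ae (Eventually.of_forall fun x => ?_)
    simp only
    rw [real_inner_comm (Ψ (ε⁻¹ • (x - x₀))) (G x)]
    ring
  rw [e1, e2, h1, h2]
  ring

/-- The influence of a neutral inclusion, tested with solutions of the background problem. -/
theorem exists_abs_integral_le (hd : 2 ≤ d) (hγ : 0 < γ) (hR : 0 < R)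
    (hD : IsPerturbation γ (ball 0 R) D₁) (hs : IsSphericallySymmetric D₁)
    (hM : LeadingTensorVanishes γ (ball 0 R) D₁) (hΩ : IsLipschitzDomain Ω)
    (hD₀ : IsBackground Ω D₀) (hx₀ : x₀ ∈ Ω) (hDγ : D₀ x₀ = γ) :
    ∃ C ε₀ : ℝ, 0 ≤ C ∧ 0 < ε₀ ∧ ∀ ε, 0 < ε → ε ≤ ε₀ → ∀ (g T : Space d → ℝ)
      (F G G₀ : Space d → Space d), IsNeumannData Ω g → IsNeumannData Ω T →
      IsGradientLimit Ω F → IsGradientLimit Ω G → IsGradientLimit Ω G₀ →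
      SolvesNeumann Ω D₀ T F → SolvesNeumann Ω (perturbedCoeff D₀ D₁ x₀ ε) g G →
      SolvesNeumann Ω D₀ g G₀ →
      ∫ x in Ω, D₀ x * inner ℝ (F x) (G x - G₀ x)
        ≤ C * ε ^ (d + 1) * (lpNorm T 2 (surfaceMeasure Ω) * lpNorm g 2 (surfaceMeasure Ω)) := by
  have hD₀b := hD₀.isBoundedCoeff hΩ
  obtain ⟨c₀, hc₀, hDc₀⟩ := hD₀.2
  obtain ⟨c, hc, hDc⟩ := hD.elliptic
  obtain ⟨K, hK0, hK⟩ := hD.exists_bound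
  obtain ⟨L, δ, hL0, hδ, hL⟩ := hD₀.exists_abs_sub_le hΩ hx₀
  obtain ⟨Cb, hCb0, hCb⟩ := hΩ.exists_abs_integral_boundary_le
  obtain ⟨Cc, hCc0, hCc⟩ := exists_compactCorrector hd hγ hR hD hs hM
  obtain ⟨ρ, Cr, hρ, hCr0, hρΩ, hCr⟩ := exists_regularity hΩ.isOpen
    (hD₀.1.mono subset_closure) (fun x hx => (hc₀.trans_le (hDc₀ x (subset_closure hx))).ne') hx₀
  set κ := √(volume.real (closedBall (0 : Space d) R)) with hκ
  -- Ellipticity of the perturbed coefficient uniformly in `ε`: half of `c` is given up on the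
  -- inclusion to the variation of `D₀`, and `c₀` serves elsewhere.
  set m := min (c / 2) c₀ with hm
  have hm0 : 0 < m := lt_min (by positivity) hc₀
  -- The three terms put the enlarged inclusion inside the regularity ball, put it inside the ball
  -- where `D₀` is compared with `γ`, and make that variation at most `c / 2`.
  set ε₀ := min (min (ρ / (2 * (R + 1))) (δ / (2 * (R + 1)))) (c / (2 * (L * R + 1))) with hε₀
  set A := (K * (Cr * R * κ) + L * R * (Cc * Cr)) * ((1 + K / m) * (Cr * (1 + ρ) * κ)) with hA
  have hA0 : 0 ≤ A := by positivity
  refine ⟨A * (Cb / c₀) ^ 2, ε₀, by positivity, by positivity,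
    fun ε hε hεle g T F G G₀ hg hT hF hG hG₀ hsF hsG hsG₀ => ?_⟩
  have hε1 : ε * (R + 1) < ρ := by
    have : ε ≤ ρ / (2 * (R + 1)) := hεle.trans ((min_le_left _ _).trans (min_le_left _ _))
    rw [le_div_iff₀ (by positivity)] at this
    nlinarith [mul_pos hε (by linarith : 0 < R + 1)]
  have hε2 : ε * (R + 1) < δ := by
    have : ε ≤ δ / (2 * (R + 1)) := hεle.trans ((min_le_left _ _).trans (min_le_right _ _))
    rw [le_div_iff₀ (by positivity)] at this
    nlinarith [mul_pos hε (by linarith : 0 < R + 1)]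
  have hε3 : L * (ε * R) ≤ c / 2 := by
    have : ε ≤ c / (2 * (L * R + 1)) := hεle.trans (min_le_right _ _)
    rw [le_div_iff₀ (by positivity)] at this
    nlinarith
  have hεR : ε * R < ε * (R + 1) := mul_lt_mul_of_pos_left (by linarith) hε
  set B := closedBall x₀ (ε * R) with hBdef
  have hBρ : closedBall x₀ (ε * (R + 1)) ⊆ ball x₀ ρ := closedBall_subset_ball hε1
  have hB1 : closedBall x₀ (ε * (R + 1)) ⊆ Ω := hBρ.trans hρΩ
  have hBB : B ⊆ closedBall x₀ (ε * (R + 1)) := closedBall_subset_closedBall hεR.le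
  have hBΩ : B ⊆ Ω := hBB.trans hB1
  have hBm : MeasurableSet B := measurableSet_closedBall
  have hDε := hD.isBoundedCoeff_rescale x₀ hε Ω
  have hDε0 := hD.rescale_eq_zero hR x₀ hε
  have hDεK : ∀ᵐ x, |D₁ (ε⁻¹ • (x - x₀))| ≤ K := (quasiMeasurePreserving_rescale x₀ hε).ae hK
  have hDεc : ∀ᵐ x, c ≤ γ + D₁ (ε⁻¹ • (x - x₀)) := (quasiMeasurePreserving_rescale x₀ hε).ae hDc
  have hDL (x : Space d) (hx : x ∈ B) : |D₀ x - γ| ≤ L * (ε * R) := by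
    rw [← hDγ]
    exact (hL x (closedBall_subset_ball hε2 (hBB hx))).trans
      (mul_le_mul_of_nonneg_left (mem_closedBall_iff_norm.1 hx) hL0)
  have hell : ∀ᵐ x ∂(volume.restrict Ω), m ≤ D₀ x + D₁ (ε⁻¹ • (x - x₀)) := by
    refine (ae_restrict_iff' hΩ.isOpen.measurableSet).2 ?_
    filter_upwards [hDε0, hDεc] with x h0 h1 hx
    by_cases hxB : x ∈ B
    · refine (min_le_left _ _).trans ?_
      have := (abs_le.1 (hDL x hxB)).1
      linarith
    · rw [h0 hxB, add_zero]
      exact (min_le_right _ _).trans (hDc₀ x (subset_closure hx))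
  have hell₀ : ∀ᵐ x ∂(volume.restrict Ω), c₀ ≤ D₀ x :=
    (ae_restrict_iff' hΩ.isOpen.measurableSet).2
      (Eventually.of_forall fun x hx => hDc₀ x (subset_closure hx))
  have hnF : lpNorm F 2 (volume.restrict Ω) ≤ Cb / c₀ * lpNorm T 2 (surfaceMeasure Ω) := by
    have := hsF.mul_lpNorm_le hΩ hD₀b hell₀ (hCb T hT) hCb0 hF
    rw [div_mul_eq_mul_div, le_div_iff₀ hc₀]
    linarith
  have hnG₀ : lpNorm G₀ 2 (volume.restrict Ω) ≤ Cb / c₀ * lpNorm g 2 (surfaceMeasure Ω) := by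
    have := hsG₀.mul_lpNorm_le hΩ hD₀b hell₀ (hCb g hg) hCb0 hG₀
    rw [div_mul_eq_mul_div, le_div_iff₀ hc₀]
    linarith
  have hrestr {H : Space d → Space d} (hH : MemLp H 2 (volume.restrict Ω)) :
      MemLp H 2 (volume.restrict B) := hH.mono_measure (Measure.restrict_mono_set _ hBΩ)
  -- the fields near the inclusion
  obtain ⟨f, hfae, hf0, hfl⟩ := hCr F (hsF.isSolutionField hΩ hF)
  obtain ⟨f₀, hf₀ae, hf₀0, hf₀l⟩ := hCr G₀ (hsG₀.isSolutionField hΩ hG₀)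
  set nF := lpNorm F 2 (volume.restrict Ω) with hnFd
  set nG := lpNorm G₀ 2 (volume.restrict Ω) with hnGd
  have hnF0 : 0 ≤ nF := lpNorm_nonneg
  have hnG0 : 0 ≤ nG := lpNorm_nonneg
  set s := √(ε ^ d) with hsdef
  have hs0 : 0 ≤ s := Real.sqrt_nonneg _
  have hκ0 : 0 ≤ κ := Real.sqrt_nonneg _
  have hG₀B : lpNorm G₀ 2 (volume.restrict B) ≤ (Cr * (1 + ρ) * nG) * (s * κ) := by
    refine lpNorm_restrict_closedBall_le hε hR.le (by positivity) (hrestr hG₀.1).1 ?_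
    filter_upwards [hf₀ae] with x hx hxB
    have hxρ := hBρ (hBB hxB)
    rw [hx hxρ]
    have h1 : ‖f₀ x‖ ≤ ‖f₀ x₀‖ + ‖f₀ x - f₀ x₀‖ := by
      have := norm_add_le (f₀ x₀) (f₀ x - f₀ x₀)
      rwa [add_sub_cancel] at this
    have h2 : Cr * nG * ‖x - x₀‖ ≤ Cr * nG * ρ :=
      mul_le_mul_of_nonneg_left (mem_ball_iff_norm.1 hxρ).le (by positivity)
    linarith [hf₀l x]
  -- Here `F` minus its value at `x₀` gains a factor `ε R` from the Lipschitz bound, beyond the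
  -- factor `ε^{d/2}` from the volume.
  have hFB : lpNorm (fun x => F x - f x₀) 2 (volume.restrict B)
      ≤ (Cr * nF * (ε * R)) * (s * κ) := by
    refine lpNorm_restrict_closedBall_le hε hR.le (by positivity)
      ((hrestr hF.1).1.sub aestronglyMeasurable_const) ?_
    filter_upwards [hfae] with x hx hxB
    rw [hx (hBρ (hBB hxB))]
    exact (hfl x).trans (mul_le_mul_of_nonneg_left (mem_closedBall_iff_norm.1 hxB) (by positivity))
  have hE := hG.sub hΩ.isBounded hG₀
  have hEn := mul_lpNorm_sub_le hΩ hBm hBΩ hK0 hDεK hDε0 hDε hD₀b hell hG hG₀ hsG hsG₀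
  -- No pointwise bound is available for the perturbed field, so its norm on the inclusion is
  -- obtained from that of `G₀` and the energy estimate for the difference.
  have hGB : lpNorm G 2 (volume.restrict B) ≤ (1 + K / m) * ((Cr * (1 + ρ) * nG) * (s * κ)) := by
    have h1 : lpNorm G 2 (volume.restrict B)
        ≤ lpNorm G₀ 2 (volume.restrict B) + lpNorm (fun x => G x - G₀ x) 2 (volume.restrict B) :=
      lpNorm_le_lpNorm_add_lpNorm_sub' (hrestr hG₀.1) (by norm_num)
    have h2 := lpNorm_restrict_mono hBΩ hE.1
    have h3 : lpNorm (fun x => G x - G₀ x) 2 (volume.restrict Ω)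
        ≤ K / m * lpNorm G₀ 2 (volume.restrict B) := by
      rw [div_mul_eq_mul_div, le_div_iff₀ hm0]
      linarith
    calc _ ≤ (1 + K / m) * lpNorm G₀ 2 (volume.restrict B) := by linarith
      _ ≤ _ := mul_le_mul_of_nonneg_left hG₀B (by positivity)
  -- the corrector
  obtain ⟨Ψ, hΨ, hΨn⟩ := hCc (f x₀)
  have hΨm := (memLp_rescale x₀ hε hΨ.memLp).restrict Ω
  have hΨB : lpNorm (fun x => Ψ (ε⁻¹ • (x - x₀))) 2 (volume.restrict B) ≤ s * (Cc * (Cr * nF)) :=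
    (lpNorm_restrict_rescale_le x₀ hε hΨ.memLp B).trans
      (mul_le_mul_of_nonneg_left (hΨn.trans (mul_le_mul_of_nonneg_left hf0 hCc0)) hs0)
  have hbm : MemLp (fun _ => f x₀) 2 (volume.restrict Ω) :=
    memLp_of_continuous_isBounded hΩ.isBounded continuous_const
  have hFb : MemLp (fun x => F x - f x₀) 2 (volume.restrict Ω) := hF.1.sub hbm
  have I1 := abs_setIntegral_mul_inner_le hBm hΩ.isOpen.measurableSet hBΩ hK0
    (hDεK.mono fun x hx _ => hx) (hDε0.mono fun x hx h' => by rw [hx h', zero_mul])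
    hFb hG.1
  have I2 : |∫ x in Ω, (D₀ x - γ) * inner ℝ (Ψ (ε⁻¹ • (x - x₀))) (G x)| ≤ _ :=
    abs_setIntegral_mul_inner_le hBm hΩ.isOpen.measurableSet hBΩ
      (by positivity : 0 ≤ L * (ε * R)) (Eventually.of_forall hDL)
      (Eventually.of_forall fun x hx => by
        rw [hΨ.eq_zero _ fun h => hx ((norm_rescale_le_iff hε).1 h), inner_zero_left, mul_zero])
      hΨm hG.1
  rw [integral_sub_eq_neg hΩ hDε hD₀b hF hG hG₀ hsG hsG₀,
    hΨ.integral_eq hΩ hR hD hD₀b hε hB1 hF.1 hG hsG]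
  have hGB0 : 0 ≤ lpNorm G 2 (volume.restrict B) := lpNorm_nonneg
  set Y := (1 + K / m) * ((Cr * (1 + ρ) * nG) * (s * κ)) with hY
  have hY0 : 0 ≤ Y := by positivity
  have J1 := I1.trans (mul_le_mul_of_nonneg_left
    (mul_le_mul hFB hGB hGB0 (by positivity)) hK0)
  have J2 := I2.trans (mul_le_mul_of_nonneg_left
    (mul_le_mul hΨB hGB hGB0 (by positivity)) (by positivity))
  have hss : s * s = ε ^ d := Real.mul_self_sqrt (by positivity)
  -- Each term carries one factor `ε`, from `F - F(x₀)` or from `D₀ - γ`, and two factors `s =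
  -- ε^{d/2}`.
  calc _ ≤ K * (Cr * nF * (ε * R) * (s * κ) * Y) + L * (ε * R) * (s * (Cc * (Cr * nF)) * Y) := by
        linarith [neg_le_abs (∫ x in Ω, D₁ (ε⁻¹ • (x - x₀)) * inner ℝ (F x - f x₀) (G x)),
          neg_le_abs (∫ x in Ω, (D₀ x - γ) * inner ℝ (Ψ (ε⁻¹ • (x - x₀))) (G x))]
    _ = A * (ε * (s * s)) * (nF * nG) := by rw [hY, hA]; ring
    _ = A * ε ^ (d + 1) * (nF * nG) := by rw [hss, pow_succ, mul_comm ε]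
    _ ≤ A * ε ^ (d + 1) * ((Cb / c₀ * lpNorm T 2 (surfaceMeasure Ω))
        * (Cb / c₀ * lpNorm g 2 (surfaceMeasure Ω))) :=
      mul_le_mul_of_nonneg_left (mul_le_mul hnF hnG₀ hnG0 (hnF0.trans hnF)) (by positivity)
    _ = _ := by ring

/-- The smooth approximations that define the trace also place the weak gradient in the space where
the equations extend by density. -/
lemma IsTrace.isGradientLimit {u T : Space d → ℝ} {G : Space d → Space d} (h : IsTrace Ω u G T)
    (hu : MemH1 Ω u G) : IsGradientLimit Ω G := by
  obtain ⟨-, w, hw, -, hl, -⟩ := h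
  exact ⟨hu.2.2, w, hw, hl⟩

/-- Green's formula for the trace of the difference of two solutions. -/
lemma SolvesNeumann.integral_trace_sub (hΩ : IsLipschitzDomain Ω) (hD₀ : IsBoundedCoeff Ω D₀)
    {u u₀ T T₀ g : Space d → ℝ} {F G G₀ : Space d → Space d} (hF : MemLp F 2 (volume.restrict Ω))
    (hg : MemLp g 2 (surfaceMeasure Ω)) (h : SolvesNeumann Ω D₀ g F)
    (hG : MemLp G 2 (volume.restrict Ω)) (hG₀ : MemLp G₀ 2 (volume.restrict Ω))
    (hT : IsTrace Ω u G T) (hT₀ : IsTrace Ω u₀ G₀ T₀) :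
    ∫ x, g x * (T x - T₀ x) ∂(surfaceMeasure Ω)
      = ∫ x in Ω, D₀ x * inner ℝ (F x) (G x - G₀ x) := by
  obtain ⟨hT, w, hw, -, hwG, hwT⟩ := hT
  obtain ⟨hT₀, v, hv, -, hvG, hvT⟩ := hT₀
  have hwv (n : ℕ) : ContDiff ℝ ∞ fun x => w n x - v n x := (hw n).sub (hv n)
  have e (n : ℕ) (x : Space d) : ∇ (fun x => w n x - v n x) x = ∇ (w n) x - ∇ (v n) x :=
    gradient_sub ((hw n).differentiable (by simp) x) ((hv n).differentiable (by simp) x)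
  have h1 := tendsto_eLpNorm_sub_sub (fun n => (memLp_gradient hΩ.isBounded (hw n)).1)
    (fun n => (memLp_gradient hΩ.isBounded (hv n)).1) hG.1 hG₀.1 hwG hvG
  simp only [← e] at h1
  have h2 := IsGradientLimit.tendsto_integral hΩ.isBounded hD₀ hF hwv (hG.sub hG₀) h1
  have hm (z : Space d → ℝ) (hz : ContDiff ℝ ∞ z) : MemLp z 2 (surfaceMeasure Ω) :=
    memLp_surfaceMeasure_of_continuous hΩ hz.continuous
  have h3 := tendsto_eLpNorm_sub_sub (fun n => (hm _ (hw n)).1) (fun n => (hm _ (hv n)).1)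
    hT.1 hT₀.1 hwT hvT
  have h4 := tendsto_integral_mul_inner_right (D := fun _ => 1) (K := 1)
    aestronglyMeasurable_const (Eventually.of_forall fun _ => by simp) (hT.sub hT₀)
    (fun n => hm _ (hwv n)) hg h3
  have hi (a b : ℝ) : inner ℝ a b = a * b := by simp [mul_comm]
  simp only [one_mul, hi] at h4
  refine tendsto_nhds_unique h4 (h2.congr fun n => ?_)
  rw [h _ (hwv n)]

/-- The difference of the traces is itself used as Neumann data of the background problem; its mean
is zero because both traces have mean zero. Green's formula turns its squared norm into the bilinear
quantity already estimated, and one factor of the norm cancels. -/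
theorem boundaryInfluenceOrderSucc (hd : 2 ≤ d) (hγ : 0 < γ) (hR : 0 < R)
    (hD : IsPerturbation γ (ball 0 R) D₁) (hs : IsSphericallySymmetric D₁)
    (hM : LeadingTensorVanishes γ (ball 0 R) D₁) (hΩ : IsLipschitzDomain Ω)
    (hD₀ : IsBackground Ω D₀) (hx₀ : x₀ ∈ Ω) (hDγ : D₀ x₀ = γ) :
    BoundaryInfluenceOrderSucc Ω D₀ D₁ x₀ := by
  obtain ⟨C, ε₀, hC0, hε₀, hC⟩ := exists_abs_integral_le hd hγ hR hD hs hM hΩ hD₀ hx₀ hDγ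
  -- The addition of 1 makes the constant strictly positive.
  refine ⟨C + 1, ε₀, by positivity, hε₀, fun ε hε hεle g Tε T₀ hg hTε hT₀ => ?_⟩
  obtain ⟨u, G, hu, hTr, hmean, heq⟩ := hTε
  obtain ⟨u₀, G₀, hu₀, hTr₀, hmean₀, heq₀⟩ := hT₀
  have hfin := hΩ.isFiniteMeasure_surfaceMeasure
  have hTm : MemLp (fun x => Tε x - T₀ x) 2 (surfaceMeasure Ω) := hTr.1.sub hTr₀.1
  have hT : IsNeumannData Ω fun x => Tε x - T₀ x := by
    refine ⟨hTm, ?_⟩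
    rw [integral_sub (hTr.1.integrable (by norm_num)) (hTr₀.1.integrable (by norm_num)), hmean,
      hmean₀, sub_zero]
  obtain ⟨c₀, hc₀, hDc₀⟩ := hD₀.2
  have hell₀ : ∀ᵐ x ∂(volume.restrict Ω), c₀ ≤ D₀ x :=
    (ae_restrict_iff' hΩ.isOpen.measurableSet).2
      (Eventually.of_forall fun x hx => hDc₀ x (subset_closure hx))
  have hD₀b := hD₀.isBoundedCoeff hΩ
  obtain ⟨F, hF, hsF⟩ := exists_solvesNeumann hΩ hD₀b hc₀ hell₀ hT
  have h1 := hC ε hε hεle g _ F G G₀ hg hT hF (hTr.isGradientLimit hu) (hTr₀.isGradientLimit hu₀)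
    hsF heq heq₀
  rw [← hsF.integral_trace_sub hΩ hD₀b hF.1 hTm hu.2.2 hu₀.2.2 hTr hTr₀] at h1
  set t := lpNorm (fun x => Tε x - T₀ x) 2 (surfaceMeasure Ω) with ht
  have h2 : ∫ x, (Tε x - T₀ x) * (Tε x - T₀ x) ∂(surfaceMeasure Ω) = t ^ 2 := by
    rw [ht, ← integral_norm_sq_eq_lpNorm hTm]
    refine integral_congr_ae (Eventually.of_forall fun x => ?_)
    simp only [Real.norm_eq_abs, sq_abs]
    ring
  rw [h2] at h1
  have ht0 : 0 ≤ t := lpNorm_nonneg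
  have hg0 : 0 ≤ lpNorm g 2 (surfaceMeasure Ω) := lpNorm_nonneg
  have h3 : t ≤ (C + 1) * ε ^ (d + 1) * lpNorm g 2 (surfaceMeasure Ω) := by
    rcases ht0.eq_or_lt with h0 | h0
    · rw [← h0]; positivity
    · refine le_of_mul_le_mul_right ?_ h0
      have : 0 ≤ ε ^ (d + 1) * lpNorm g 2 (surfaceMeasure Ω) * t := by positivity
      nlinarith [h1]
  rw [← ENNReal.ofReal_toReal hTm.2.ne, ← ENNReal.ofReal_toReal hg.1.2.ne,
    ← ENNReal.ofReal_mul (by positivity), toReal_eLpNorm hTm.1, toReal_eLpNorm hg.1.1]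
  exact ENNReal.ofReal_le_ofReal h3

end Influence

end

end SmallInclusion

theorem proposition2p10 (d : ℕ) (hd : 2 ≤ d) (γ R : ℝ) (hγ : 0 < γ) (hR : 0 < R) :
    (∃ D₁ : SmallInclusion.Space d → ℝ,
      SmallInclusion.IsPerturbation γ (Metric.ball 0 R) D₁ ∧
      SmallInclusion.IsSphericallySymmetric D₁ ∧
      ¬ (D₁ =ᵐ[MeasureTheory.volume] fun _ => 0) ∧
      SmallInclusion.LeadingTensorVanishes γ (Metric.ball 0 R) D₁) ∧
    (∀ D₁ : SmallInclusion.Space d → ℝ,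
      SmallInclusion.IsPerturbation γ (Metric.ball 0 R) D₁ →
      SmallInclusion.IsSphericallySymmetric D₁ →
      SmallInclusion.LeadingTensorVanishes γ (Metric.ball 0 R) D₁ →
      ∀ (Ω : Set (SmallInclusion.Space d)) (D₀ : SmallInclusion.Space d → ℝ)
        (x₀ : SmallInclusion.Space d),
        SmallInclusion.IsLipschitzDomain Ω → SmallInclusion.IsBackground Ω D₀ →
        x₀ ∈ Ω → D₀ x₀ = γ →
        SmallInclusion.BoundaryInfluenceOrderSucc Ω D₀ D₁ x₀) := by
  refine ⟨SmallInclusion.exists_neutral hd hγ hR, fun D₁ hD hs hM Ω D₀ x₀ hΩ hD₀ hx₀ hDγ => ?_⟩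
  exact SmallInclusion.boundaryInfluenceOrderSucc hd hγ hR hD hs hM hΩ hD₀ hx₀ hDγ
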